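/- **Setting.** Let $M$ be a smooth manifold (finite-dimensional, Hausdorff, $\sigma$-compact, without boundary). An *exact Courant algebroid* on $M$ is a smooth vector bundle $\mathcal TM\to M$ with a smooth fibrewise non-degenerate symmetric bilinear form $\langle\cdot,\cdot\rangle$, a smooth bundle map $a:\mathcal TM\to TM$ and an $\mathbb R$-bilinear bracket $*$ on sections such that, for all sections $\mathfrak X,\mathfrak Y,\mathfrak Z$, $$\mathfrak X*(\mathfrak Y*\mathfrak Z)=(\mathfrak X*\mathfrak Y)*\mathfrak Z+\mathfrak Y*(\mathfrak X*\mathfrak Z),$$ $$a(\mathfrak X)\langle\mathfrak Y,\mathfrak Z\rangle=\langle\mathfrak X,\mathfrak Y*\mathfrak Z+\mathfrak Z*\mathfrak Y\rangle=\langle\mathfrak X*\mathfrak Y,\mathfrak Z\rangle+\langle\mathfrak Y,\mathfrak X*\mathfrak Z\rangle,$$ and such that $0\to T^*M\to\mathcal TM\xrightarrow{a}TM\to0$ is exact, where $\xi\in T^*_xM$ is identified with the element of $\mathcal T_xM$ satisfying $2\langle\xi,w\rangle=\xi(a(w))$ for all $w$. Let $\mathcal I(M)$ be the set of smooth splittings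 $s:TM\to\mathcal TM$ of $a$ with isotropic image. A 2-form $B$ acts on it by $(s+B)(X)=s(X)+\iota_XB$. For $s\in\mathcal I(M)$ put $H_s(X,Y,Z)=2\langle s(X),s(Y)*s(Z)\rangle$, which is a 3-form, and write a section as $\mathfrak X=s(X)+\xi$ with $X=a(\mathfrak X)$ and $\xi\in\Omega^1(M)$. A *spinor* is a family $\rho=(\rho_s)_{s\in\mathcal I(M)}$ of differential forms with $\rho_{s+B}=e^B\wedge\rho_s$; let $\mathcal S^\bullet(M)$ be the $\mathbb Z/2$-graded space of spinors. On it one has $$(d_{\mathcal T}\rho)_s=d\rho_s-H_s\wedge\rho_s,\qquad(\iota_{\mathfrak X}\rho)_s=\iota_X\rho_s+\xi\wedge\rho_s,\qquad(\mathcal L_{\mathfrak X}\rho)_s=\mathcal L_X\rho_s+(d\xi-\iota_XH_s)\wedge\rho_s .$$ **Group action.** Let $G$ be a compact Lie group with Lie algebra $\mathfrak g$ (left-invariant vector fields), acting smoothly on $M$ and, covering this, smoothly on $\mathcal TM$ by bundle automorphisms that preserve $\langle\cdot,\cdot\rangle$, $a$ and $*$. Assume that $G$ acts by *extended symmetries*: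 there is a linear map $\delta:\mathfrak g\to\Gamma(\mathcal TM)$ such that, for each $\tau\in\mathfrak g$, $a(\delta(\tau))=X_\tau$ is the vector field generating $x\mapsto\exp(t\tau)x$ and the infinitesimal action of $\tau$ on $\Gamma(\mathcal TM)$ is $\mathfrak Y\mapsto-\delta(\tau)*\mathfrak Y$. Assume that the action is *isotropic*: $\langle\delta(\tau),\delta(\sigma)\rangle=0$ for all $\tau,\sigma\in\mathfrak g$. Let $\tau_1,\dots,\tau_r$ be a basis of $\mathfrak g$ with dual basis $u_1,\dots,u_r$, and let $\widehat S(\mathfrak g^*)=\mathbb R[[u_1,\dots,u_r]]$, which has even parity. **Complexes.** The *extended equivariant Cartan complex* is $$C^\bullet_{\mathfrak g}(\mathcal TM;\delta)=\{\rho\in\mathcal S^\bullet(M)\otimes\widehat S(\mathfrak g^*)\mid\mathcal L_{\delta(\tau)}\rho(\tau)=0\text{ as a formal power series in }\tau\in\mathfrak g\},\qquad d_{\mathcal T,\delta}=d_{\mathcal T}-\sum_ju_j\iota_{\delta(\tau_j)},$$ with $\mathbb Z/2$-graded cohomology $H^\bullet_G(\mathcal TM)$. The ordinary Cartan complex is $$C^\bullet_{\mathfrak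 g}(M)=\{\alpha\in\Omega^\bullet(M)\otimes\widehat S(\mathfrak g^*)\mid\mathcal L_{X_\tau}\alpha(\tau)=0\text{ as a formal power series in }\tau\in\mathfrak g\},\qquad d_G=d-\sum_ju_j\iota_{X_{\tau_j}}.$$ For $H_G\in C_{\mathfrak g}(M)$ of total degree $3$ ($u_j$ having degree $2$) with $d_GH_G=0$, the *$H_G$-twisted equivariant cohomology* $H^\bullet_G(M;H_G)$ is the $\mathbb Z/2$-graded cohomology of $C^\bullet_{\mathfrak g}(M)$ with the differential $d_G-H_G\wedge$. **Statement.** There is $H_G\in C_{\mathfrak g}(M)$, homogeneous of total degree $3$ with $d_GH_G=0$, such that $$H^\bullet_G(\mathcal TM)\cong H^\bullet_G(M;H_G)$$ as $\mathbb Z/2$-graded vector spaces, compatibly with the products $[\rho]\mapsto[\rho\wedge\alpha]$ by the closed elements $\alpha$ of $C^\bullet_{\mathfrak g}(M)$. If moreover $\delta([\tau,\sigma])=-\delta(\tau)*\delta(\sigma)$ for all $\tau,\sigma\in\mathfrak g$ (the sign arises because $\tau\mapsto X_\tau$ reverses brackets), then the same $H_G$ is $\mathfrak g$-invariant, and the same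 conclusion holds when, in all three complexes, the condition $\mathcal L_{\delta(\tau)}\rho(\tau)=0$, respectively $\mathcal L_{X_\tau}\alpha(\tau)=0$, is replaced by invariance under $\mathfrak g$, acting on coefficients through $\mathcal L_{\delta(\tau)}$, respectively $\mathcal L_{X_\tau}$, and on $\widehat S(\mathfrak g^*)$ by the coadjoint action. -/

import Mathlib

/-- Alternating `A`-multilinear forms of degree `n` on a Lie-Rinehart algebra `L` over `A`.  When
`A` is the algebra of smooth functions and `L` the Lie algebra of smooth vector fields of a
manifold, these are the differential `n`-forms. -/
abbrev Form (A L : Type*) [CommRing A] [AddCommGroup L] [Module A L] (n : ℕ) : Type _ :=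
  L [⋀^Fin n]→ₗ[A] A

/-- Inhomogeneous forms.  (A form of degree larger than the dimension vanishes, so for a manifold
the product over all degrees is the direct sum.) -/
abbrev Forms (A L : Type*) [CommRing A] [AddCommGroup L] [Module A L] : Type _ :=
  (n : ℕ) → Form A L n

namespace Form

section Cartan

set_option linter.unusedSectionVars false

variable {A L : Type*} [CommRing A] [Algebra ℝ A] [LieRing L] [LieAlgebra ℝ L] [Module A L]
  [LieRingModule L A] [LieRinehartRing A L] [LieRinehartAlgebra ℝ A L] {n : ℕ}

/-- The Lie derivative of a form:
`(L_X ω)(v) = X (ω (v)) - ∑ i, ω (v_1, …, [X, v_i], …, v_n)`. -/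
def lieDeriv (X : L) (ω : Form A L n) : Form A L n :=
  { MultilinearMap.mk' (fun v : Fin n → L => ⁅X, ω v⁆ - ∑ i, ω (Function.update v i ⁅X, v i⁆))
      (by
        intro v j x y
        have h : ∀ z : L, ∑ i, ω (Function.update (Function.update v j z) i
              ⁅X, Function.update v j z i⁆) =
            ω (Function.update v j ⁅X, z⁆) + ∑ i ∈ Finset.univ.erase j,
              ω (Function.update (Function.update v i ⁅X, v i⁆) j z) := by
          intro z
          rw [← Finset.add_sum_erase _ _ (Finset.mem_univ j)]
          congr 1
          · simp
          · refine Finset.sum_congr rfl fun i hi => ?_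
            have hij : i ≠ j := (Finset.mem_erase.mp hi).1
            rw [Function.update_of_ne hij, Function.update_comm hij.symm]
        simp only [h, AlternatingMap.map_update_add, lie_add, Finset.sum_add_distrib]
        abel)
      (by
        intro v j c x
        have h : ∀ z : L, ∑ i, ω (Function.update (Function.update v j z) i
              ⁅X, Function.update v j z i⁆) =
            ω (Function.update v j ⁅X, z⁆) + ∑ i ∈ Finset.univ.erase j,
              ω (Function.update (Function.update v i ⁅X, v i⁆) j z) := by
          intro z
          rw [← Finset.add_sum_erase _ _ (Finset.mem_univ j)]
          congr 1
          · simp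
          · refine Finset.sum_congr rfl fun i hi => ?_
            have hij : i ≠ j := (Finset.mem_erase.mp hi).1
            rw [Function.update_of_ne hij, Function.update_comm hij.symm]
        simp only [h, AlternatingMap.map_update_add, AlternatingMap.map_update_smul,
          LieRinehartRing.leibniz_smul_right, smul_eq_mul,
          LieRinehartRing.leibniz_mul_right, ← Finset.mul_sum]
        ring) with
    map_eq_zero_of_eq' := by
      intro v i j hv hij
      have h0 : ∀ k, k ≠ i → k ≠ j → ω (Function.update v k ⁅X, v k⁆) = 0 := by
        intro k hi hj
        refine ω.map_eq_zero_of_eq _ ?_ hij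
        rw [Function.update_of_ne hi.symm, Function.update_of_ne hj.symm, hv]
      have h1 : ω (Function.update v i ⁅X, v i⁆) + ω (Function.update v j ⁅X, v j⁆) = 0 := by
        have := ω.map_swap (Function.update v i ⁅X, v i⁆) hij
        have e : Function.update v i ⁅X, v i⁆ ∘ Equiv.swap i j = Function.update v j ⁅X, v j⁆ := by
          funext k
          by_cases hk : k = j
          · subst hk; simp [hv]
          · by_cases hk' : k = i
            · subst hk'; simp [hij, hv, Function.update_of_ne hij.symm]
            · simp [Equiv.swap_apply_of_ne_of_ne hk' hk, Function.update_of_ne hk,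
                Function.update_of_ne hk']
        rw [e] at this
        rw [this]; ring
      change ⁅X, ω v⁆ - ∑ k, ω (Function.update v k ⁅X, v k⁆) = 0
      rw [ω.map_eq_zero_of_eq v hv hij, lie_zero,
        Fintype.sum_eq_add i j hij (fun k hk => h0 k hk.1 hk.2), h1, sub_zero] }

theorem lieDeriv_apply (X : L) (ω : Form A L n) (v : Fin n → L) :
    lieDeriv X ω v = ⁅X, ω v⁆ - ∑ i, ω (Function.update v i ⁅X, v i⁆) := rfl

theorem lieDeriv_add_left (X Y : L) (ω : Form A L n) :
    lieDeriv (X + Y) ω = lieDeriv X ω + lieDeriv Y ω := by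
  ext v
  simp only [lieDeriv_apply, AlternatingMap.add_apply, add_lie, AlternatingMap.map_update_add,
    Finset.sum_add_distrib]
  abel

theorem lieDeriv_add (X : L) (ω η : Form A L n) :
    lieDeriv X (ω + η) = lieDeriv X ω + lieDeriv X η := by
  ext v
  simp only [lieDeriv_apply, AlternatingMap.add_apply, lie_add, Finset.sum_add_distrib]
  abel

theorem lieDeriv_real_smul (X : L) (c : ℝ) (ω : Form A L n) :
    lieDeriv X (c • ω) = c • lieDeriv X ω := by
  ext v
  simp only [lieDeriv_apply, AlternatingMap.smul_apply, lie_smul, smul_sub, Finset.smul_sum]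

theorem lieDeriv_smul (X : L) (f : A) (ω : Form A L n) :
    lieDeriv X (f • ω) = f • lieDeriv X ω + ⁅X, f⁆ • ω := by
  ext v
  simp only [lieDeriv_apply, AlternatingMap.smul_apply, AlternatingMap.add_apply, smul_eq_mul,
    LieRinehartRing.leibniz_mul_right, ← Finset.mul_sum]
  ring

theorem lieDeriv_smul_left (f : A) (X : L) (ω : Form A L n) (v : Fin n → L) :
    lieDeriv (f • X) ω v =
      f * lieDeriv X ω v + ∑ i, ⁅v i, f⁆ * ω (Function.update v i X) := by
  have h : ∀ Y : L, ⁅f • X, Y⁆ = f • ⁅X, Y⁆ + (-⁅Y, f⁆) • X := by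
    intro Y
    rw [← lie_skew, LieRinehartRing.leibniz_smul_right, ← lie_skew X Y, smul_neg, neg_smul, neg_add]
  simp only [lieDeriv_apply, h, AlternatingMap.map_update_add, AlternatingMap.map_update_smul,
    LieRinehartRing.lie_smul_eq_mul, Finset.sum_add_distrib, smul_eq_mul, neg_mul,
    Finset.sum_neg_distrib, ← Finset.mul_sum]
  ring

/-- The value of the exterior derivative of a form, given by the action of vector fields on
functions in degree zero and by Cartan's formula `ι_X (d ω) = L_X ω - d (ι_X ω)` in positive
degree. -/
def extDerivAux : (n : ℕ) → Form A L n → (Fin (n + 1) → L) → A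
  | 0, f, v => ⁅v 0, f ![]⁆
  | n + 1, ω, v =>
      lieDeriv (v 0) ω (Fin.tail v) - extDerivAux n (ω.curryLeft (v 0)) (Fin.tail v)

theorem extDerivAux_add (ω η : Form A L n) (v : Fin (n + 1) → L) :
    extDerivAux n (ω + η) v = extDerivAux n ω v + extDerivAux n η v := by
  induction n with
  | zero => simp [extDerivAux]
  | succ n ih =>
    simp only [extDerivAux, lieDeriv_add, AlternatingMap.curryLeft_add, LinearMap.add_apply, ih,
      AlternatingMap.add_apply]
    abel

theorem extDerivAux_real_smul (c : ℝ) (ω : Form A L n) (v : Fin (n + 1) → L) :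
    extDerivAux n (c • ω) v = c • extDerivAux n ω v := by
  induction n with
  | zero => simp [extDerivAux]
  | succ n ih =>
    have : (c • ω).curryLeft (v 0) = c • ω.curryLeft (v 0) := rfl
    simp only [extDerivAux, lieDeriv_real_smul, this, ih, AlternatingMap.smul_apply, smul_sub]

/-- The value of `df ∧ ω`. -/
def dMulAux (f : A) : (n : ℕ) → Form A L n → (Fin (n + 1) → L) → A
  | 0, g, v => ⁅v 0, f⁆ * g ![]
  | n + 1, ω, v => ⁅v 0, f⁆ * ω (Fin.tail v) - dMulAux f n (ω.curryLeft (v 0)) (Fin.tail v)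

theorem dMulAux_neg (f : A) (ω : Form A L n) (v : Fin (n + 1) → L) :
    dMulAux f n (-ω) v = -dMulAux f n ω v := by
  induction n with
  | zero => simp [dMulAux]
  | succ n ih =>
    have : (-ω).curryLeft (v 0) = -ω.curryLeft (v 0) := rfl
    simp only [dMulAux, this, ih, AlternatingMap.neg_apply]
    ring

theorem curryLeft_swap (ω : Form A L (n + 2)) (X Y : L) :
    (ω.curryLeft X).curryLeft Y = -(ω.curryLeft Y).curryLeft X := by
  have h := AlternatingMap.curryLeft_same ω (X + Y)
  simp only [map_add, AlternatingMap.curryLeft_add, LinearMap.add_apply,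
    AlternatingMap.curryLeft_same, zero_add, add_zero] at h
  exact eq_neg_of_add_eq_zero_right h

theorem vecCons_tail (v : Fin (n + 1) → L) : Matrix.vecCons (v 0) (Fin.tail v) = v :=
  Fin.cons_self_tail v

theorem vecCons_update (X : L) (t : Fin n → L) (i : Fin n) (y : L) :
    Matrix.vecCons X (Function.update t i y) = Function.update (Matrix.vecCons X t) i.succ y :=
  Fin.cons_update ..

theorem dMulAux_curryLeft (f : A) (X : L) (ω : Form A L (n + 1)) (v : Fin (n + 1) → L) :
    dMulAux f n (ω.curryLeft X) v = ∑ i, ⁅v i, f⁆ * ω (Function.update v i X) := by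
  induction n with
  | zero =>
    simp only [dMulAux, AlternatingMap.curryLeft_apply_apply, Fin.sum_univ_succ, Fin.sum_univ_zero,
      add_zero]
    congr 2
    funext i
    fin_cases i
    simp
  | succ n ih =>
    rw [dMulAux, curryLeft_swap, dMulAux_neg, ih, Fin.sum_univ_succ (n := n + 1), sub_neg_eq_add]
    congr 1
    · rw [AlternatingMap.curryLeft_apply_apply]
      congr 2
      exact (Fin.update_cons_zero (v 0) (Fin.tail v) X).symm.trans (by rw [Fin.cons_self_tail])
    · refine Finset.sum_congr rfl fun i _ => ?_
      rw [AlternatingMap.curryLeft_apply_apply, vecCons_update, vecCons_tail]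
      rfl

theorem extDerivAux_smul (f : A) (ω : Form A L n) (v : Fin (n + 1) → L) :
    extDerivAux n (f • ω) v = f * extDerivAux n ω v + dMulAux f n ω v := by
  induction n with
  | zero => simp [extDerivAux, dMulAux, LieRinehartRing.leibniz_mul_right]
  | succ n ih =>
    simp only [extDerivAux, dMulAux, lieDeriv_smul, AlternatingMap.curryLeft_smul,
      LinearMap.smul_apply, ih, AlternatingMap.add_apply, AlternatingMap.smul_apply, smul_eq_mul]
    ring

theorem tail_update_zero (v : Fin (n + 1) → L) (x : L) :
    Fin.tail (Function.update v 0 x) = Fin.tail v := by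
  funext i; simp [Fin.tail]

theorem tail_update_succ (v : Fin (n + 1) → L) (i : Fin n) (x : L) :
    Fin.tail (Function.update v i.succ x) = Function.update (Fin.tail v) i x :=
  Fin.tail_update_succ ..

theorem update_succ_zero (v : Fin (n + 1) → L) (i : Fin n) (x : L) :
    Function.update v i.succ x 0 = v 0 :=
  Function.update_of_ne (Fin.succ_ne_zero i).symm _ _

theorem extDerivAux_update_add (ω : Form A L n) (v : Fin (n + 1) → L) (j : Fin (n + 1))
    (x y : L) : extDerivAux n ω (Function.update v j (x + y)) =
      extDerivAux n ω (Function.update v j x) + extDerivAux n ω (Function.update v j y) := by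
  induction n with
  | zero =>
    have : j = 0 := Fin.fin_one_eq_zero j
    subst this
    simp [extDerivAux]
  | succ n ih =>
    refine Fin.cases ?_ (fun j => ?_) j
    · simp only [extDerivAux, tail_update_zero, Function.update_self, map_add, extDerivAux_add,
        lieDeriv_add_left, AlternatingMap.add_apply]
      abel
    · simp only [extDerivAux, tail_update_succ, update_succ_zero, ih,
        AlternatingMap.map_update_add]
      abel

theorem extDerivAux_update_smul (ω : Form A L n) (v : Fin (n + 1) → L) (j : Fin (n + 1))
    (c : A) (x : L) : extDerivAux n ω (Function.update v j (c • x)) =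
      c • extDerivAux n ω (Function.update v j x) := by
  induction n with
  | zero =>
    have : j = 0 := Fin.fin_one_eq_zero j
    subst this
    simp [extDerivAux]
  | succ n ih =>
    refine Fin.cases ?_ (fun j => ?_) j
    · simp only [extDerivAux, tail_update_zero, Function.update_self, map_smul, extDerivAux_smul,
        lieDeriv_smul_left, dMulAux_curryLeft, smul_eq_mul]
      ring
    · simp only [extDerivAux, tail_update_succ, update_succ_zero, ih,
        AlternatingMap.map_update_smul, smul_sub]

theorem lieDeriv_cons_self (X : L) (ω : Form A L (n + 1)) (t : Fin n → L) :
    lieDeriv X ω (Matrix.vecCons X t) = lieDeriv X (ω.curryLeft X) t := by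
  rw [lieDeriv_apply, lieDeriv_apply, Fin.sum_univ_succ]
  have h0 : ω (Function.update (Matrix.vecCons X t) 0 ⁅X, Matrix.vecCons X t 0⁆) = 0 :=
    ω.map_coord_zero 0 (by simp)
  rw [h0, zero_add]
  congr 1
  refine Finset.sum_congr rfl fun i _ => ?_
  rw [AlternatingMap.curryLeft_apply_apply, vecCons_update]
  rfl

theorem extDerivAux_curryLeft_zero (X : L) (ω : Form A L (n + 1)) (w : Fin (n + 1) → L)
    (h : w 0 = X) : lieDeriv X ω w = extDerivAux n (ω.curryLeft X) w := by
  have hw : Matrix.vecCons X (Fin.tail w) = w := by rw [← h, vecCons_tail]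
  rw [← hw, lieDeriv_cons_self]
  cases n with
  | zero => simp [extDerivAux, lieDeriv_apply, Subsingleton.elim (Fin.tail w) ![]]
  | succ n =>
    have hz : ∀ u, extDerivAux n (0 : Form A L n) u = 0 := fun u => by
      simpa using extDerivAux_real_smul (0 : ℝ) (0 : Form A L n) u
    simp only [extDerivAux, Matrix.cons_val_zero, AlternatingMap.curryLeft_same, hz, sub_zero]
    rfl

theorem extDerivAux_eq_zero (ω : Form A L n) (v : Fin (n + 1) → L) (i j : Fin (n + 1))
    (hv : v i = v j) (hij : i ≠ j) : extDerivAux n ω v = 0 := by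
  induction n with
  | zero => exact absurd ((Fin.fin_one_eq_zero i).trans (Fin.fin_one_eq_zero j).symm) hij
  | succ n ih =>
    have key : ∀ (X : L) (w : Fin (n + 1) → L) (k : Fin (n + 1)), w k = X →
        lieDeriv X ω w = extDerivAux n (ω.curryLeft X) w := by
      intro X w k hk
      let D : Form A L (n + 1) :=
        { MultilinearMap.mk' (extDerivAux n (ω.curryLeft X))
            (fun v j x y => extDerivAux_update_add _ v j x y)
            (fun v j c x => extDerivAux_update_smul _ v j c x) with
          map_eq_zero_of_eq' := fun v i j hv hij => ih (ω.curryLeft X) v i j hv hij }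
      change lieDeriv X ω w = D w
      by_cases hk0 : k = 0
      · subst hk0
        exact extDerivAux_curryLeft_zero X ω w hk
      · have h1 := (lieDeriv X ω).map_swap w hk0
        have h2 := D.map_swap w hk0
        have h3 : lieDeriv X ω (w ∘ Equiv.swap k 0) = D (w ∘ Equiv.swap k 0) :=
          extDerivAux_curryLeft_zero X ω _ (by simp [hk])
        rw [h1, h2] at h3
        exact neg_injective h3
    rw [extDerivAux]
    induction i using Fin.cases with
    | zero =>
      induction j using Fin.cases with
      | zero => exact absurd rfl hij
      | succ j => rw [key (v 0) (Fin.tail v) j hv.symm, sub_self]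
    | succ i =>
      induction j using Fin.cases with
      | zero => rw [key (v 0) (Fin.tail v) i hv, sub_self]
      | succ j =>
        have hij' : i ≠ j := fun h => hij (h ▸ rfl)
        rw [ih _ (Fin.tail v) i j hv hij',
          (lieDeriv (v 0) ω).map_eq_zero_of_eq (Fin.tail v) hv hij', sub_zero]

/-- The exterior derivative of a form. -/
def extDeriv (ω : Form A L n) : Form A L (n + 1) :=
  { MultilinearMap.mk' (extDerivAux n ω)
      (fun v j x y => extDerivAux_update_add ω v j x y)
      (fun v j c x => extDerivAux_update_smul ω v j c x) with
    map_eq_zero_of_eq' := fun v i j hv hij => extDerivAux_eq_zero ω v i j hv hij }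

theorem extDeriv_apply_zero (f : Form A L 0) (v : Fin 1 → L) : extDeriv f v = ⁅v 0, f ![]⁆ := rfl

theorem extDeriv_apply_succ (ω : Form A L (n + 1)) (v : Fin (n + 2) → L) :
    extDeriv ω v = lieDeriv (v 0) ω (Fin.tail v) - extDeriv (ω.curryLeft (v 0)) (Fin.tail v) := rfl

end Cartan
end Form

namespace Forms

section Operators

set_option linter.unusedSectionVars false

variable {A L : Type*} [CommRing A] [Algebra ℝ A] [LieRing L] [LieAlgebra ℝ L] [Module A L]
  [LieRingModule L A] [LieRinehartRing A L] [LieRinehartAlgebra ℝ A L]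

noncomputable section

/-- The form `η` of degree `n`, as an inhomogeneous form. -/
def ofForm {n : ℕ} (η : Form A L n) : Forms A L := Pi.single n η

/-- The forms with components only in the degrees of parity `p`. -/
def parity (p : ZMod 2) : Submodule ℝ (Forms A L) where
  carrier := {ρ | ∀ n : ℕ, (n : ZMod 2) ≠ p → ρ n = 0}
  zero_mem' := fun _ _ => rfl
  add_mem' := fun {a b} ha hb n hn => by simp [ha n hn, hb n hn]
  smul_mem' := fun c a ha n hn => by simp [ha n hn]

/-- The interior product `ι_X`. -/
def contract (X : L) : Forms A L →ₗ[ℝ] Forms A L where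
  toFun ρ n := (ρ (n + 1)).curryLeft X
  map_add' _ _ := rfl
  map_smul' _ _ := rfl

/-- The Lie derivative `L_X`. -/
def lieD (X : L) : Forms A L →ₗ[ℝ] Forms A L where
  toFun ρ n := Form.lieDeriv X (ρ n)
  map_add' ρ σ := funext fun n => Form.lieDeriv_add X (ρ n) (σ n)
  map_smul' c ρ := funext fun n => Form.lieDeriv_real_smul X c (ρ n)

/-- The exterior derivative `d`. -/
def d : Forms A L →ₗ[ℝ] Forms A L where
  toFun ρ
    | 0 => 0
    | n + 1 => Form.extDeriv (ρ n)
  map_add' ρ σ := by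
    funext n
    cases n with
    | zero => simp
    | succ n => ext v; exact Form.extDerivAux_add (ρ n) (σ n) v
  map_smul' c ρ := by
    funext n
    cases n with
    | zero => simp
    | succ n => ext v; exact Form.extDerivAux_real_smul c (ρ n) v

/-- The grading involution: multiplication by `(-1)^n` in degree `n`. -/
def sgn (ρ : Forms A L) : Forms A L := fun n => (-1 : A) ^ n • ρ n

/-- The value in degree `n` of the wedge product, given by the product of functions in degree zero
and by the Leibniz rule `ι_X (α ∧ β) = ι_X α ∧ β + (-1)^|α| α ∧ ι_X β`. -/
def wedgeAux : (n : ℕ) → Forms A L → Forms A L → (Fin n → L) → A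
  | 0, α, β, _ => α 0 ![] * β 0 ![]
  | n + 1, α, β, v => wedgeAux n (contract (v 0) α) β (Fin.tail v) +
      wedgeAux n (sgn α) (contract (v 0) β) (Fin.tail v)

theorem contract_add_left (X Y : L) (ρ : Forms A L) :
    contract (X + Y) ρ = contract X ρ + contract Y ρ :=
  funext fun n => map_add (ρ (n + 1)).curryLeft X Y

theorem contract_smul_left (f : A) (X : L) (ρ : Forms A L) :
    contract (f • X) ρ = f • contract X ρ :=
  funext fun n => map_smul (ρ (n + 1)).curryLeft f X

theorem contract_smul (f : A) (X : L) (ρ : Forms A L) :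
    contract X (f • ρ) = f • contract X ρ := rfl

theorem contract_contract (X : L) (ρ : Forms A L) : contract X (contract X ρ) = 0 :=
  funext fun n => AlternatingMap.curryLeft_same (ρ (n + 2)) X

theorem sgn_add (ρ σ : Forms A L) : sgn (ρ + σ) = sgn ρ + sgn σ :=
  funext fun n => smul_add _ (ρ n) (σ n)

theorem sgn_smul (f : A) (ρ : Forms A L) : sgn (f • ρ) = f • sgn ρ :=
  funext fun n => smul_comm _ f (ρ n)

theorem sgn_real_smul (c : ℝ) (ρ : Forms A L) : sgn (c • ρ) = c • sgn ρ :=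
  funext fun n => smul_comm _ c (ρ n)

theorem sgn_sgn (ρ : Forms A L) : sgn (sgn ρ) = ρ :=
  funext fun n => by
    change (-1 : A) ^ n • (-1 : A) ^ n • ρ n = ρ n
    rw [smul_smul, ← mul_pow]; simp

theorem contract_sgn (X : L) (ρ : Forms A L) : contract X (sgn ρ) = -sgn (contract X ρ) := by
  funext n
  change (-1 : A) ^ (n + 1) • (ρ (n + 1)).curryLeft X = -((-1 : A) ^ n • (ρ (n + 1)).curryLeft X)
  rw [pow_succ, mul_smul, neg_smul, one_smul, smul_neg]

theorem wedgeAux_add_left (n : ℕ) (α α' β : Forms A L) (v : Fin n → L) :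
    wedgeAux n (α + α') β v = wedgeAux n α β v + wedgeAux n α' β v := by
  induction n generalizing α α' β with
  | zero => simp [wedgeAux, add_mul]
  | succ n ih => simp only [wedgeAux, map_add, sgn_add, ih]; abel

theorem wedgeAux_add_right (n : ℕ) (α β β' : Forms A L) (v : Fin n → L) :
    wedgeAux n α (β + β') v = wedgeAux n α β v + wedgeAux n α β' v := by
  induction n generalizing α β β' with
  | zero => simp [wedgeAux, mul_add]
  | succ n ih => simp only [wedgeAux, map_add, ih]; abel

theorem wedgeAux_smul_left (n : ℕ) (f : A) (α β : Forms A L) (v : Fin n → L) :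
    wedgeAux n (f • α) β v = f * wedgeAux n α β v := by
  induction n generalizing α β with
  | zero => simp [wedgeAux, mul_assoc]
  | succ n ih => simp only [wedgeAux, contract_smul, sgn_smul, ih, mul_add]

theorem wedgeAux_smul_right (n : ℕ) (f : A) (α β : Forms A L) (v : Fin n → L) :
    wedgeAux n α (f • β) v = f * wedgeAux n α β v := by
  induction n generalizing α β with
  | zero => simp [wedgeAux, mul_left_comm]
  | succ n ih => simp only [wedgeAux, contract_smul, ih, mul_add]

theorem wedgeAux_real_smul_left (n : ℕ) (c : ℝ) (α β : Forms A L) (v : Fin n → L) :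
    wedgeAux n (c • α) β v = c • wedgeAux n α β v := by
  induction n generalizing α β with
  | zero => simp [wedgeAux]
  | succ n ih => simp only [wedgeAux, map_smul, sgn_real_smul, ih, smul_add]

theorem wedgeAux_real_smul_right (n : ℕ) (c : ℝ) (α β : Forms A L) (v : Fin n → L) :
    wedgeAux n α (c • β) v = c • wedgeAux n α β v := by
  induction n generalizing α β with
  | zero => simp [wedgeAux]
  | succ n ih => simp only [wedgeAux, map_smul, ih, smul_add]

theorem wedgeAux_update_add (n : ℕ) (α β : Forms A L) (v : Fin n → L) (j : Fin n) (x y : L) :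
    wedgeAux n α β (Function.update v j (x + y)) =
      wedgeAux n α β (Function.update v j x) + wedgeAux n α β (Function.update v j y) := by
  induction n generalizing α β with
  | zero => exact j.elim0
  | succ n ih =>
    refine Fin.cases ?_ (fun j => ?_) j
    · simp only [wedgeAux, Form.tail_update_zero, Function.update_self, contract_add_left,
        wedgeAux_add_left, wedgeAux_add_right]
      abel
    · simp only [wedgeAux, Form.tail_update_succ, Form.update_succ_zero, ih]
      abel

theorem wedgeAux_update_smul (n : ℕ) (α β : Forms A L) (v : Fin n → L) (j : Fin n) (f : A)
    (x : L) : wedgeAux n α β (Function.update v j (f • x)) =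
      f • wedgeAux n α β (Function.update v j x) := by
  induction n generalizing α β with
  | zero => exact j.elim0
  | succ n ih =>
    refine Fin.cases ?_ (fun j => ?_) j
    · simp only [wedgeAux, Form.tail_update_zero, Function.update_self, contract_smul_left,
        wedgeAux_smul_left, wedgeAux_smul_right, smul_eq_mul, mul_add]
    · simp only [wedgeAux, Form.tail_update_succ, Form.update_succ_zero, ih, smul_add]

theorem wedgeAux_cons_self (n : ℕ) (α β : Forms A L) (X : L) (w : Fin (n + 1) → L)
    (hw : w 0 = X) :
    wedgeAux (n + 1) (contract X α) β w + wedgeAux (n + 1) (sgn α) (contract X β) w = 0 := by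
  have h0 : ∀ ρ : Forms A L, wedgeAux n 0 ρ (Fin.tail w) = 0 := fun ρ => by
    simpa using wedgeAux_smul_left n (0 : A) 0 ρ (Fin.tail w)
  have h0' : ∀ ρ : Forms A L, wedgeAux n ρ 0 (Fin.tail w) = 0 := fun ρ => by
    simpa using wedgeAux_smul_right n (0 : A) ρ 0 (Fin.tail w)
  have hneg : -sgn (contract X α) = (-1 : A) • sgn (contract X α) := by
    funext n
    exact (neg_one_smul A (sgn (contract X α) n)).symm
  simp only [wedgeAux, hw, contract_contract, h0, h0', contract_sgn, hneg, wedgeAux_smul_left]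
  ring

theorem wedgeAux_eq_zero (n : ℕ) (α β : Forms A L) (v : Fin n → L) (i j : Fin n)
    (hv : v i = v j) (hij : i ≠ j) : wedgeAux n α β v = 0 := by
  induction n generalizing α β with
  | zero => exact i.elim0
  | succ n ih =>
    have key : ∀ (X : L) (w : Fin n → L) (k : Fin n), w k = X →
        wedgeAux n (contract X α) β w + wedgeAux n (sgn α) (contract X β) w = 0 := by
      intro X w k hk
      cases n with
      | zero => exact k.elim0
      | succ n =>
      let D : Form A L (n + 1) :=
        { MultilinearMap.mk' (fun w => wedgeAux (n + 1) (contract X α) β w +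
              wedgeAux (n + 1) (sgn α) (contract X β) w)
            (fun v j x y => by simp only [wedgeAux_update_add]; abel)
            (fun v j c x => by simp only [wedgeAux_update_smul, smul_add]) with
          map_eq_zero_of_eq' := fun v i j hv hij => by
            change wedgeAux (n + 1) (contract X α) β v +
              wedgeAux (n + 1) (sgn α) (contract X β) v = 0
            rw [ih _ _ v i j hv hij, ih _ _ v i j hv hij, add_zero] }
      change D w = 0
      by_cases hk0 : k = 0
      · subst hk0
        exact wedgeAux_cons_self n α β X w hk
      · have h3 : D (w ∘ Equiv.swap k 0) = 0 :=
          wedgeAux_cons_self n α β X _ (by simp [hk])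
        rwa [D.map_swap w hk0, neg_eq_zero] at h3
    rw [wedgeAux]
    induction i using Fin.cases with
    | zero =>
      induction j using Fin.cases with
      | zero => exact absurd rfl hij
      | succ j => exact key (v 0) (Fin.tail v) j hv.symm
    | succ i =>
      induction j using Fin.cases with
      | zero => exact key (v 0) (Fin.tail v) i hv
      | succ j =>
        have hij' : i ≠ j := fun h => hij (h ▸ rfl)
        rw [ih _ _ (Fin.tail v) i j hv hij', ih _ _ (Fin.tail v) i j hv hij', add_zero]

/-- The wedge product of forms. -/
def wedge : Forms A L →ₗ[ℝ] Forms A L →ₗ[ℝ] Forms A L :=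
  LinearMap.mk₂ ℝ (fun α β n =>
      { MultilinearMap.mk' (wedgeAux n α β) (fun v j x y => wedgeAux_update_add n α β v j x y)
          (fun v j c x => wedgeAux_update_smul n α β v j c x) with
        map_eq_zero_of_eq' := fun v i j hv hij => wedgeAux_eq_zero n α β v i j hv hij })
    (fun α α' β => by funext n; ext v; exact wedgeAux_add_left n α α' β v)
    (fun c α β => by funext n; ext v; exact wedgeAux_real_smul_left n c α β v)
    (fun α β β' => by funext n; ext v; exact wedgeAux_add_right n α β β' v)
    (fun c α β => by funext n; ext v; exact wedgeAux_real_smul_right n c α β v)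

theorem wedge_apply_zero (α β : Forms A L) : wedge α β 0 ![] = α 0 ![] * β 0 ![] := rfl

theorem contract_wedge (X : L) (α β : Forms A L) :
    contract X (wedge α β) = wedge (contract X α) β + wedge (sgn α) (contract X β) := rfl

/-- The operator `e^B ∧`, for a form `B` of degree two. -/
def expWedge (B : Form A L 2) : Forms A L →ₗ[ℝ] Forms A L :=
  LinearMap.pi fun n => ∑ j ∈ Finset.range (n + 1),
    (1 / (j.factorial : ℝ)) • (LinearMap.proj n ∘ₗ (wedge (ofForm B)) ^ j)

end

end Operators

end Forms

namespace Form

section OfSkew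

variable {A L : Type*} [CommRing A] [AddCommGroup L] [Module A L]

/-- The three-form given by a skew-symmetric function that is linear in its first variable. -/
def ofSkew (t : L → L → L → A) (hadd : ∀ X X' Y Z, t (X + X') Y Z = t X Y Z + t X' Y Z)
    (hsmul : ∀ f X Y Z, t (f • X) Y Z = f * t X Y Z) (h23 : ∀ X Y Z, t X Y Z = -t X Z Y)
    (h13 : ∀ X Y Z, t X Y Z = -t Z Y X) (h2 : ∀ f : A, f = -f → f = 0) : Form A L 3 :=
  have h12 : ∀ X Y Z, t X Y Z = -t Y X Z := fun X Y Z => by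
    rw [h13, h23, h13, neg_neg]
  { MultilinearMap.mk' (fun v : Fin 3 → L => t (v 0) (v 1) (v 2))
      (by
        intro v i X Y
        fin_cases i
        · simp [hadd]
        · simp [h12 (v 0), hadd]
          abel
        · simp [h13 (v 0), hadd]
          abel)
      (by
        intro v i f X
        fin_cases i
        · simp [hsmul]
        · simp [h12 (v 0), hsmul]
        · simp [h13 (v 0), hsmul]) with
    map_eq_zero_of_eq' := by
      intro v i j hv hij
      change t (v 0) (v 1) (v 2) = 0
      fin_cases i <;> fin_cases j <;> simp at hv hij
      · rw [hv]; exact h2 _ (h12 _ _ _)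
      · rw [hv]; exact h2 _ (h13 _ _ _)
      · rw [hv]; exact h2 _ (h12 _ _ _)
      · rw [hv]; exact h2 _ (h23 _ _ _)
      · rw [hv]; exact h2 _ (h13 _ _ _)
      · rw [hv]; exact h2 _ (h23 _ _ _) }

theorem ofSkew_apply (t : L → L → L → A) (hadd hsmul h23 h13 h2) (v : Fin 3 → L) :
    ofSkew t hadd hsmul h23 h13 h2 v = t (v 0) (v 1) (v 2) := rfl

end OfSkew

end Form

/-- The space `W[[u_1, …, u_r]]` of formal power series with coefficients in `W`; the value at the
multi-index `m` is the coefficient of `u^m`. -/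
abbrev Series (r : ℕ) (W : Type*) : Type _ := (Fin r →₀ ℕ) → W

namespace Series

section Operators

variable {r : ℕ} {W W' : Type*} [AddCommGroup W] [Module ℝ W] [AddCommGroup W'] [Module ℝ W']

noncomputable section

/-- A linear map applied to every coefficient. -/
def map (f : W →ₗ[ℝ] W') : Series r W →ₗ[ℝ] Series r W' := f.compLeft _

/-- Multiplication by the variable `u_j`. -/
def mulVar (j : Fin r) : Series r W →ₗ[ℝ] Series r W where
  toFun ρ m := if m j = 0 then 0 else ρ (m - Finsupp.single j 1)
  map_add' ρ σ := by funext m; by_cases h : m j = 0 <;> simp [h]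
  map_smul' c ρ := by funext m; by_cases h : m j = 0 <;> simp [h]

/-- The partial derivative `∂/∂u_j`. -/
def partialDeriv (j : Fin r) : Series r W →ₗ[ℝ] Series r W where
  toFun ρ m := ((m j : ℝ) + 1) • ρ (m + Finsupp.single j 1)
  map_add' ρ σ := by funext m; simp
  map_smul' c ρ := by funext m; exact smul_comm ((m j : ℝ) + 1) c _

/-- The operator `∑ j, u_j T_j`.  For a family `T_τ` of operators that is linear in
`τ = ∑ j, u_j τ_j` it sends `ρ` to the formal power series `τ ↦ T_τ (ρ(τ))`. -/
def diag (T : Fin r → W →ₗ[ℝ] W') : Series r W →ₗ[ℝ] Series r W' :=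
  ∑ j, mulVar j ∘ₗ map (T j)

/-- The action `∑ k l, c^k_{il} u_l ∂/∂u_k` on power series induced by the `i`-th basis vector of a
Lie algebra with structure constants `[τ_i, τ_l] = ∑ k, c^k_{il} τ_k`; that is,
`τ ↦ (dρ)_τ ([τ_i, τ])`. -/
def coadjoint (c : Fin r → Fin r → Fin r → ℝ) (i : Fin r) : Series r W →ₗ[ℝ] Series r W :=
  ∑ l, ∑ k, c i l k • (mulVar l ∘ₗ partialDeriv k)

end

end Operators

section Forms

variable {r : ℕ} {A L : Type*} [CommRing A] [Algebra ℝ A] [LieRing L] [LieAlgebra ℝ L]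
  [Module A L] [LieRingModule L A] [LieRinehartRing A L] [LieRinehartAlgebra ℝ A L]

noncomputable section

/-- The product of power series of forms. -/
def wedge : Series r (Forms A L) →ₗ[ℝ] Series r (Forms A L) →ₗ[ℝ] Series r (Forms A L) :=
  LinearMap.mk₂ ℝ (fun α β m => ∑ ij ∈ Finset.HasAntidiagonal.antidiagonal m, Forms.wedge (α ij.1) (β ij.2))
    (fun α α' β => by funext m; simp [Finset.sum_add_distrib])
    (fun c α β => by funext m; simp [Finset.smul_sum])
    (fun α β β' => by funext m; simp [Finset.sum_add_distrib])
    (fun c α β => by funext m; simp [Finset.smul_sum])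

/-- The power series all of whose coefficients are forms of parity `p`. -/
def parity (p : ZMod 2) : Submodule ℝ (Series r (Forms A L)) :=
  Submodule.pi Set.univ fun _ => Forms.parity p

/-- The equivariant differential `d_G = d - ∑ j, u_j ι_{X_j}`. -/
def cartanDiff (X : Fin r → L) : Series r (Forms A L) →ₗ[ℝ] Series r (Forms A L) :=
  map Forms.d - diag fun j => Forms.contract (X j)

/-- The twisted equivariant differential `d_G - H_G ∧`. -/
def twistedDiff (X : Fin r → L) (H : Series r (Forms A L)) :
    Series r (Forms A L) →ₗ[ℝ] Series r (Forms A L) :=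
  cartanDiff X - wedge H

/-- The elements `ρ` of parity `p` with `L_{X_τ} ρ(τ) = 0` for `X_τ = ∑ j, x_j X_j` and
`τ = ∑ j, x_j τ_j`, as an identity of formal power series in `τ`. -/
def cartan (X : Fin r → L) (p : ZMod 2) : Submodule ℝ (Series r (Forms A L)) :=
  parity p ⊓ LinearMap.ker (diag fun j => Forms.lieD (X j))

/-- The elements `ρ` of parity `p` that are invariant under the Lie algebra with structure constants
`c`, which acts on the coefficients through the Lie derivatives along the `X_i` and on the variables
by the coadjoint action. -/
def invariantCartan (X : Fin r → L) (c : Fin r → Fin r → Fin r → ℝ) (p : ZMod 2) :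
    Submodule ℝ (Series r (Forms A L)) :=
  parity p ⊓ ⨅ i, LinearMap.ker (map (Forms.lieD (X i)) + coadjoint c i)

/-- The series is homogeneous of total degree `n`, where every variable `u_j` has degree two. -/
def IsHomogeneous (n : ℕ) (ρ : Series r (Forms A L)) : Prop :=
  ∀ (m : Fin r →₀ ℕ) (k : ℕ), 2 * m.degree + k ≠ n → ρ m k = 0

end

end Forms

end Series

/-- The cohomology in degree `p` of a `ℤ/2`-graded complex `C`, given by subspaces of a space `W`,
with differential the restriction of an operator `D` on `W`: the quotient of
`{z ∈ C^p | D z = 0}` by its subspace of the elements `D y` with `y ∈ C^{p+1}`. -/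
abbrev GradedCohomology {W : Type*} [AddCommGroup W] [Module ℝ W] (D : W →ₗ[ℝ] W)
    (C : ZMod 2 → Submodule ℝ W) (p : ZMod 2) : Type _ :=
  (C p ⊓ LinearMap.ker D : Submodule ℝ W) ⧸
    ((C (p + 1)).map D).comap (C p ⊓ LinearMap.ker D).subtype

/-- Two `ℤ/2`-graded complexes `(C, D)` and `(C', D')`, on which a third one `(C₀, D₀)` acts by
products, have isomorphic cohomology: there are linear isomorphisms in both degrees, compatible with
the products by the classes of cocycles of the third complex. -/
def IsoCohomology {W W' W₀ : Type*} [AddCommGroup W] [Module ℝ W] [AddCommGroup W'] [Module ℝ W']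
    [AddCommGroup W₀] [Module ℝ W₀]
    (D : W →ₗ[ℝ] W) (C : ZMod 2 → Submodule ℝ W) (mul : W → W₀ → W)
    (D' : W' →ₗ[ℝ] W') (C' : ZMod 2 → Submodule ℝ W') (mul' : W' → W₀ → W')
    (D₀ : W₀ →ₗ[ℝ] W₀) (C₀ : ZMod 2 → Submodule ℝ W₀) : Prop :=
  ∃ Φ : ∀ p : ZMod 2, GradedCohomology D C p ≃ₗ[ℝ] GradedCohomology D' C' p,
    ∀ (p q : ZMod 2) (z : (C p ⊓ LinearMap.ker D : Submodule ℝ W))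
      (z' : (C' p ⊓ LinearMap.ker D' : Submodule ℝ W')),
      Φ p (Submodule.Quotient.mk z) = Submodule.Quotient.mk z' →
      ∀ α ∈ (C₀ q ⊓ LinearMap.ker D₀ : Submodule ℝ W₀),
        ∃ (hz : mul z α ∈ (C (p + q) ⊓ LinearMap.ker D : Submodule ℝ W))
          (hz' : mul' z' α ∈ (C' (p + q) ⊓ LinearMap.ker D' : Submodule ℝ W')),
          Φ (p + q) (Submodule.Quotient.mk ⟨mul z α, hz⟩) = Submodule.Quotient.mk ⟨mul' z' α, hz'⟩

section Manifolds

open scoped Manifold ContDiff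
open VectorField

variable (E : Type*) [NormedAddCommGroup E] [NormedSpace ℝ E]
  (M : Type*) [TopologicalSpace M] [ChartedSpace E M]

/-- The algebra of smooth functions on a manifold. -/
abbrev SmoothFun : Type _ := C^∞⟮𝓘(ℝ, E), M; ℝ⟯

/-- The smooth sections of a smooth vector bundle. -/
abbrev SmoothSec [IsManifold 𝓘(ℝ, E) ∞ M] (F : Type*) [NormedAddCommGroup F] [NormedSpace ℝ F] (V : M → Type*)
    [TopologicalSpace (Bundle.TotalSpace F V)] [∀ x, AddCommGroup (V x)] [∀ x, Module ℝ (V x)]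
    [∀ x, TopologicalSpace (V x)] [FiberBundle F V] [VectorBundle ℝ F V]  : Type _ :=
  Cₛ^∞⟮𝓘(ℝ, E); F, V⟯

/-- The smooth vector fields on a manifold. -/
abbrev SmoothVF [IsManifold 𝓘(ℝ, E) ∞ M] : Type _ :=
  Cₛ^∞⟮𝓘(ℝ, E); E, (TangentSpace 𝓘(ℝ, E) : M → Type _)⟯

variable [FiniteDimensional ℝ E] [IsManifold 𝓘(ℝ, E) ∞ M]

noncomputable section
set_option linter.unusedSectionVars false

namespace SmoothVF

variable {E M}

instance : Module (SmoothFun E M) (SmoothVF E M) where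
  smul f X := ⟨fun x => f x • X x, f.contMDiff.smul_section X.contMDiff⟩
  one_smul X := by ext x; exact one_smul ℝ (X x)
  mul_smul f g X := by ext x; exact mul_smul (f x) (g x) (X x)
  smul_zero f := by ext x; exact smul_zero (f x)
  smul_add f X Y := by ext x; exact smul_add (f x) (X x) (Y x)
  add_smul f g X := by ext x; exact add_smul (f x) (g x) (X x)
  zero_smul X := by ext x; exact zero_smul ℝ (X x)

theorem smul_apply (f : SmoothFun E M) (X : SmoothVF E M) (x : M) : (f • X) x = f x • X x := rfl

theorem three_le_infty : (3 : WithTop ℕ∞) ≤ ∞ := by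
  exact WithTop.coe_le_coe.mpr (le_top : (3 : ℕ∞) ≤ ⊤)

theorem two_le_infty : (2 : WithTop ℕ∞) ≤ ∞ := by
  exact WithTop.coe_le_coe.mpr (le_top : (2 : ℕ∞) ≤ ⊤)

instance : IsManifold 𝓘(ℝ, E) (minSmoothness ℝ 3) M := by
  rw [minSmoothness_of_isRCLikeNormedField]; exact IsManifold.of_le (n := ∞) three_le_infty

theorem mdiff (X : SmoothVF E M) (x : M) :
    MDifferentiableAt 𝓘(ℝ, E) 𝓘(ℝ, E).tangent (fun x => (X x : TangentBundle 𝓘(ℝ, E) M)) x :=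
  X.mdifferentiableAt

/-- The Lie bracket of vector fields. -/
instance : Bracket (SmoothVF E M) (SmoothVF E M) where
  bracket X Y := ⟨mlieBracket 𝓘(ℝ, E) X Y, by
    have : IsManifold 𝓘(ℝ, E) ((⊤ : ℕ∞) + 1) M := by simpa
    exact ContDiff.mlieBracket_vectorField (n := ⊤) (m := ⊤) X.contMDiff Y.contMDiff (by simp)⟩

theorem bracket_apply (X Y : SmoothVF E M) (x : M) : ⁅X, Y⁆ x = mlieBracket 𝓘(ℝ, E) X Y x := rfl

instance : LieRing (SmoothVF E M) where
  add_lie X Y Z := by ext x; exact mlieBracket_add_left (mdiff X x) (mdiff Y x)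
  lie_add X Y Z := by ext x; exact mlieBracket_add_right (mdiff Y x) (mdiff Z x)
  lie_self X := by ext x; simp [bracket_apply]
  leibniz_lie X Y Z := by
    ext x
    refine leibniz_identity_mlieBracket_apply ?_ ?_ ?_ <;>
    · rw [minSmoothness_of_isRCLikeNormedField]
      exact (ContMDiffSection.contMDiff _ x).of_le two_le_infty

instance : LieAlgebra ℝ (SmoothVF E M) where
  lie_smul c X Y := by ext x; exact mlieBracket_const_smul_right (mdiff Y x)

theorem contMDiff_mvfderiv (f : SmoothFun E M) (X : SmoothVF E M) :
    ContMDiff 𝓘(ℝ, E) 𝓘(ℝ, ℝ) ∞ (fun x => mvfderiv 𝓘(ℝ, E) f x (X x)) :=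
  (contMDiff_snd_tangentBundle_modelSpace ℝ 𝓘(ℝ, ℝ)).comp
    ((f.contMDiff.contMDiff_tangentMap (m := ∞) (by simp)).comp X.contMDiff)

/-- The derivative of a function along a vector field. -/
instance : Bracket (SmoothVF E M) (SmoothFun E M) where
  bracket X f := ⟨fun x => mvfderiv 𝓘(ℝ, E) f x (X x), contMDiff_mvfderiv f X⟩

theorem bracket_fun_apply (X : SmoothVF E M) (f : SmoothFun E M) (x : M) :
    ⁅X, f⁆ x = mvfderiv 𝓘(ℝ, E) f x (X x) := rfl

theorem fun_mdiff (f : SmoothFun E M) (x : M) : MDifferentiableAt 𝓘(ℝ, E) 𝓘(ℝ, ℝ) f x :=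
  f.contMDiff.mdifferentiable (by simp) x

theorem mvfderiv_lie (X Y : SmoothVF E M) (f : SmoothFun E M) (x : M) :
    mvfderiv 𝓘(ℝ, E) f x (mlieBracket 𝓘(ℝ, E) X Y x) =
      ⁅X, ⁅Y, f⁆⁆ x - ⁅Y, ⁅X, f⁆⁆ x := by
  -- Compare the two sides of the Jacobi identity for `X`, `Y` and `f • Z`, where `Z x ≠ 0`.
  rcases subsingleton_or_nontrivial E with hE | hE
  · have h0 : ∀ v : TangentSpace 𝓘(ℝ, E) x, v = 0 := fun v => hE.elim v 0
    rw [bracket_fun_apply, bracket_fun_apply, h0 (X x), h0 (Y x), h0 (mlieBracket _ _ _ x)]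
    simp
  obtain ⟨v, hv⟩ : ∃ v : E, v ≠ 0 := exists_ne 0
  let Z : (x : M) → TangentSpace 𝓘(ℝ, E) x :=
    FiberBundle.extend E (E := (TangentSpace 𝓘(ℝ, E) : M → Type _)) (x := x) v
  have hZx : Z x = v := FiberBundle.extend_apply_self ..
  have hZ : ContMDiffAt 𝓘(ℝ, E) 𝓘(ℝ, E).tangent ∞
      (fun x => (Z x : TangentBundle 𝓘(ℝ, E) M)) x := by
    have := FiberBundle.contMDiffAt_extend 𝓘(ℝ, E) E (V := (TangentSpace 𝓘(ℝ, E) : M → Type _)) (k := ∞)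
      (x := x) v
    exact this
  have hZ2 : ContMDiffAt 𝓘(ℝ, E) 𝓘(ℝ, E).tangent 2
      (fun x => (Z x : TangentBundle 𝓘(ℝ, E) M)) x := hZ.of_le two_le_infty
  have hmd : ∀ᶠ y in nhds x, MDifferentiableAt 𝓘(ℝ, E) 𝓘(ℝ, E).tangent
      (fun x => (Z x : TangentBundle 𝓘(ℝ, E) M)) y :=
    ((contMDiffAt_iff_contMDiffAt_nhds (by simp)).mp hZ2).mono fun y hy =>
      hy.mdifferentiableAt (by simp)
  have hmin : minSmoothness ℝ 2 = 2 := minSmoothness_of_isRCLikeNormedField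
  have hX : ∀ (W : SmoothVF E M), ContMDiffAt 𝓘(ℝ, E) 𝓘(ℝ, E).tangent (minSmoothness ℝ 2)
      (fun x => (W x : TangentBundle 𝓘(ℝ, E) M)) x := fun W => by
    rw [hmin]; exact (W.contMDiff x).of_le two_le_infty
  have hbr : ∀ (W : SmoothVF E M), MDifferentiableAt 𝓘(ℝ, E) 𝓘(ℝ, E).tangent
      (fun y => (mlieBracket 𝓘(ℝ, E) W Z y : TangentBundle 𝓘(ℝ, E) M)) x := fun W => by
    have : IsManifold 𝓘(ℝ, E) ((⊤ : ℕ∞) + 1) M := by simpa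
    have h := ContMDiffAt.mlieBracket_vectorField (n := ⊤) (m := ⊤) (W.contMDiff x) hZ (by simp)
    exact h.mdifferentiableAt (by simp)
  have hfZ : ContMDiffAt 𝓘(ℝ, E) 𝓘(ℝ, E).tangent (minSmoothness ℝ 2)
      (fun x => (((f : M → ℝ) • Z) x : TangentBundle 𝓘(ℝ, E) M)) x := by
    rw [hmin]; exact ((f.contMDiff x).smul_section hZ).of_le two_le_infty
  have hstep : ∀ W : SmoothVF E M, mlieBracket 𝓘(ℝ, E) W ((f : M → ℝ) • Z) =ᶠ[nhds x]
      ((⁅W, f⁆ : SmoothFun E M) : M → ℝ) • Z + (f : M → ℝ) • mlieBracket 𝓘(ℝ, E) W Z := fun W => by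
    filter_upwards [hmd] with y hy
    exact mlieBracket_smul_right (fun_mdiff f y) hy
  have htwo : ∀ U W : SmoothVF E M,
      mlieBracket 𝓘(ℝ, E) U (mlieBracket 𝓘(ℝ, E) W ((f : M → ℝ) • Z)) x =
        (⁅U, ⁅W, f⁆⁆ x • Z x + ⁅W, f⁆ x • mlieBracket 𝓘(ℝ, E) U Z x) +
        (⁅U, f⁆ x • mlieBracket 𝓘(ℝ, E) W Z x +
          f x • mlieBracket 𝓘(ℝ, E) U (mlieBracket 𝓘(ℝ, E) W Z) x) := fun U W => by
    rw [(Filter.EventuallyEq.refl _ _).mlieBracket_vectorField_eq (hstep W),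
      mlieBracket_add_right
        ((fun_mdiff (⁅W, f⁆ : SmoothFun E M) x).smul_section hmd.self_of_nhds)
        ((fun_mdiff f x).smul_section (hbr W)),
      mlieBracket_smul_right (fun_mdiff _ x) hmd.self_of_nhds,
      mlieBracket_smul_right (fun_mdiff _ x) (hbr W)]
    rfl
  have h1 := leibniz_identity_mlieBracket_apply (hX X) (hX Y) hfZ
  have h2 := leibniz_identity_mlieBracket_apply (hX X) (hX Y)
    (show ContMDiffAt 𝓘(ℝ, E) 𝓘(ℝ, E).tangent (minSmoothness ℝ 2)
      (fun x => (Z x : TangentBundle 𝓘(ℝ, E) M)) x by rw [hmin]; exact hZ2)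
  have h3 : mlieBracket 𝓘(ℝ, E) (mlieBracket 𝓘(ℝ, E) X Y) ((f : M → ℝ) • Z) x =
      mvfderiv 𝓘(ℝ, E) f x (mlieBracket 𝓘(ℝ, E) X Y x) • Z x +
        f x • mlieBracket 𝓘(ℝ, E) (mlieBracket 𝓘(ℝ, E) X Y) Z x :=
    mlieBracket_smul_right (fun_mdiff f x) hmd.self_of_nhds
  rw [htwo, htwo, h3, h2, smul_add] at h1
  have h4 : (mvfderiv 𝓘(ℝ, E) f x (mlieBracket 𝓘(ℝ, E) X Y x) -
      (⁅X, ⁅Y, f⁆⁆ x - ⁅Y, ⁅X, f⁆⁆ x)) • Z x = 0 := by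
    rw [sub_smul, sub_smul]
    rw [← sub_eq_zero] at h1
    rw [← neg_eq_zero, ← h1]
    abel
  rw [hZx] at h4
  exact sub_eq_zero.mp ((smul_eq_zero.mp h4).resolve_right hv)

instance : LieRingModule (SmoothVF E M) (SmoothFun E M) where
  add_lie X Y f := by ext x; exact map_add (mvfderiv 𝓘(ℝ, E) f x) (X x) (Y x)
  lie_add X f g := by
    ext x
    change mvfderiv 𝓘(ℝ, E) ((f : M → ℝ) + (g : M → ℝ)) x (X x) = _
    rw [mvfderiv_add (fun_mdiff f x) (fun_mdiff g x)]
    rfl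
  leibniz_lie X Y f := by
    ext x
    change _ = mvfderiv 𝓘(ℝ, E) f x (mlieBracket 𝓘(ℝ, E) X Y x) + ⁅Y, ⁅X, f⁆⁆ x
    rw [mvfderiv_lie, sub_add_cancel]

instance : LieRinehartRing (SmoothFun E M) (SmoothVF E M) where
  lie_smul_eq_mul' f g X := by ext x; exact map_smul (mvfderiv 𝓘(ℝ, E) g x) (f x) (X x)
  leibniz_mul_right' X f g := by
    ext x
    change mvfderiv 𝓘(ℝ, E) ((f : M → ℝ) * (g : M → ℝ)) x (X x) = f x * ⁅X, g⁆ x + ⁅X, f⁆ x * g x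
    rw [mvfderiv_mul (fun_mdiff f x) (fun_mdiff g x)]
    simp [bracket_fun_apply, mul_comm]
  leibniz_smul_right' X Y f := by
    ext x
    change mlieBracket 𝓘(ℝ, E) X ((f : M → ℝ) • (Y : (x : M) → TangentSpace 𝓘(ℝ, E) x)) x =
      f x • mlieBracket 𝓘(ℝ, E) X Y x + mvfderiv 𝓘(ℝ, E) f x (X x) • Y x
    rw [mlieBracket_smul_right (fun_mdiff f x) (mdiff Y x), add_comm]

instance : LieRinehartAlgebra ℝ (SmoothFun E M) (SmoothVF E M) where
  smul_assoc c f X := by ext x; exact smul_assoc c (f x) (X x)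
  smul_lie c X f := by ext x; exact map_smul (mvfderiv 𝓘(ℝ, E) f x) c (X x)
  lie_smul c X f := by
    ext x
    change mvfderiv 𝓘(ℝ, E) ((fun _ : M => c) • (f : M → ℝ)) x (X x) = c * ⁅X, f⁆ x
    rw [mvfderiv_smul mdifferentiableAt_const (fun_mdiff f x)]
    simp [bracket_fun_apply, mvfderiv_const]

end SmoothVF
end
end Manifolds
section Courant

open scoped Manifold ContDiff
open Bundle

set_option linter.unusedSectionVars false

noncomputable section

variable {E : Type*} [NormedAddCommGroup E] [NormedSpace ℝ E] [FiniteDimensional ℝ E]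
  {M : Type*} [TopologicalSpace M] [ChartedSpace E M] [IsManifold 𝓘(ℝ, E) ∞ M]
  {F : Type*} [NormedAddCommGroup F] [NormedSpace ℝ F]
  {V : M → Type*} [TopologicalSpace (TotalSpace F V)] [∀ x, AddCommGroup (V x)]
  [∀ x, Module ℝ (V x)] [∀ x, TopologicalSpace (V x)] [FiberBundle F V] [VectorBundle ℝ F V]

variable (E F V) in
/-- The data of a Courant algebroid on a smooth vector bundle `V`: a smooth fibrewise symmetric
bilinear form, a smooth anchor map `V → TM`, and an `ℝ`-bilinear bracket on the sections. -/
structure CourantData where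
  /-- The pairing. -/
  pairing : ∀ x, V x →ₗ[ℝ] V x →ₗ[ℝ] ℝ
  /-- The anchor map. -/
  anchor : ∀ x, V x →ₗ[ℝ] TangentSpace 𝓘(ℝ, E) x
  /-- The bracket, written `𝔛 * 𝔜` in comments. -/
  bracket : SmoothSec E M F V →ₗ[ℝ] SmoothSec E M F V →ₗ[ℝ] SmoothSec E M F V
  contMDiff_pairing : ∀ u v : SmoothSec E M F V,
    ContMDiff 𝓘(ℝ, E) 𝓘(ℝ, ℝ) ∞ fun x => pairing x (u x) (v x)
  contMDiff_anchor : ∀ u : SmoothSec E M F V,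
    ContMDiff 𝓘(ℝ, E) 𝓘(ℝ, E).tangent ∞
      fun x => (⟨x, anchor x (u x)⟩ : TangentBundle 𝓘(ℝ, E) M)

namespace CourantData

variable (C : CourantData E F V)

/-- The pairing of two sections. -/
def inner (u v : SmoothSec E M F V) : SmoothFun E M :=
  ⟨fun x => C.pairing x (u x) (v x), C.contMDiff_pairing u v⟩

/-- The anchor of a section. -/
def rho (u : SmoothSec E M F V) : SmoothVF E M :=
  ⟨fun x => C.anchor x (u x), C.contMDiff_anchor u⟩

end CourantData

variable (E F V) in
/-- An exact Courant algebroid. -/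
structure ExactCourantAlgebroid extends CourantData E F V where
  pairing_symm : ∀ x v w, pairing x v w = pairing x w v
  pairing_nondegenerate : ∀ x v, (∀ w, pairing x v w = 0) → v = 0
  /-- The Jacobi identity `𝔛 * (𝔜 * ℨ) = (𝔛 * 𝔜) * ℨ + 𝔜 * (𝔛 * ℨ)`. -/
  jacobi : ∀ u v w : SmoothSec E M F V,
    bracket u (bracket v w) = bracket (bracket u v) w + bracket v (bracket u w)
  /-- `a(𝔛) ⟨𝔜, ℨ⟩ = ⟨𝔛, 𝔜 * ℨ + ℨ * 𝔜⟩`. -/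
  lie_inner_symm : ∀ u v w : SmoothSec E M F V,
    ⁅toCourantData.rho u, toCourantData.inner v w⁆ =
      toCourantData.inner u (bracket v w + bracket w v)
  /-- `a(𝔛) ⟨𝔜, ℨ⟩ = ⟨𝔛 * 𝔜, ℨ⟩ + ⟨𝔜, 𝔛 * ℨ⟩`. -/
  lie_inner : ∀ u v w : SmoothSec E M F V,
    ⁅toCourantData.rho u, toCourantData.inner v w⁆ =
      toCourantData.inner (bracket u v) w + toCourantData.inner v (bracket u w)
  /-- Exactness at `TM`. -/
  anchor_surjective : ∀ x, Function.Surjective (anchor x)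
  /-- Exactness at `V` of `T*M → V → TM`, where the covector `ξ` is sent to the element `v` with
  `2 ⟨v, w⟩ = ξ (a w)` for all `w`. -/
  anchor_eq_zero_iff : ∀ x v, anchor x v = 0 ↔
    ∃ ξ : Module.Dual ℝ (TangentSpace 𝓘(ℝ, E) x), ∀ w, 2 * pairing x v w = ξ (anchor x w)

namespace ExactCourantAlgebroid

variable (C : ExactCourantAlgebroid E F V)

/-- A smooth splitting `s : TM → V` of the anchor map with isotropic image. -/
structure IsotropicSplitting where
  /-- The underlying map. -/
  toFun : ∀ x, TangentSpace 𝓘(ℝ, E) x →ₗ[ℝ] V x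
  contMDiff_toFun : ∀ X : SmoothVF E M,
    ContMDiff 𝓘(ℝ, E) (𝓘(ℝ, E).prod 𝓘(ℝ, F)) ∞
      fun x => (⟨x, toFun x (X x)⟩ : TotalSpace F V)
  anchor_toFun : ∀ x v, C.anchor x (toFun x v) = v
  isotropic : ∀ x v w, C.pairing x (toFun x v) (toFun x w) = 0

namespace IsotropicSplitting

variable {C} (s : C.IsotropicSplitting)

/-- The section `s(X)`. -/
def sec (X : SmoothVF E M) : SmoothSec E M F V :=
  ⟨fun x => s.toFun x (X x), s.contMDiff_toFun X⟩

theorem sec_add (X Y : SmoothVF E M) : s.sec (X + Y) = s.sec X + s.sec Y := by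
  ext x; exact map_add (s.toFun x) (X x) (Y x)

theorem inner_sec_sec (X Y : SmoothVF E M) : C.inner (s.sec X) (s.sec Y) = 0 := by
  ext x; exact s.isotropic x (X x) (Y x)

/-- The function `2 ⟨s(X), s(Y) * s(Z)⟩`. -/
def twistFun (X Y Z : SmoothVF E M) : SmoothFun E M :=
  (2 : ℝ) • C.inner (s.sec X) (C.bracket (s.sec Y) (s.sec Z))

theorem twistFun_add (X X' Y Z : SmoothVF E M) :
    s.twistFun (X + X') Y Z = s.twistFun X Y Z + s.twistFun X' Y Z := by
  ext x
  change 2 * C.pairing x (s.toFun x (X x + X' x)) _ = 2 * C.pairing x _ _ + 2 * C.pairing x _ _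
  rw [map_add, map_add, LinearMap.add_apply, mul_add]
  rfl

theorem twistFun_smul (f : SmoothFun E M) (X Y Z : SmoothVF E M) :
    s.twistFun (f • X) Y Z = f * s.twistFun X Y Z := by
  ext x
  change 2 * C.pairing x (s.toFun x (f x • X x)) _ = f x * (2 * C.pairing x _ _)
  rw [map_smul, map_smul, LinearMap.smul_apply, smul_eq_mul, mul_left_comm]
  rfl

theorem twistFun_swap_right (X Y Z : SmoothVF E M) : s.twistFun X Y Z = -s.twistFun X Z Y := by
  have h := C.lie_inner_symm (s.sec X) (s.sec Y) (s.sec Z)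
  rw [inner_sec_sec, lie_zero] at h
  ext x
  have hx : (0 : ℝ) = C.pairing x (s.sec X x) (C.bracket (s.sec Y) (s.sec Z) x +
      C.bracket (s.sec Z) (s.sec Y) x) := congrArg (fun f : SmoothFun E M => f x) h
  rw [map_add] at hx
  change 2 * C.pairing x (s.sec X x) _ = -(2 * C.pairing x (s.sec X x) _)
  linarith

theorem twistFun_swap (X Y Z : SmoothVF E M) : s.twistFun X Y Z = -s.twistFun Z Y X := by
  have h := C.lie_inner (s.sec Y) (s.sec X) (s.sec Z)
  rw [inner_sec_sec, lie_zero] at h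
  ext x
  have hx : (0 : ℝ) = C.pairing x (C.bracket (s.sec Y) (s.sec X) x) (s.sec Z x) +
      C.pairing x (s.sec X x) (C.bracket (s.sec Y) (s.sec Z) x) :=
    congrArg (fun f : SmoothFun E M => f x) h
  rw [C.pairing_symm] at hx
  change 2 * C.pairing x (s.sec X x) _ = -(2 * C.pairing x (s.sec Z x) _)
  linarith

theorem eq_zero_of_eq_neg {f : SmoothFun E M} (h : f = -f) : f = 0 := by
  ext x
  have hx : f x = -f x := congrArg (fun f : SmoothFun E M => f x) h
  change f x = 0
  linarith

/-- The twisting form `H_s(X, Y, Z) = 2 ⟨s(X), s(Y) * s(Z)⟩` of an isotropic splitting. -/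
def twistingForm : Form (SmoothFun E M) (SmoothVF E M) 3 :=
  Form.ofSkew s.twistFun s.twistFun_add s.twistFun_smul s.twistFun_swap_right s.twistFun_swap
    fun _ h => eq_zero_of_eq_neg h

/-- The component in `T*M` of a section, as the one-form `ξ(Y) = 2 ⟨𝔛 - s(a(𝔛)), s(Y)⟩`. -/
def covector (u : SmoothSec E M F V) : Form (SmoothFun E M) (SmoothVF E M) 1 :=
  AlternatingMap.ofSubsingleton (SmoothFun E M) (SmoothVF E M) (SmoothFun E M) (0 : Fin 1)
    { toFun := fun Y => (2 : ℝ) • C.inner (u - s.sec (C.rho u)) (s.sec Y)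
      map_add' := fun Y Z => by
        ext x
        change 2 * C.pairing x _ (s.toFun x (Y x + Z x)) =
          2 * C.pairing x _ (s.toFun x (Y x)) + 2 * C.pairing x _ (s.toFun x (Z x))
        rw [map_add, map_add, mul_add]
      map_smul' := fun f Y => by
        ext x
        change 2 * C.pairing x _ (s.toFun x (f x • Y x)) =
          f x * (2 * C.pairing x _ (s.toFun x (Y x)))
        rw [map_smul, map_smul, smul_eq_mul, mul_left_comm] }

/-- The operator `d_H ρ = dρ - H ∧ ρ`. -/
def d : Forms (SmoothFun E M) (SmoothVF E M) →ₗ[ℝ] Forms (SmoothFun E M) (SmoothVF E M) :=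
  Forms.d - Forms.wedge (Forms.ofForm s.twistingForm)

/-- The Clifford action `ι_𝔛 ρ = ι_X ρ + ξ ∧ ρ` of a section `𝔛 = s(X) + ξ`. -/
def contract (u : SmoothSec E M F V) :
    Forms (SmoothFun E M) (SmoothVF E M) →ₗ[ℝ] Forms (SmoothFun E M) (SmoothVF E M) :=
  Forms.contract (C.rho u) + Forms.wedge (Forms.ofForm (s.covector u))

/-- The Lie derivative `L_𝔛 ρ = L_X ρ + (dξ - ι_X H) ∧ ρ` along a section `𝔛 = s(X) + ξ`. -/
def lieD (u : SmoothSec E M F V) :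
    Forms (SmoothFun E M) (SmoothVF E M) →ₗ[ℝ] Forms (SmoothFun E M) (SmoothVF E M) :=
  Forms.lieD (C.rho u) + Forms.wedge (Forms.ofForm
    ((s.covector u).extDeriv - s.twistingForm.curryLeft (C.rho u)))

/-- The splitting `s'` is obtained from `s` by the action of the two-form `B`, that is,
`s'(X) = s(X) + ι_X B`. -/
def IsShift (s s' : C.IsotropicSplitting) (B : Form (SmoothFun E M) (SmoothVF E M) 2) : Prop :=
  ∀ (X : SmoothVF E M) (u : SmoothSec E M F V),
    (2 : ℝ) • C.inner (s'.sec X - s.sec X) u = B ![X, C.rho u]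

end IsotropicSplitting

/-- The families `(φ_s)` of formal power series of forms, indexed by the isotropic splittings. -/
abbrev SpinorFamily (r : ℕ) : Type _ :=
  C.IsotropicSplitting → Series r (Forms (SmoothFun E M) (SmoothVF E M))

/-- The space `𝒮 ⊗ ℝ[[u_1, …, u_r]]` of formal power series with coefficients in the spinors of
the exact Courant algebroid: families of power series `φ_s` of forms with `φ_{s'} = e^B ∧ φ_s`
if `s' = s + B`. -/
def spinors (r : ℕ) : Submodule ℝ (C.SpinorFamily r) where
  carrier := {φ | ∀ (s s' : C.IsotropicSplitting) (B : Form (SmoothFun E M) (SmoothVF E M) 2),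
    s.IsShift s' B → φ s' = Series.map (Forms.expWedge B) (φ s)}
  zero_mem' := fun s s' B _ => (map_zero _).symm
  add_mem' := fun {a b} ha hb s s' B h => by
    rw [Pi.add_apply, Pi.add_apply, map_add, ha s s' B h, hb s s' B h]
  smul_mem' := fun c a ha s s' B h => by
    rw [Pi.smul_apply, Pi.smul_apply, map_smul, ha s s' B h]

/-- The families of parity `p`. -/
def parity (r : ℕ) (p : ZMod 2) : Submodule ℝ (C.SpinorFamily r) :=
  Submodule.pi Set.univ fun _ => Series.parity p

/-- An operator applied to every member of a family. -/
def pointwise {r : ℕ} (T : C.IsotropicSplitting →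
    Series r (Forms (SmoothFun E M) (SmoothVF E M)) →ₗ[ℝ]
      Series r (Forms (SmoothFun E M) (SmoothVF E M))) :
    C.SpinorFamily r →ₗ[ℝ] C.SpinorFamily r :=
  LinearMap.pi fun s => T s ∘ₗ LinearMap.proj s

variable {r : ℕ} (u : Fin r → SmoothSec E M F V)

/-- The differential `d_𝒯 - ∑ j, u_j ι_{𝔛_j}`. -/
def equivDiff : C.SpinorFamily r →ₗ[ℝ] C.SpinorFamily r :=
  C.pointwise fun s => Series.map s.d - Series.diag fun j => s.contract (u j)

/-- The extended equivariant Cartan complex: the elements `ρ` of parity `p` of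
`𝒮 ⊗ ℝ[[u_1, …, u_r]]` with `L_{𝔛_τ} ρ(τ) = 0` for `𝔛_τ = ∑ j, x_j 𝔛_j` and `τ = ∑ j, x_j τ_j`,
as an identity of formal power series in `τ`. -/
def cartan (p : ZMod 2) : Submodule ℝ (C.SpinorFamily r) :=
  C.spinors r ⊓ C.parity r p ⊓
    LinearMap.ker (C.pointwise fun s => Series.diag fun j => s.lieD (u j))

/-- The elements `ρ` of parity `p` of `𝒮 ⊗ ℝ[[u_1, …, u_r]]` that are invariant under the Lie algebra
with structure constants `c`, which acts on the spinors through the Lie derivatives along the `𝔛_i`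
and on the variables by the coadjoint action. -/
def invariantCartan (c : Fin r → Fin r → Fin r → ℝ) (p : ZMod 2) :
    Submodule ℝ (C.SpinorFamily r) :=
  C.spinors r ⊓ C.parity r p ⊓
    ⨅ i, LinearMap.ker (C.pointwise fun s => Series.map (s.lieD (u i)) + Series.coadjoint c i)

/-- The product `ρ ∧ α` of a family with a power series of forms. -/
def wedge (ρ : C.SpinorFamily r) (α : Series r (Forms (SmoothFun E M) (SmoothVF E M))) :
    C.SpinorFamily r :=
  fun s => Series.wedge (ρ s) α

end ExactCourantAlgebroid

section GroupAction

variable {EG : Type*} [NormedAddCommGroup EG] [NormedSpace ℝ EG]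
  (G : Type*) [TopologicalSpace G] [ChartedSpace EG G] [Group G] [MulAction G M]

namespace ExactCourantAlgebroid

variable (EG) in
/-- A smooth action of a Lie group on an exact Courant algebroid by automorphisms that cover a given
action on the base. -/
structure GroupAction (C : ExactCourantAlgebroid E F V) where
  /-- The fibre maps. -/
  toFun : ∀ (g : G) (x : M), V x →ₗ[ℝ] V (g • x)
  one_apply : ∀ x v, (⟨(1 : G) • x, toFun 1 x v⟩ : TotalSpace F V) = ⟨x, v⟩
  mul_apply : ∀ g h x v, (⟨(g * h) • x, toFun (g * h) x v⟩ : TotalSpace F V) =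
    ⟨g • h • x, toFun g (h • x) (toFun h x v)⟩
  contMDiff_toFun : ContMDiff (𝓘(ℝ, EG).prod (𝓘(ℝ, E).prod 𝓘(ℝ, F))) (𝓘(ℝ, E).prod 𝓘(ℝ, F)) ∞
    fun q : G × TotalSpace F V => (⟨q.1 • q.2.1, toFun q.1 q.2.1 q.2.2⟩ : TotalSpace F V)
  pairing_toFun : ∀ g x v w, C.pairing (g • x) (toFun g x v) (toFun g x w) = C.pairing x v w
  anchor_toFun : ∀ g x v, C.anchor (g • x) (toFun g x v) =
    mfderiv 𝓘(ℝ, E) 𝓘(ℝ, E) (fun y : M => g • y) x (C.anchor x v)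
  /-- If `𝔛' = g 𝔛` and `𝔜' = g 𝔜`, then `𝔛' * 𝔜' = g (𝔛 * 𝔜)`. -/
  bracket_toFun : ∀ (g : G) (u u' v v' : SmoothSec E M F V),
    (∀ x, u' (g • x) = toFun g x (u x)) → (∀ x, v' (g • x) = toFun g x (v x)) →
    ∀ x, C.bracket u' v' (g • x) = toFun g x (C.bracket u v x)

/-- The action is by extended symmetries, generated by the map `δ` from the Lie algebra to the
sections, and isotropic. -/
structure GroupAction.IsIsotropicExtended {C : ExactCourantAlgebroid E F V}
    (φ : C.GroupAction EG G) (δ : GroupLieAlgebra 𝓘(ℝ, EG) G →ₗ[ℝ] SmoothSec E M F V) : Prop where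
  /-- The anchor of `δ(τ)` is the vector field `X_τ` generating `x ↦ exp(tτ) x`. -/
  anchor_eq : ∀ (τ : GroupLieAlgebra 𝓘(ℝ, EG) G) (x : M),
    (⟨x, C.anchor x (δ τ x)⟩ : TangentBundle 𝓘(ℝ, E) M) =
      ⟨(1 : G) • x, mfderiv 𝓘(ℝ, EG) 𝓘(ℝ, E) (fun g : G => g • x) 1 τ⟩
  /-- The infinitesimal action of `τ` on sections is `𝔜 ↦ -δ(τ) * 𝔜`.  It is expressed through the
  pullbacks `g⁻¹ 𝔜` paired with `e ∈ V_x`, using `⟨g⁻¹ 𝔜(g x), e⟩ = ⟨𝔜(g x), g e⟩`: the derivative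
  of this function of `g` at `1` in the direction `τ` is `⟨(δ(τ) * 𝔜)(x), e⟩`. -/
  bracket_eq : ∀ (τ : GroupLieAlgebra 𝓘(ℝ, EG) G) (v : SmoothSec E M F V) (x : M) (e : V x),
    mvfderiv 𝓘(ℝ, EG) (fun g : G => C.pairing (g • x) (v (g • x)) (φ.toFun g x e)) 1 τ =
      C.pairing x (C.bracket (δ τ) v x) e
  isotropic : ∀ (τ σ : GroupLieAlgebra 𝓘(ℝ, EG) G) (x : M), C.pairing x (δ τ x) (δ σ x) = 0

end ExactCourantAlgebroid

variable {G} in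
/-- The structure constants `c^k_{il}` of the Lie algebra of a Lie group in a basis:
`[τ_i, τ_l] = ∑ k, c^k_{il} τ_k`. -/
def structureConstants {r : ℕ} (b : Module.Basis (Fin r) ℝ (GroupLieAlgebra 𝓘(ℝ, EG) G)) :
    Fin r → Fin r → Fin r → ℝ :=
  fun i l k => b.repr ⁅b i, b l⁆ k

end GroupAction

end
end Courant

open scoped Manifold ContDiff

/-! Compactness of `G` is used to find a `G`-invariant isotropic splitting s: a splitting of the
anchor is averaged over `G` and then corrected by a canonical formula to an isotropic one
(`exists_invariant_isotropicSplitting`). Infinitesimally, invariance says δ(τ) * s(Y) = s([X_τ, Y])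
for every vector field Y (`IsIsotropicExtended.bracket_sec`). The rest is algebra at this s.

Two isotropic splittings differ by exactly one 2-form B, and the twisted operators d, ι and L
commute with e^B ∧, since the changes of H and ξ cancel the commutators of e^B ∧ with the untwisted
operators. A spinor is therefore the same as its value at s, and `extend` inverts the evaluation.
Write δ(τ_j) = s(X_j) + ξ_j. At s the differential is d - H - Σ u_j (ι_{X_j} + ξ_j ∧), which is d_G
- H_G for H_G = H + Σ u_j ξ_j (`equivDiff_eq_twistedDiff`). Invariance of s gives dξ_j = ι_{X_j} H
(`extDeriv_covector`), so L_{δ(τ_j)} becomes the ordinary Lie derivative and the conditions that cut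
out the complexes agree too. The isomorphism thus exists before passing to cohomology, and it
commutes with products from the right.

What remains is about H_G. By order in u, d_G H_G consists of dH, which vanishes by the Jacobi
identity; of u_j (dξ_j - ι_{X_j} H) = 0; and of -Σ u_i u_j ξ_j(X_i), which vanishes because isotropy
makes ξ_j(X_i) antisymmetric. For the Cartan condition, L_{X_i} H = 0, while L_{X_i} ξ_j is the
covector part of δ(τ_i) * δ(τ_j), again antisymmetric by isotropy. If δ reverses brackets, then
L_{X_i} ξ_l = -Σ c^k_{il} ξ_k cancels against the coadjoint action on u_l. -/

namespace Forms

/-! ### Cartan calculus for inhomogeneous forms. -/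

section CartanCalculus

set_option linter.unusedSectionVars false

variable {A L : Type*} [CommRing A] [Algebra ℝ A] [LieRing L] [LieAlgebra ℝ L] [Module A L]
  [LieRingModule L A] [LieRinehartRing A L] [LieRinehartAlgebra ℝ A L]

theorem apply_zero_ext {ρ σ : Forms A L} (h : ρ 0 ![] = σ 0 ![]) : ρ 0 = σ 0 := by
  ext v
  rw [Subsingleton.elim v ![], h]

/-- With `apply_zero_ext` this is the induction principle of the section: compare functions in
degree zero, and in the step compare contractions, which are computed by the Leibniz and commutator
rules. -/
theorem apply_succ_ext {ρ σ : Forms A L} {n : ℕ} (h : ∀ X, contract X ρ n = contract X σ n) :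
    ρ (n + 1) = σ (n + 1) := by
  ext v
  have := DFunLike.congr_fun (h (v 0)) (Fin.tail v)
  change ρ (n + 1) (Matrix.vecCons (v 0) (Fin.tail v)) =
    σ (n + 1) (Matrix.vecCons (v 0) (Fin.tail v)) at this
  rwa [Form.vecCons_tail] at this

theorem neg_one_smul_form {n : ℕ} (η : Form A L n) : (-1 : A) • η = -η := neg_one_smul A η

noncomputable section

/-- The grading involution as a linear map. -/
def sgnHom : Forms A L →ₗ[ℝ] Forms A L where
  toFun := sgn
  map_add' := sgn_add
  map_smul' := sgn_real_smul

theorem sgnHom_apply (ρ : Forms A L) : sgnHom ρ = sgn ρ := rfl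

theorem sgn_apply_zero (ρ : Forms A L) : sgn ρ 0 = ρ 0 := by
  change (-1 : A) ^ 0 • ρ 0 = ρ 0
  simp

theorem sgn_contract (X : L) (ρ : Forms A L) : sgn (contract X ρ) = -contract X (sgn ρ) := by
  rw [contract_sgn, neg_neg]

theorem sgn_wedge (a b : Forms A L) : sgn (wedge a b) = wedge (sgn a) (sgn b) := by
  -- The forms stay quantified inside the induction because the step replaces them by their
  -- contractions.
  suffices h : ∀ (n : ℕ) (a b : Forms A L), sgn (wedge a b) n = wedge (sgn a) (sgn b) n from
    funext fun n => h n a b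
  intro n
  induction n with
  | zero =>
    intro a b
    refine apply_zero_ext ?_
    rw [sgn_apply_zero, wedge_apply_zero, wedge_apply_zero, sgn_apply_zero, sgn_apply_zero]
  | succ n ih =>
    intro a b
    refine apply_succ_ext fun X => ?_
    rw [contract_sgn, contract_wedge, contract_wedge, sgn_add, neg_add, Pi.add_apply, Pi.add_apply,
      Pi.neg_apply, Pi.neg_apply, ih, ih, contract_sgn, contract_sgn, map_neg, map_neg,
      LinearMap.neg_apply, Pi.neg_apply, Pi.neg_apply]

theorem wedge_assoc (a b c : Forms A L) : wedge (wedge a b) c = wedge a (wedge b c) := by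
  suffices h : ∀ (n : ℕ) (a b c : Forms A L),
      wedge (wedge a b) c n = wedge a (wedge b c) n from funext fun n => h n a b c
  intro n
  induction n with
  | zero =>
    intro a b c
    refine apply_zero_ext ?_
    simp only [wedge_apply_zero, mul_assoc]
  | succ n ih =>
    intro a b c
    refine apply_succ_ext fun X => ?_
    simp only [contract_wedge, map_add, LinearMap.add_apply, Pi.add_apply, sgn_wedge, ih, add_assoc]

/-- Graded commutativity. Contraction exchanges even and odd forms, so the two parities of `a` must
be treated in one induction. -/
theorem wedge_comm_aux (n : ℕ) : ∀ a b : Forms A L,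
    (sgn a = a → wedge a b n = wedge b a n) ∧
      (sgn a = -a → wedge a b n = wedge (sgn b) a n) := by
  induction n with
  | zero =>
    intro a b
    refine ⟨fun _ => apply_zero_ext ?_, fun _ => apply_zero_ext ?_⟩
    · simp only [wedge_apply_zero, mul_comm]
    · simp only [wedge_apply_zero, sgn_apply_zero, mul_comm]
  | succ n ih =>
    intro a b
    refine ⟨fun ha => apply_succ_ext fun X => ?_, fun ha => apply_succ_ext fun X => ?_⟩
    · have hX : sgn (contract X a) = -contract X a := by rw [sgn_contract, ha]
      rw [contract_wedge, contract_wedge, Pi.add_apply, Pi.add_apply, ha, (ih _ _).2 hX,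
        (ih _ _).1 ha, add_comm]
    · have hX : sgn (contract X a) = contract X a := by
        rw [sgn_contract, ha, map_neg, neg_neg]
      rw [contract_wedge, contract_wedge, Pi.add_apply, Pi.add_apply, ha, (ih _ _).1 hX, sgn_sgn,
        contract_sgn, map_neg, map_neg, LinearMap.neg_apply, LinearMap.neg_apply, Pi.neg_apply,
        Pi.neg_apply, (ih _ _).2 ha, add_comm]

theorem wedge_comm_of_even {a : Forms A L} (ha : sgn a = a) (b : Forms A L) :
    wedge a b = wedge b a := funext fun n => (wedge_comm_aux n a b).1 ha

theorem wedge_left_comm_of_even {a : Forms A L} (ha : sgn a = a) (b c : Forms A L) :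
    wedge a (wedge b c) = wedge b (wedge a c) := by
  rw [← wedge_assoc, wedge_comm_of_even ha, wedge_assoc]

theorem lieD_apply_zero (X : L) (ρ : Forms A L) : lieD X ρ 0 ![] = ⁅X, ρ 0 ![]⁆ := by
  change Form.lieDeriv X (ρ 0) ![] = _
  simp [Form.lieDeriv_apply]

/-- The summand of `Form.lieDeriv` at the first slot is the contraction with the bracket; the other
summands make up the Lie derivative of the contraction. -/
theorem contract_lieD (X Y : L) (ρ : Forms A L) :
    contract Y (lieD X ρ) = lieD X (contract Y ρ) - contract ⁅X, Y⁆ ρ := by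
  funext n
  ext v
  change Form.lieDeriv X (ρ (n + 1)) (Matrix.vecCons Y v) =
    Form.lieDeriv X ((ρ (n + 1)).curryLeft Y) v - ρ (n + 1) (Matrix.vecCons ⁅X, Y⁆ v)
  rw [Form.lieDeriv_apply, Form.lieDeriv_apply, Fin.sum_univ_succ]
  have h0 : Function.update (Matrix.vecCons Y v) 0 ⁅X, Matrix.vecCons Y v 0⁆ =
      Matrix.vecCons ⁅X, Y⁆ v := Fin.update_cons_zero (α := fun _ => L) Y v ⁅X, Y⁆
  simp only [h0, AlternatingMap.curryLeft_apply_apply, Form.vecCons_update, Matrix.cons_val_succ]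
  abel

/-- In positive degree this is how the exterior derivative is defined, so only degree zero needs an
argument. -/
theorem contract_d (X : L) (ρ : Forms A L) :
    contract X (d ρ) = lieD X ρ - d (contract X ρ) := by
  funext n
  ext v
  cases n with
  | zero =>
    change ⁅X, ρ 0 ![]⁆ = Form.lieDeriv X (ρ 0) v - 0
    rw [Subsingleton.elim v ![], sub_zero]
    exact (lieD_apply_zero X ρ).symm
  | succ n => rfl

theorem d_apply_zero (ρ : Forms A L) : d ρ 0 = 0 := rfl

/-- In degree zero this is the Lie algebra action on functions. In the step the additional terms are
contractions with double brackets, and the Jacobi identity collects them. -/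
theorem lieD_lieD (X Y : L) (ρ : Forms A L) :
    lieD X (lieD Y ρ) - lieD Y (lieD X ρ) = lieD ⁅X, Y⁆ ρ := by
  suffices h : ∀ (n : ℕ) (ρ : Forms A L),
      (lieD X (lieD Y ρ) - lieD Y (lieD X ρ)) n = lieD ⁅X, Y⁆ ρ n from funext fun n => h n ρ
  intro n
  induction n with
  | zero =>
    intro ρ
    refine apply_zero_ext ?_
    rw [Pi.sub_apply, AlternatingMap.sub_apply]
    simp only [lieD_apply_zero, lie_lie]
  | succ n ih =>
    intro ρ
    refine apply_succ_ext fun Z => ?_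
    have e : contract Z (lieD X (lieD Y ρ) - lieD Y (lieD X ρ)) =
        (lieD X (lieD Y (contract Z ρ)) - lieD Y (lieD X (contract Z ρ))) -
          contract (⁅X, ⁅Y, Z⁆⁆ - ⁅Y, ⁅X, Z⁆⁆) ρ := by
      have hs : contract (⁅X, ⁅Y, Z⁆⁆ - ⁅Y, ⁅X, Z⁆⁆) ρ =
          contract ⁅X, ⁅Y, Z⁆⁆ ρ - contract ⁅Y, ⁅X, Z⁆⁆ ρ :=
        funext fun n => map_sub (ρ (n + 1)).curryLeft _ _
      rw [hs]
      simp only [map_sub, contract_lieD]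
      abel
    rw [e, contract_lieD, Pi.sub_apply, ih, lie_lie, Pi.sub_apply]

/-- After contraction with Y the two sides differ by the same statement for ι_Y ρ and by the
commutator formula `lieD_lieD`. -/
theorem lieD_d (X : L) (ρ : Forms A L) : lieD X (d ρ) = d (lieD X ρ) := by
  suffices h : ∀ (n : ℕ) (ρ : Forms A L), lieD X (d ρ) n = d (lieD X ρ) n from
    funext fun n => h n ρ
  intro n
  induction n with
  | zero =>
    intro ρ
    refine apply_zero_ext ?_
    rw [lieD_apply_zero, d_apply_zero, d_apply_zero]
    simp
  | succ n ih =>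
    intro ρ
    refine apply_succ_ext fun Y => ?_
    rw [contract_lieD, contract_d, contract_d, contract_d, contract_lieD, map_sub, map_sub,
      ← lieD_lieD X Y]
    simp only [Pi.sub_apply, ih]
    abel

/-- Cartan's formula and `lieD_d` give ι_Y d d = d d ι_Y, which lowers the degree. -/
theorem d_d (ρ : Forms A L) : d (d ρ) = 0 := by
  suffices h : ∀ (n : ℕ) (ρ : Forms A L), d (d ρ) n = 0 from funext fun n => h n ρ
  intro n
  induction n with
  | zero => exact fun _ => rfl
  | succ n ih =>
    intro ρ
    have : d (d ρ) (n + 1) = (0 : Forms A L) (n + 1) := by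
      refine apply_succ_ext fun Y => ?_
      rw [contract_d, contract_d, map_sub, lieD_d, map_zero, sub_sub_cancel, ih, Pi.zero_apply]
    exact this

theorem lieD_sgn (X : L) (ρ : Forms A L) : lieD X (sgn ρ) = sgn (lieD X ρ) := by
  funext n
  change Form.lieDeriv X ((-1 : A) ^ n • ρ n) = (-1 : A) ^ n • Form.lieDeriv X (ρ n)
  rcases Nat.even_or_odd n with h | h
  · simp [h.neg_one_pow]
  · rw [h.neg_one_pow, neg_one_smul_form, neg_one_smul_form]
    exact congrFun (map_neg (lieD X) ρ) n

theorem lieD_wedge (X : L) (a b : Forms A L) :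
    lieD X (wedge a b) = wedge (lieD X a) b + wedge a (lieD X b) := by
  suffices h : ∀ (n : ℕ) (a b : Forms A L),
      lieD X (wedge a b) n = (wedge (lieD X a) b + wedge a (lieD X b)) n from
    funext fun n => h n a b
  intro n
  induction n with
  | zero =>
    intro a b
    refine apply_zero_ext ?_
    rw [Pi.add_apply, AlternatingMap.add_apply, lieD_apply_zero]
    simp only [wedge_apply_zero, lieD_apply_zero, LieRinehartRing.leibniz_mul_right]
    ring
  | succ n ih =>
    intro a b
    refine apply_succ_ext fun Y => ?_
    simp only [contract_lieD, contract_wedge, map_add, map_sub, LinearMap.sub_apply, Pi.add_apply,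
      Pi.sub_apply, ih, lieD_sgn]
    abel

theorem d_wedge (a b : Forms A L) :
    d (wedge a b) = wedge (d a) b + wedge (sgn a) (d b) := by
  suffices h : ∀ (n : ℕ) (a b : Forms A L),
      d (wedge a b) n = (wedge (d a) b + wedge (sgn a) (d b)) n from funext fun n => h n a b
  intro n
  induction n with
  | zero =>
    intro a b
    refine apply_zero_ext ?_
    rw [Pi.add_apply, AlternatingMap.add_apply, wedge_apply_zero, wedge_apply_zero, d_apply_zero,
      d_apply_zero, d_apply_zero]
    simp
  | succ n ih =>
    intro a b
    refine apply_succ_ext fun Y => ?_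
    -- Since d raises the degree by one, it anticommutes with the grading involution; the sign is
    -- needed when ι_Y meets sgn a ∧ db.
    have hs : sgn (d a) = -d (sgn a) := by
      funext n
      cases n with
      | zero => simp [sgn_apply_zero, d_apply_zero]
      | succ n =>
        change (-1 : A) ^ (n + 1) • Form.extDeriv (a n) = -(Form.extDeriv ((-1 : A) ^ n • a n))
        have hn : Form.extDeriv (-(a n)) = -Form.extDeriv (a n) :=
          congrFun (map_neg d a) (n + 1)
        rcases Nat.even_or_odd n with h | h
        · simp [pow_succ, h.neg_one_pow, neg_one_smul_form]
        · simp [pow_succ, h.neg_one_pow, neg_one_smul_form, hn]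
    simp only [contract_d, contract_wedge, lieD_wedge, map_add, map_sub, Pi.add_apply,
      Pi.sub_apply, ih, hs, sgn_sgn, contract_sgn, LinearMap.sub_apply, map_neg,
      LinearMap.neg_apply, Pi.neg_apply]
    abel

theorem sgn_ofForm_even {n : ℕ} (hn : Even n) (η : Form A L n) : sgn (ofForm η) = ofForm η := by
  funext k
  change (-1 : A) ^ k • (Pi.single n η : Forms A L) k = (Pi.single n η : Forms A L) k
  by_cases h : k = n
  · subst h; simp [hn.neg_one_pow]
  · simp [h]

theorem contract_ofForm {n : ℕ} (X : L) (η : Form A L (n + 1)) :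
    contract X (ofForm η) = ofForm (η.curryLeft X) := by
  funext k
  change ((Pi.single (n + 1) η : Forms A L) (k + 1)).curryLeft X = (Pi.single n _ : Forms A L) k
  by_cases h : k = n
  · subst h; simp
  · rw [Pi.single_eq_of_ne h, Pi.single_eq_of_ne (by omega)]
    rfl

theorem d_ofForm {n : ℕ} (η : Form A L n) : d (ofForm η) = ofForm η.extDeriv := by
  funext k
  cases k with
  | zero =>
    change 0 = (Pi.single (n + 1) _ : Forms A L) 0
    rw [Pi.single_eq_of_ne (by omega)]
  | succ k =>
    change Form.extDeriv ((Pi.single n η : Forms A L) k) = (Pi.single (n + 1) _ : Forms A L) (k + 1)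
    by_cases h : k = n
    · subst h; simp
    · rw [Pi.single_eq_of_ne h, Pi.single_eq_of_ne (by omega)]
      exact congrFun (map_zero d) (k + 1)

theorem lieD_ofForm {n : ℕ} (X : L) (η : Form A L n) :
    lieD X (ofForm η) = ofForm (Form.lieDeriv X η) := by
  funext k
  change Form.lieDeriv X ((Pi.single n η : Forms A L) k) = (Pi.single n _ : Forms A L) k
  by_cases h : k = n
  · subst h; simp
  · rw [Pi.single_eq_of_ne h, Pi.single_eq_of_ne h]
    exact congrFun (map_zero (lieD X)) k

theorem ofForm_add {n : ℕ} (η η' : Form A L n) : ofForm (η + η') = ofForm η + ofForm η' :=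
  Pi.single_add _ _ _

theorem ofForm_sub {n : ℕ} (η η' : Form A L n) : ofForm (η - η') = ofForm η - ofForm η' :=
  Pi.single_sub _ _ _

theorem ofForm_zero {n : ℕ} : ofForm (0 : Form A L n) = 0 := Pi.single_zero _

/-- Locality in the degree: it allows the exponential series to be truncated inside a product. -/
theorem wedge_congr_right {n : ℕ} (a : Forms A L) {b b' : Forms A L}
    (h : ∀ k ≤ n, b k = b' k) : wedge a b n = wedge a b' n := by
  induction n generalizing a b b' with
  | zero =>
    refine apply_zero_ext ?_
    rw [wedge_apply_zero, wedge_apply_zero, h 0 le_rfl]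
  | succ n ih =>
    refine apply_succ_ext fun X => ?_
    rw [contract_wedge, contract_wedge, Pi.add_apply, Pi.add_apply,
      ih _ fun k hk => h k (by omega)]
    congr 1
    refine ih _ fun k hk => ?_
    change (b (k + 1)).curryLeft X = (b' (k + 1)).curryLeft X
    rw [h (k + 1) (by omega)]

theorem wedge_congr_left {n : ℕ} {a a' : Forms A L} (b : Forms A L)
    (h : ∀ k ≤ n, a k = a' k) : wedge a b n = wedge a' b n := by
  induction n generalizing a a' b with
  | zero =>
    refine apply_zero_ext ?_
    rw [wedge_apply_zero, wedge_apply_zero, h 0 le_rfl]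
  | succ n ih =>
    refine apply_succ_ext fun X => ?_
    rw [contract_wedge, contract_wedge, Pi.add_apply, Pi.add_apply]
    congr 1
    · refine ih _ fun k hk => ?_
      change (a (k + 1)).curryLeft X = (a' (k + 1)).curryLeft X
      rw [h (k + 1) (by omega)]
    · refine ih _ fun k hk => ?_
      change (-1 : A) ^ k • a k = (-1 : A) ^ k • a' k
      rw [h k (by omega)]

end

end CartanCalculus

end Forms

/-! ### The operator e^B ∧, its commutation rules, and parity. -/

namespace Forms

section Exponential

set_option linter.unusedSectionVars false

variable {A L : Type*} [CommRing A] [Algebra ℝ A] [LieRing L] [LieAlgebra ℝ L] [Module A L]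
  [LieRingModule L A] [LieRinehartRing A L] [LieRinehartAlgebra ℝ A L]

noncomputable section

/-- Orders of vanishing add under the product. Hence the j-th power of B ∧ starts in degree 2j, and
each degree sees only finitely many terms of the exponential. -/
theorem wedge_apply_eq_zero {p q n : ℕ} {a b : Forms A L} (ha : ∀ k < p, a k = 0)
    (hb : ∀ k < q, b k = 0) (hn : n < p + q) : wedge a b n = 0 := by
  induction n generalizing p q a b with
  | zero =>
    have : wedge a b 0 = (0 : Forms A L) 0 := by
      refine apply_zero_ext ?_
      rw [wedge_apply_zero]
      rcases Nat.eq_zero_or_pos p with h | h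
      · rw [hb 0 (by omega)]; simp
      · rw [ha 0 h]; simp
    exact this
  | succ n ih =>
    have : wedge a b (n + 1) = (0 : Forms A L) (n + 1) := by
      refine apply_succ_ext fun X => ?_
      -- Contraction lowers one of the two orders by one. Truncated subtraction is harmless: if p =
      -- 0 then the bound already follows from q alone, and conversely.
      rw [contract_wedge, Pi.add_apply, ih (p := p - 1) (q := q) _ hb (by omega),
        ih (p := p) (q := q - 1) _ _ (by omega), map_zero, add_zero]
      · rfl
      · intro k hk
        change (-1 : A) ^ k • a k = 0
        rw [ha k hk, smul_zero]
      · intro k hk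
        change (b (k + 1)).curryLeft X = 0
        rw [hb (k + 1) (by omega)]; rfl
      · intro k hk
        change (a (k + 1)).curryLeft X = 0
        rw [ha (k + 1) (by omega)]; rfl
    exact this

theorem wedge_pow_apply_eq_zero (B : Form A L 2) (ρ : Forms A L) (j : ℕ) :
    ∀ n < 2 * j, (wedge (ofForm B) ^ j) ρ n = 0 := by
  induction j with
  | zero => intro n hn; omega
  | succ j ih =>
    intro n hn
    rw [pow_succ', Module.End.mul_apply]
    refine wedge_apply_eq_zero (p := 2) (q := 2 * j) (fun k hk => ?_) ih (by omega)
    exact Pi.single_eq_of_ne (by omega) _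

/-- The partial sums of the exponential series of `B ∧`. -/
def expTrunc (B : Form A L 2) (N : ℕ) : Module.End ℝ (Forms A L) :=
  ∑ j ∈ Finset.range N, (1 / (j.factorial : ℝ)) • wedge (ofForm B) ^ j

/-- The cutoff in `expWedge` depends on the degree, whereas `expTrunc` is a polynomial in B ∧ and
can be handled in the endomorphism ring. Here the extra terms vanish for degree reasons. -/
theorem expWedge_apply_eq (B : Form A L 2) (ρ : Forms A L) {n N : ℕ} (h : n < N) :
    expWedge B ρ n = expTrunc B N ρ n := by
  have h1 : expWedge B ρ n = ∑ j ∈ Finset.range (n + 1),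
      (1 / (j.factorial : ℝ)) • (wedge (ofForm B) ^ j) ρ n := by
    simp [expWedge]
  have h2 : expTrunc B N ρ n = ∑ j ∈ Finset.range N,
      (1 / (j.factorial : ℝ)) • (wedge (ofForm B) ^ j) ρ n := by
    simp [expTrunc, LinearMap.sum_apply, Finset.sum_apply]
  rw [h1, h2]
  refine Finset.sum_subset (Finset.range_mono (by omega)) fun j _ hj => ?_
  rw [Finset.mem_range] at hj
  rw [wedge_pow_apply_eq_zero B ρ j n (by omega), smul_zero]

/-- The commutator with T is a derivation, and its value C on P commutes with P, so powers are
differentiated as usual. -/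
theorem mul_pow_of_commutator {R : Type*} [Ring R] [Algebra ℝ R] {T P C : R}
    (h : T * P = P * T + C) (hC : P * C = C * P) (j : ℕ) :
    T * P ^ (j + 1) = P ^ (j + 1) * T + ((j : ℝ) + 1) • (P ^ j * C) := by
  induction j with
  | zero => simp [h]
  | succ j ih =>
    have e : P ^ j * C * P = P ^ (j + 1) * C := by rw [mul_assoc, ← hC, ← mul_assoc, pow_succ]
    rw [pow_succ P (j + 1), ← mul_assoc, ih, add_mul, mul_assoc _ T P, h, mul_add, smul_mul_assoc,
      e, ← mul_assoc, add_assoc]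
    congr 1
    rw [Nat.cast_succ, add_smul ((j : ℝ) + 1) (1 : ℝ), one_smul, add_comm]

/-- In the weighted sum the factor j + 1 cancels against the factorial, so the commutator is the
partial sum with one term fewer, times C. -/
theorem mul_expTrunc {T C P : Module.End ℝ (Forms A L)} {B : Form A L 2}
    (hP : P = wedge (ofForm B)) (h : T * P = P * T + C) (hC : P * C = C * P) (N : ℕ) :
    T * expTrunc B (N + 1) = expTrunc B (N + 1) * T + expTrunc B N * C := by
  induction N with
  | zero => simp [expTrunc]
  | succ N ih =>
    have e : ∀ N, expTrunc B (N + 1) =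
        expTrunc B N + (1 / (N.factorial : ℝ)) • P ^ N :=
      fun N => hP ▸ Finset.sum_range_succ _ _
    have hN : (1 / ((N + 1).factorial : ℝ)) * ((N : ℝ) + 1) = 1 / (N.factorial : ℝ) := by
      rw [Nat.factorial_succ]
      push_cast
      have : (N.factorial : ℝ) ≠ 0 := by positivity
      have : (N : ℝ) + 1 ≠ 0 := by positivity
      field_simp
    have hp : T * P ^ (N + 1) = P ^ (N + 1) * T + ((N : ℝ) + 1) • (P ^ N * C) :=
      mul_pow_of_commutator (R := Module.End ℝ (Forms A L)) h hC N
    rw [e (N + 1), mul_add, ih, add_mul, mul_smul_comm, hp, smul_add,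
      smul_smul, hN, e N]
    simp only [add_mul, smul_mul_assoc]
    abel

/-- The operator only uses components of bounded degree. -/
def IsLocalOp (T : Forms A L →ₗ[ℝ] Forms A L) : Prop :=
  ∀ (ρ σ : Forms A L) (n : ℕ), (∀ k ≤ n + 1, ρ k = σ k) → T ρ n = T σ n

/-- This is T e^P = e^P (T + C) for P = B ∧. The behaviour of d, L_X, ι_X, products and the grading
involution under e^B ∧ all comes from it, with C the contribution of B (or zero). -/
theorem expWedge_intertwine {T C : Forms A L →ₗ[ℝ] Forms A L} (hT : IsLocalOp T)
    {B : Form A L 2}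
    (h : ∀ ρ, T (wedge (ofForm B) ρ) = wedge (ofForm B) (T ρ) + C ρ)
    (hC : ∀ ρ, wedge (ofForm B) (C ρ) = C (wedge (ofForm B) ρ)) (ρ : Forms A L) :
    T (expWedge B ρ) = expWedge B (T ρ) + expWedge B (C ρ) := by
  funext n
  -- With n + 3 terms the partial sum is exact up to degree n + 2. This covers degree n + 1, the
  -- highest that T may read; the sum in front of C has n + 2 terms, enough in degree n.
  have key := congrFun (LinearMap.congr_fun (mul_expTrunc (T := T) (C := C) (B := B) rfl
    (LinearMap.ext h) (LinearMap.ext hC) (n + 2)) ρ) n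
  rw [hT _ (expTrunc B (n + 2 + 1) ρ) n fun k hk => expWedge_apply_eq B ρ (by omega),
    Pi.add_apply, expWedge_apply_eq B (T ρ) (show n < n + 2 + 1 by omega),
    expWedge_apply_eq B (C ρ) (show n < n + 2 by omega)]
  exact key

theorem isLocalOp_contract (X : L) : IsLocalOp (contract X : Forms A L →ₗ[ℝ] Forms A L) := by
  intro ρ σ n h
  change (ρ (n + 1)).curryLeft X = (σ (n + 1)).curryLeft X
  rw [h _ le_rfl]

theorem isLocalOp_lieD (X : L) : IsLocalOp (lieD X : Forms A L →ₗ[ℝ] Forms A L) := by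
  intro ρ σ n h
  change Form.lieDeriv X (ρ n) = Form.lieDeriv X (σ n)
  rw [h n (by omega)]

theorem isLocalOp_d : IsLocalOp (d : Forms A L →ₗ[ℝ] Forms A L) := by
  intro ρ σ n h
  cases n with
  | zero => rfl
  | succ n =>
    change Form.extDeriv (ρ n) = Form.extDeriv (σ n)
    rw [h n (by omega)]

theorem isLocalOp_wedge (a : Forms A L) : IsLocalOp (wedge a) :=
  fun _ _ _ h => wedge_congr_right a fun k hk => h k (by omega)

theorem isLocalOp_wedge_flip (a : Forms A L) : IsLocalOp (wedge.flip a) :=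
  fun _ _ _ h => wedge_congr_left a fun k hk => h k (by omega)

theorem isLocalOp_sgnHom : IsLocalOp (sgnHom : Forms A L →ₗ[ℝ] Forms A L) := by
  intro ρ σ n h
  change (-1 : A) ^ n • ρ n = (-1 : A) ^ n • σ n
  rw [h n (by omega)]

variable (B : Form A L 2)

theorem sgn_ofForm_two : sgn (ofForm B) = ofForm B := sgn_ofForm_even even_two B

theorem wedge_two_left_comm (a b : Forms A L) :
    wedge (ofForm B) (wedge a b) = wedge a (wedge (ofForm B) b) :=
  wedge_left_comm_of_even (sgn_ofForm_two B) a b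

theorem contract_expWedge (X : L) (ρ : Forms A L) :
    contract X (expWedge B ρ) =
      expWedge B (contract X ρ) + expWedge B (wedge (ofForm (B.curryLeft X)) ρ) :=
  expWedge_intertwine (C := wedge (ofForm (B.curryLeft X))) (isLocalOp_contract X)
    (fun ρ => by rw [contract_wedge, sgn_ofForm_two, contract_ofForm, add_comm])
    (fun ρ => wedge_two_left_comm B _ _) ρ

theorem lieD_expWedge (X : L) (ρ : Forms A L) :
    lieD X (expWedge B ρ) =
      expWedge B (lieD X ρ) + expWedge B (wedge (ofForm (Form.lieDeriv X B)) ρ) :=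
  expWedge_intertwine (C := wedge (ofForm (Form.lieDeriv X B))) (isLocalOp_lieD X)
    (fun ρ => by rw [lieD_wedge, lieD_ofForm, add_comm])
    (fun ρ => wedge_two_left_comm B _ _) ρ

theorem d_expWedge (ρ : Forms A L) :
    d (expWedge B ρ) = expWedge B (d ρ) + expWedge B (wedge (ofForm B.extDeriv) ρ) :=
  expWedge_intertwine (C := wedge (ofForm B.extDeriv)) isLocalOp_d
    (fun ρ => by rw [d_wedge, sgn_ofForm_two, d_ofForm, add_comm])
    (fun ρ => wedge_two_left_comm B _ _) ρ

theorem wedge_expWedge (a ρ : Forms A L) :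
    wedge a (expWedge B ρ) = expWedge B (wedge a ρ) := by
  have := expWedge_intertwine (C := 0) (B := B) (isLocalOp_wedge a)
    (fun ρ => by rw [wedge_two_left_comm]; simp) (fun ρ => by simp) ρ
  simpa using this

theorem expWedge_wedge (ρ a : Forms A L) :
    expWedge B (wedge ρ a) = wedge (expWedge B ρ) a := by
  have := expWedge_intertwine (C := 0) (B := B) (isLocalOp_wedge_flip a)
    (fun ρ => by simp [wedge_assoc]) (fun ρ => by simp) ρ
  simpa using this.symm

theorem sgn_expWedge (ρ : Forms A L) : sgn (expWedge B ρ) = expWedge B (sgn ρ) := by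
  have := expWedge_intertwine (C := 0) (B := B) (isLocalOp_sgnHom)
    (fun ρ => by simp [sgnHom_apply, sgn_wedge, sgn_ofForm_two]) (fun ρ => by simp) ρ
  simpa [sgnHom_apply] using this

theorem expWedge_apply_zero (ρ : Forms A L) : expWedge B ρ 0 = ρ 0 := by
  simp [expWedge]

/-- By `contract_expWedge` both sides obey the same recursion under contraction, which replaces a
binomial expansion. -/
theorem expWedge_add (B' : Form A L 2) (ρ : Forms A L) :
    expWedge (B + B') ρ = expWedge B (expWedge B' ρ) := by
  suffices h : ∀ (n : ℕ) (ρ : Forms A L),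
      expWedge (B + B') ρ n = expWedge B (expWedge B' ρ) n from funext fun n => h n ρ
  intro n
  induction n with
  | zero => intro ρ; simp only [expWedge_apply_zero]
  | succ n ih =>
    intro ρ
    refine apply_succ_ext fun X => ?_
    have e : ofForm ((B + B').curryLeft X) = ofForm (B.curryLeft X) + ofForm (B'.curryLeft X) :=
      ofForm_add (B.curryLeft X) (B'.curryLeft X)
    simp only [contract_expWedge, e, map_add, LinearMap.add_apply, Pi.add_apply, ih, wedge_expWedge]
    abel

theorem expWedge_zero (ρ : Forms A L) : expWedge (0 : Form A L 2) ρ = ρ := by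
  suffices h : ∀ (n : ℕ) (ρ : Forms A L), expWedge (0 : Form A L 2) ρ n = ρ n from
    funext fun n => h n ρ
  intro n
  induction n with
  | zero => intro ρ; rw [expWedge_apply_zero]
  | succ n ih =>
    intro ρ
    refine apply_succ_ext fun X => ?_
    have e : ofForm ((0 : Form A L 2).curryLeft X) = 0 := ofForm_zero
    simp only [contract_expWedge, e, map_zero, LinearMap.zero_apply, add_zero, ih]

/-- The sign `(-1)^p`. -/
def paritySign (p : ZMod 2) : ℝ := if p = 0 then 1 else -1

theorem paritySign_natCast (n : ℕ) : paritySign (n : ZMod 2) = (-1) ^ n := by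
  unfold paritySign
  rcases Nat.even_or_odd n with h | h
  · rw [if_pos ((ZMod.natCast_eq_zero_iff_even).2 h), h.neg_one_pow]
  · rw [if_neg (fun h0 => Nat.not_even_iff_odd.2 h ((ZMod.natCast_eq_zero_iff_even).1 h0)),
      h.neg_one_pow]

theorem paritySign_add (p q : ZMod 2) : paritySign (p + q) = paritySign p * paritySign q := by
  obtain ⟨m, rfl⟩ := ZMod.natCast_zmod_surjective p
  obtain ⟨n, rfl⟩ := ZMod.natCast_zmod_surjective q
  rw [← Nat.cast_add, paritySign_natCast, paritySign_natCast, paritySign_natCast, pow_add]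

theorem paritySign_injective : Function.Injective paritySign := by
  intro p q h
  have h2 : ∀ p : ZMod 2, p = 0 ∨ p = 1 := by decide
  rcases h2 p with rfl | rfl <;> rcases h2 q with rfl | rfl <;> first | rfl | norm_num [paritySign] at h

theorem sgn_apply (ρ : Forms A L) (n : ℕ) : sgn ρ n = paritySign (n : ZMod 2) • ρ n := by
  change (-1 : A) ^ n • ρ n = _
  rw [paritySign_natCast]
  rcases Nat.even_or_odd n with h | h
  · simp [h.neg_one_pow]
  · rw [h.neg_one_pow, h.neg_one_pow, neg_one_smul_form]
    exact (neg_one_smul ℝ (ρ n)).symm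

/-- Parity as an eigenspace of the grading involution: preservation of parity then follows from
commutation rules with `sgn`. -/
theorem mem_parity_iff {p : ZMod 2} {ρ : Forms A L} :
    ρ ∈ parity p ↔ sgn ρ = paritySign p • ρ := by
  constructor
  · intro h
    funext n
    rw [sgn_apply, Pi.smul_apply]
    by_cases hn : (n : ZMod 2) = p
    · rw [hn]
    · rw [h n hn, smul_zero, smul_zero]
  · intro h n hn
    have := congrFun h n
    rw [sgn_apply, Pi.smul_apply] at this
    ext v
    have hv := DFunLike.congr_fun this v
    rw [AlternatingMap.smul_apply, AlternatingMap.smul_apply, ← sub_eq_zero, ← sub_smul] at hv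
    exact (smul_eq_zero.1 hv).resolve_left
      (sub_ne_zero.2 fun h0 => hn (paritySign_injective h0))

theorem wedge_mem_parity {p q : ZMod 2} {a b : Forms A L} (ha : a ∈ parity p)
    (hb : b ∈ parity q) : wedge a b ∈ parity (p + q) := by
  rw [mem_parity_iff] at *
  rw [sgn_wedge, ha, hb, map_smul, map_smul, LinearMap.smul_apply, smul_smul, paritySign_add,
    mul_comm]

theorem expWedge_mem_parity {p : ZMod 2} {a : Forms A L} (ha : a ∈ parity p) :
    expWedge B a ∈ parity p := by
  rw [mem_parity_iff] at *
  rw [sgn_expWedge, ha, map_smul]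

theorem ofForm_mem_parity {n : ℕ} (η : Form A L n) : ofForm η ∈ parity (n : ZMod 2) := by
  intro k hk
  exact Pi.single_eq_of_ne (fun h => hk (by rw [h])) _

end

end Exponential

end Forms

/-! ### From an isomorphism of complexes to cohomology. -/

theorem IsoCohomology.of_inverse {W W' W₀ : Type*} [AddCommGroup W] [Module ℝ W] [AddCommGroup W']
    [Module ℝ W'] [AddCommGroup W₀] [Module ℝ W₀]
    {D : W →ₗ[ℝ] W} {C : ZMod 2 → Submodule ℝ W} {mul : W → W₀ → W}
    {D' : W' →ₗ[ℝ] W'} {C' : ZMod 2 → Submodule ℝ W'} (mul' : W' →ₗ[ℝ] W₀ →ₗ[ℝ] W')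
    {D₀ : W₀ →ₗ[ℝ] W₀} {C₀ : ZMod 2 → Submodule ℝ W₀}
    (e : W' →ₗ[ℝ] W) (π : W →ₗ[ℝ] W') (hπ : ∀ w, π (e w) = w)
    (hC : ∀ p, ∀ z ∈ C p, e (π z) = z) (he : ∀ p, ∀ w ∈ C' p, e w ∈ C p)
    (hπC : ∀ p, ∀ z ∈ C p, π z ∈ C' p) (hD : ∀ w, D (e w) = e (D' w))
    (hmul : ∀ w α, mul (e w) α = e (mul' w α))
    (hmulC : ∀ p q, ∀ w ∈ C' p, ∀ α ∈ C₀ q, mul' w α ∈ C' (p + q))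
    (hmulD : ∀ w, ∀ α, D₀ α = 0 → D' (mul' w α) = mul' (D' w) α) :
    IsoCohomology D C mul D' C' (fun w α => mul' w α) D₀ C₀ := by
  -- On `C` the map `π` inherits the chain map property from `e`, although `e ∘ π` is the identity
  -- only there.
  have hD' : ∀ p, ∀ z ∈ C p, D' (π z) = π (D z) := fun p z hz => by
    rw [← hπ (D' (π z)), ← hD, hC p z hz]
  let f : ∀ p, (C p ⊓ LinearMap.ker D : Submodule ℝ W) ≃ₗ[ℝ]
      (C' p ⊓ LinearMap.ker D' : Submodule ℝ W') := fun p =>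
    { toFun := fun z => ⟨π z, hπC p z z.2.1, by
        refine LinearMap.mem_ker.2 ?_
        rw [hD' p z z.2.1, LinearMap.mem_ker.1 z.2.2, map_zero]⟩
      map_add' := fun x y => Subtype.ext (map_add π x.1 y.1)
      map_smul' := fun c x => Subtype.ext (map_smul π c x.1)
      invFun := fun w => ⟨e w, he p w w.2.1, by
        refine LinearMap.mem_ker.2 ?_
        rw [hD, LinearMap.mem_ker.1 w.2.2, map_zero]⟩
      left_inv := fun z => Subtype.ext (hC p z z.2.1)
      right_inv := fun w => Subtype.ext (hπ w) }
  have hf : ∀ p, (((C (p + 1)).map D).comap (C p ⊓ LinearMap.ker D).subtype).map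
      (f p : (C p ⊓ LinearMap.ker D : Submodule ℝ W) →ₗ[ℝ]
        (C' p ⊓ LinearMap.ker D' : Submodule ℝ W')) =
      ((C' (p + 1)).map D').comap (C' p ⊓ LinearMap.ker D').subtype := by
    intro p
    ext w
    constructor
    · rintro ⟨z, ⟨y, hy, hyz⟩, rfl⟩
      refine ⟨π y, hπC _ y hy, ?_⟩
      rw [hD' _ y hy, hyz]
      rfl
    · rintro ⟨y, hy, hyw⟩
      refine ⟨(f p).symm w, ⟨e y, he _ y hy, ?_⟩, (f p).apply_symm_apply w⟩
      rw [hD, hyw]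
      rfl
  refine ⟨fun p => Submodule.Quotient.equiv _ _ (f p) (hf p), ?_⟩
  intro p q z z' h α hα
  have h' : (Submodule.Quotient.mk (f p z) : GradedCohomology D' C' p) =
    Submodule.Quotient.mk z' := h
  rw [Submodule.Quotient.eq] at h'
  obtain ⟨y, hy, hyz⟩ := h'
  have hyz' : D' y = π z - z' := hyz
  have hα0 : D₀ α = 0 := hα.2
  have hz0 : D' (π z) = 0 := by
    rw [hD' p z z.2.1, LinearMap.mem_ker.1 z.2.2, map_zero]
  have hw : mul' (π z) α ∈ C' (p + q) ⊓ LinearMap.ker D' :=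
    ⟨hmulC p q _ (hπC p z z.2.1) α hα.1, by
      refine LinearMap.mem_ker.2 ?_
      rw [hmulD _ _ hα0, hz0, map_zero, LinearMap.zero_apply]⟩
  have hez : mul z α = e (mul' (π z) α) := by rw [← hmul, hC p z z.2.1]
  refine ⟨?_, ⟨hmulC p q _ z'.2.1 α hα.1, ?_⟩, ?_⟩
  · rw [hez]
    refine ⟨he _ _ hw.1, ?_⟩
    refine LinearMap.mem_ker.2 ?_
    rw [hD, LinearMap.mem_ker.1 hw.2, map_zero]
  · change D' (mul' z' α) = 0
    rw [hmulD _ _ hα0, LinearMap.mem_ker.1 z'.2.2, map_zero,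
      LinearMap.zero_apply]
  -- The representatives π z and z' differ by D' y. As α is closed, their products differ by D' (y
  -- α).
  · refine (Submodule.Quotient.eq _).2 ⟨mul' y α, ?_, ?_⟩
    · have := hmulC _ _ y hy α hα.1
      rwa [show p + q + 1 = p + 1 + q by ring]
    · rw [hmulD _ _ hα0, hyz', map_sub, LinearMap.sub_apply]
      change _ = π (mul z α) - mul' z' α
      rw [hez, hπ]

/-! ### Formal power series with coefficients in forms. -/

namespace Series

section Operators

set_option linter.unusedSectionVars false

variable {r : ℕ} {W W' W'' : Type*} [AddCommGroup W] [Module ℝ W] [AddCommGroup W'] [Module ℝ W']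
  [AddCommGroup W''] [Module ℝ W'']

noncomputable section

theorem map_apply (f : W →ₗ[ℝ] W') (ρ : Series r W) (m : Fin r →₀ ℕ) : map f ρ m = f (ρ m) := rfl

theorem mulVar_apply (j : Fin r) (ρ : Series r W) (m : Fin r →₀ ℕ) :
    mulVar j ρ m = if m j = 0 then 0 else ρ (m - Finsupp.single j 1) := rfl

theorem mulVar_apply_add (j : Fin r) (ρ : Series r W) (m : Fin r →₀ ℕ) :
    mulVar j ρ (m + Finsupp.single j 1) = ρ m := by
  rw [mulVar_apply, if_neg (by simp), add_tsub_cancel_right]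

/-- Identities for ∂/∂u_k may be checked after multiplication by u_k, where u_k ∂/∂u_k acts
diagonally on coefficients (`mulVar_partialDeriv_apply`). -/
theorem mulVar_injective (j : Fin r) : Function.Injective (mulVar j : Series r W → Series r W) := by
  intro ρ σ h
  funext m
  rw [← mulVar_apply_add j ρ m, ← mulVar_apply_add j σ m]
  exact congrFun h _

theorem map_mulVar (f : W →ₗ[ℝ] W') (j : Fin r) (ρ : Series r W) :
    map f (mulVar j ρ) = mulVar j (map f ρ) := by
  funext m
  simp only [map_apply, mulVar_apply]
  split_ifs
  · exact map_zero f
  · rfl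

theorem map_partialDeriv (f : W →ₗ[ℝ] W') (j : Fin r) (ρ : Series r W) :
    map f (partialDeriv j ρ) = partialDeriv j (map f ρ) :=
  funext fun m => map_smul f ((m j : ℝ) + 1) _

theorem map_coadjoint (f : W →ₗ[ℝ] W') (c : Fin r → Fin r → Fin r → ℝ) (i : Fin r)
    (ρ : Series r W) : map f (coadjoint c i ρ) = coadjoint c i (map f ρ) := by
  simp only [coadjoint, LinearMap.sum_apply, LinearMap.smul_apply, map_sum, map_smul,
    LinearMap.comp_apply, map_mulVar, map_partialDeriv]

theorem diag_apply (T : Fin r → W →ₗ[ℝ] W') (ρ : Series r W) :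
    diag T ρ = ∑ j, mulVar j (map (T j) ρ) := by
  simp only [diag, LinearMap.sum_apply, LinearMap.comp_apply]

theorem mulVar_comm (i j : Fin r) (ρ : Series r W) :
    mulVar i (mulVar j ρ) = mulVar j (mulVar i ρ) := by
  funext m
  simp only [mulVar_apply]
  by_cases hij : i = j
  · subst hij; rfl
  · simp only [Finsupp.coe_tsub, Pi.sub_apply, Finsupp.single_eq_of_ne hij,
      Finsupp.single_eq_of_ne (Ne.symm hij), tsub_zero]
    rw [tsub_right_comm]
    split_ifs <;> rfl

/-- The operator `u_k ∂/∂u_k` multiplies the coefficient at `m` by `m_k`. -/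
theorem mulVar_partialDeriv_apply (k : Fin r) (ρ : Series r W) (m : Fin r →₀ ℕ) :
    mulVar k (partialDeriv k ρ) m = (m k : ℝ) • ρ m := by
  rw [mulVar_apply]
  split_ifs with h
  · simp [h]
  · have hle : Finsupp.single k 1 ≤ m := by
      rw [Finsupp.single_le_iff]; omega
    change (((m - Finsupp.single k 1 : Fin r →₀ ℕ) k : ℝ) + 1) •
      ρ (m - Finsupp.single k 1 + Finsupp.single k 1) = _
    rw [tsub_add_cancel_of_le hle]
    congr 1
    rw [Finsupp.tsub_apply, Finsupp.single_eq_same, Nat.cast_sub (by omega)]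
    simp

/-- The constant power series. -/
def const (w : W) : Series r W := Pi.single 0 w

theorem map_const (f : W →ₗ[ℝ] W') (w : W) : map f (const w : Series r W) = const (f w) := by
  funext m
  rw [map_apply]
  by_cases h : m = 0
  · subst h; simp [const]
  · simp [const, h]

theorem const_zero : (const (0 : W) : Series r W) = 0 := Pi.single_zero _

theorem const_neg (w : W) : (const (-w) : Series r W) = -const w := Pi.single_neg _ _

theorem const_smul (c : ℝ) (w : W) : (const (c • w) : Series r W) = c • const w :=
  Pi.single_smul _ _ _

theorem const_sum {ι : Type*} (s : Finset ι) (w : ι → W) :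
    (const (∑ i ∈ s, w i) : Series r W) = ∑ i ∈ s, const (w i) :=
  map_sum (AddMonoidHom.single (fun _ : Fin r →₀ ℕ => W) 0) w s

theorem partialDeriv_const (k : Fin r) (w : W) : partialDeriv k (const w : Series r W) = 0 := by
  funext m
  change ((m k : ℝ) + 1) • (Pi.single 0 w : Series r W) (m + Finsupp.single k 1) = 0
  rw [Pi.single_eq_of_ne, smul_zero]
  intro h
  have := DFunLike.congr_fun h k
  simp at this

theorem partialDeriv_mulVar_const (k j : Fin r) (w : W) :
    partialDeriv k (mulVar j (const w) : Series r W) = if k = j then const w else 0 := by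
  refine mulVar_injective k ?_
  funext m
  rw [mulVar_partialDeriv_apply]
  split_ifs with h
  · subst h
    rw [mulVar_apply]
    split_ifs with h0
    · simp [h0]
    · by_cases h1 : m - Finsupp.single k 1 = 0
      · have hm : m k = 1 := by
          have := DFunLike.congr_fun h1 k
          simp at this
          omega
        rw [hm]; simp
      · simp [const, h1]
  · rw [map_zero, mulVar_apply]
    split_ifs with h0
    · simp
    · by_cases h1 : m - Finsupp.single j 1 = 0
      · have hm : m k = 0 := by
          have := DFunLike.congr_fun h1 k
          rw [Finsupp.tsub_apply, Finsupp.single_eq_of_ne h] at this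
          simpa using this
        rw [hm]; simp
      · simp [const, h1]

end

end Operators

section Forms

set_option linter.unusedSectionVars false

variable {r : ℕ} {A L : Type*} [CommRing A] [Algebra ℝ A] [LieRing L] [LieAlgebra ℝ L]
  [Module A L] [LieRingModule L A] [LieRinehartRing A L] [LieRinehartAlgebra ℝ A L]

noncomputable section

theorem wedge_apply (α β : Series r (Forms A L)) (m : Fin r →₀ ℕ) :
    wedge α β m = ∑ ij ∈ Finset.HasAntidiagonal.antidiagonal m, Forms.wedge (α ij.1) (β ij.2) := rfl

/-- A decomposition m = a + b contributes only if a_j ≠ 0, and such decompositions correspond to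
those of m - e_j by shifting a. The companion lemma shifts b instead. -/
theorem wedge_mulVar_left (j : Fin r) (α β : Series r (Forms A L)) :
    wedge (mulVar j α) β = mulVar j (wedge α β) := by
  funext m
  rw [mulVar_apply]
  split_ifs with h
  · refine Finset.sum_eq_zero fun ij hij => ?_
    have : ij.1 j = 0 := by
      have := DFunLike.congr_fun (Finset.HasAntidiagonal.mem_antidiagonal.1 hij) j
      rw [Finsupp.add_apply] at this
      omega
    rw [mulVar_apply, if_pos this, map_zero, LinearMap.zero_apply]
  · symm
    refine Finset.sum_of_injOn (fun ij => (ij.1 + Finsupp.single j 1, ij.2)) ?_ ?_ ?_ ?_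
    · rintro ⟨a, b⟩ _ ⟨a', b'⟩ _ hab
      simpa using hab
    · rintro ⟨a, b⟩ hab
      have hab' : a + b = m - Finsupp.single j 1 := by simpa using hab
      have hle : Finsupp.single j 1 ≤ m := by
        rw [Finsupp.single_le_iff]; omega
      simp only [Finset.mem_coe, Finset.HasAntidiagonal.mem_antidiagonal]
      rw [add_right_comm, hab', tsub_add_cancel_of_le hle]
    · rintro ⟨a, b⟩ hab hnot
      rw [mulVar_apply]
      split_ifs with h0
      · rw [map_zero, LinearMap.zero_apply]
      · exfalso
        apply hnot
        have hle : Finsupp.single j 1 ≤ a := by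
          rw [Finsupp.single_le_iff]; exact Nat.one_le_iff_ne_zero.2 h0
        have hab' : a + b = m := by simpa using hab
        refine ⟨(a - Finsupp.single j 1, b), ?_, ?_⟩
        · simp only [Finset.mem_coe, Finset.HasAntidiagonal.mem_antidiagonal]
          rw [← hab', tsub_add_eq_add_tsub hle]
        · simp [tsub_add_cancel_of_le hle]
    · rintro ⟨a, b⟩ _
      rw [mulVar_apply_add]

theorem wedge_mulVar_right (j : Fin r) (α β : Series r (Forms A L)) :
    wedge α (mulVar j β) = mulVar j (wedge α β) := by
  funext m
  rw [mulVar_apply]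
  split_ifs with h
  · refine Finset.sum_eq_zero fun ij hij => ?_
    have : ij.2 j = 0 := by
      have := DFunLike.congr_fun (Finset.HasAntidiagonal.mem_antidiagonal.1 hij) j
      rw [Finsupp.add_apply] at this
      omega
    rw [mulVar_apply, if_pos this, map_zero]
  · symm
    refine Finset.sum_of_injOn (fun ij => (ij.1, ij.2 + Finsupp.single j 1)) ?_ ?_ ?_ ?_
    · rintro ⟨a, b⟩ _ ⟨a', b'⟩ _ hab
      simpa using hab
    · rintro ⟨a, b⟩ hab
      have hab' : a + b = m - Finsupp.single j 1 := by simpa using hab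
      have hle : Finsupp.single j 1 ≤ m := by
        rw [Finsupp.single_le_iff]; omega
      simp only [Finset.mem_coe, Finset.HasAntidiagonal.mem_antidiagonal]
      rw [← add_assoc, hab', tsub_add_cancel_of_le hle]
    · rintro ⟨a, b⟩ hab hnot
      rw [mulVar_apply]
      split_ifs with h0
      · rw [map_zero]
      · exfalso
        apply hnot
        have hle : Finsupp.single j 1 ≤ b := by
          rw [Finsupp.single_le_iff]; exact Nat.one_le_iff_ne_zero.2 h0
        have hab' : a + b = m := by simpa using hab
        refine ⟨(a, b - Finsupp.single j 1), ?_, ?_⟩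
        · simp only [Finset.mem_coe, Finset.HasAntidiagonal.mem_antidiagonal]
          rw [← hab', add_tsub_assoc_of_le hle]
        · simp [tsub_add_cancel_of_le hle]
    · rintro ⟨a, b⟩ _
      rw [mulVar_apply_add]

theorem wedge_const (w : Forms A L) (β : Series r (Forms A L)) :
    wedge (const w) β = map (Forms.wedge w) β := by
  funext m
  rw [wedge_apply, Finset.sum_eq_single ((0 : Fin r →₀ ℕ), m)]
  · simp [const, map_apply]
  · rintro ⟨a, b⟩ hab hne
    have ha : a ≠ 0 := by
      rintro rfl
      apply hne
      simpa using hab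
    simp [const, ha]
  · intro h
    simp at h

/-- Taking S to be the identity or the grading involution covers derivations such as L_X and
antiderivations such as d and ι_X at once. -/
theorem map_wedge {T T₁ T₂ S : Forms A L →ₗ[ℝ] Forms A L}
    (h : ∀ a b, T (Forms.wedge a b) = Forms.wedge (T₁ a) b + Forms.wedge (S a) (T₂ b))
    (α β : Series r (Forms A L)) :
    map T (wedge α β) = wedge (map T₁ α) β + wedge (map S α) (map T₂ β) := by
  funext m
  rw [map_apply, wedge_apply, map_sum, Pi.add_apply, wedge_apply, wedge_apply,
    ← Finset.sum_add_distrib]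
  exact Finset.sum_congr rfl fun ij _ => h _ _

theorem map_wedge_of_linear {T : Forms A L →ₗ[ℝ] Forms A L}
    (h : ∀ a b, T (Forms.wedge a b) = Forms.wedge (T a) b) (α β : Series r (Forms A L)) :
    map T (wedge α β) = wedge (map T α) β := by
  funext m
  rw [map_apply, wedge_apply, map_sum, wedge_apply]
  exact Finset.sum_congr rfl fun ij _ => h _ _

theorem map_lieD_wedge (X : L) (α β : Series r (Forms A L)) :
    map (Forms.lieD X) (wedge α β) =
      wedge (map (Forms.lieD X) α) β + wedge α (map (Forms.lieD X) β) :=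
  map_wedge (S := LinearMap.id) (Forms.lieD_wedge X) α β

theorem diag_lieD_wedge (X : Fin r → L) (α β : Series r (Forms A L)) :
    diag (fun j => Forms.lieD (X j)) (wedge α β) =
      wedge (diag (fun j => Forms.lieD (X j)) α) β +
        wedge α (diag (fun j => Forms.lieD (X j)) β) := by
  simp only [diag_apply, map_sum, LinearMap.sum_apply, wedge_mulVar_left, wedge_mulVar_right,
    map_lieD_wedge, map_add, Finset.sum_add_distrib]

theorem cartanDiff_wedge (X : Fin r → L) (α β : Series r (Forms A L)) :
    cartanDiff X (wedge α β) =
      wedge (cartanDiff X α) β + wedge (map Forms.sgnHom α) (cartanDiff X β) := by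
  have h1 := map_wedge (r := r) (S := Forms.sgnHom) (Forms.d_wedge (A := A) (L := L)) α β
  have h2 : ∀ j, map (Forms.contract (X j)) (wedge α β) =
      wedge (map (Forms.contract (X j)) α) β +
        wedge (map Forms.sgnHom α) (map (Forms.contract (X j)) β) :=
    fun j => map_wedge (S := Forms.sgnHom) (Forms.contract_wedge (X j)) α β
  simp only [cartanDiff, LinearMap.sub_apply, diag_apply, h1, h2, map_sub, map_sum, map_add,
    LinearMap.sum_apply, wedge_mulVar_left, wedge_mulVar_right, Finset.sum_add_distrib]
  abel

/-- After multiplication by u_k the rule becomes m_k = a_k + b_k on each decomposition m = a + b. -/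
theorem partialDeriv_wedge (k : Fin r) (α β : Series r (Forms A L)) :
    partialDeriv k (wedge α β) = wedge (partialDeriv k α) β + wedge α (partialDeriv k β) := by
  refine mulVar_injective k ?_
  rw [map_add, ← wedge_mulVar_left, ← wedge_mulVar_right]
  funext m
  rw [mulVar_partialDeriv_apply, wedge_apply, Pi.add_apply, wedge_apply, wedge_apply,
    ← Finset.sum_add_distrib, Finset.smul_sum]
  refine Finset.sum_congr rfl fun ij hij => ?_
  rw [mulVar_partialDeriv_apply, mulVar_partialDeriv_apply, map_smul, map_smul,
    LinearMap.smul_apply, ← add_smul, ← Finset.HasAntidiagonal.mem_antidiagonal.1 hij, Finsupp.add_apply,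
    Nat.cast_add]

theorem coadjoint_wedge (c : Fin r → Fin r → Fin r → ℝ) (i : Fin r)
    (α β : Series r (Forms A L)) :
    coadjoint c i (wedge α β) = wedge (coadjoint c i α) β + wedge α (coadjoint c i β) := by
  simp only [coadjoint, LinearMap.sum_apply, LinearMap.smul_apply, LinearMap.comp_apply,
    partialDeriv_wedge, map_add, smul_add, Finset.sum_add_distrib, map_sum, map_smul,
    wedge_mulVar_left, wedge_mulVar_right]

theorem mem_parity {p : ZMod 2} {α : Series r (Forms A L)} :
    α ∈ parity p ↔ ∀ m, α m ∈ Forms.parity p := by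
  simp [parity, Submodule.mem_pi]

theorem wedge_mem_parity {p q : ZMod 2} {α β : Series r (Forms A L)} (hα : α ∈ parity p)
    (hβ : β ∈ parity q) : wedge α β ∈ parity (p + q) := by
  rw [mem_parity] at *
  exact fun m => Submodule.sum_mem _ fun ij _ => Forms.wedge_mem_parity (hα _) (hβ _)

theorem const_mem_parity {p : ZMod 2} {w : Forms A L} (h : w ∈ Forms.parity p) :
    (const w : Series r (Forms A L)) ∈ parity p := by
  rw [mem_parity]
  intro m
  by_cases hm : m = 0
  · subst hm; simpa [const] using h
  · simp [const, hm]

theorem mulVar_mem_parity {p : ZMod 2} {α : Series r (Forms A L)} (h : α ∈ parity p)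
    (j : Fin r) : mulVar j α ∈ parity p := by
  rw [mem_parity] at *
  intro m
  rw [mulVar_apply]
  split_ifs
  · exact zero_mem _
  · exact h _

theorem map_expWedge_mem_parity {p : ZMod 2} {α : Series r (Forms A L)} (h : α ∈ parity p)
    (B : Form A L 2) : map (Forms.expWedge B) α ∈ parity p := by
  rw [mem_parity] at *
  exact fun m => Forms.expWedge_mem_parity B (h m)

theorem wedge_mem_cartan {X : Fin r → L} {p q : ZMod 2} {α β : Series r (Forms A L)}
    (hα : α ∈ cartan X p) (hβ : β ∈ cartan X q) : wedge α β ∈ cartan X (p + q) := by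
  refine ⟨wedge_mem_parity hα.1 hβ.1, ?_⟩
  refine LinearMap.mem_ker.2 ?_
  rw [diag_lieD_wedge, LinearMap.mem_ker.1 hα.2, LinearMap.mem_ker.1 hβ.2,
    map_zero, map_zero, LinearMap.zero_apply, add_zero]

theorem mem_invariantCartan {X : Fin r → L} {c : Fin r → Fin r → Fin r → ℝ} {p : ZMod 2}
    {α : Series r (Forms A L)} : α ∈ invariantCartan X c p ↔
      α ∈ parity p ∧ ∀ i, map (Forms.lieD (X i)) α + coadjoint c i α = 0 := by
  simp [invariantCartan, Submodule.mem_iInf, LinearMap.mem_ker]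

theorem wedge_mem_invariantCartan {X : Fin r → L} {c : Fin r → Fin r → Fin r → ℝ} {p q : ZMod 2}
    {α β : Series r (Forms A L)} (hα : α ∈ invariantCartan X c p)
    (hβ : β ∈ invariantCartan X c q) : wedge α β ∈ invariantCartan X c (p + q) := by
  rw [mem_invariantCartan] at *
  refine ⟨wedge_mem_parity hα.1 hβ.1, fun i => ?_⟩
  have e : map (Forms.lieD (X i)) (wedge α β) + coadjoint c i (wedge α β) =
      wedge (map (Forms.lieD (X i)) α + coadjoint c i α) β +
        wedge α (map (Forms.lieD (X i)) β + coadjoint c i β) := by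
    rw [map_lieD_wedge, coadjoint_wedge, map_add, map_add, LinearMap.add_apply]
    abel
  rw [e, hα.2, hβ.2, map_zero, map_zero, LinearMap.zero_apply, add_zero]

end

end Forms

end Series

/-! ### Global smooth sections with prescribed values, and smoothness tests. -/

section SmoothSections

open Bundle

set_option linter.unusedSectionVars false

noncomputable section

variable {E : Type*} [NormedAddCommGroup E] [NormedSpace ℝ E] [FiniteDimensional ℝ E]
  {M : Type*} [TopologicalSpace M] [ChartedSpace E M] [IsManifold 𝓘(ℝ, E) ∞ M]
  [T2Space M] [SigmaCompactSpace M]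
  {F : Type*} [NormedAddCommGroup F] [NormedSpace ℝ F] [FiniteDimensional ℝ F]
  {V : M → Type*} [TopologicalSpace (TotalSpace F V)] [∀ x, AddCommGroup (V x)]
  [∀ x, Module ℝ (V x)] [∀ x, TopologicalSpace (V x)] [FiberBundle F V] [VectorBundle ℝ F V]
  [ContMDiffVectorBundle ∞ F V 𝓘(ℝ, E)]

theorem contMDiffVectorBundle_tangent :
    ContMDiffVectorBundle ∞ E (TangentSpace 𝓘(ℝ, E) : M → Type _) 𝓘(ℝ, E) := by
  have : IsManifold 𝓘(ℝ, E) (∞ + 1) M := by simpa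
  exact TangentBundle.contMDiffVectorBundle

/-- Near every point there are global smooth sections which form a frame, with smooth
coefficient functions. -/
theorem exists_frame (x₀ : M) : ∃ (U : Set M)
    (e : Fin (Module.finrank ℝ F) → SmoothSec E M F V)
    (c : Fin (Module.finrank ℝ F) → ∀ x, V x →ₗ[ℝ] ℝ), IsOpen U ∧ x₀ ∈ U ∧
      LinearIndependent ℝ (fun i => e i x₀) ∧
      (∀ x ∈ U, ∀ v : V x, ∑ i, c i x v • e i x = v) ∧
      ∀ i, ContMDiffOn (𝓘(ℝ, E).prod 𝓘(ℝ, F)) 𝓘(ℝ, ℝ) ∞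
        (fun q : TotalSpace F V => c i q.1 q.2) (TotalSpace.proj ⁻¹' U) := by
  let t := trivializationAt F V x₀
  let b := Module.finBasis ℝ F
  have hx₀ : x₀ ∈ t.baseSet := mem_baseSet_trivializationAt F V x₀
  -- The local frame is multiplied by a bump function supported in the trivializing set, which makes
  -- it global and leaves it unchanged on a smaller U.
  obtain ⟨χ, -, hχ⟩ := (SmoothBumpFunction.nhds_basis_tsupport (I := 𝓘(ℝ, E)) x₀).mem_iff.1
    (t.open_baseSet.mem_nhds hx₀)
  have h1 : ∀ᶠ x in nhds x₀, χ x = 1 ∧ x ∈ t.baseSet :=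
    χ.eventuallyEq_one.and (t.open_baseSet.mem_nhds hx₀)
  obtain ⟨U, hU, hUo, hUx⟩ := eventually_nhds_iff.1 h1
  let e : Fin (Module.finrank ℝ F) → SmoothSec E M F V := fun i =>
    ⟨fun x => χ x • t.localFrame b i x,
      ContMDiffOn.smul_section_of_tsupport (χ.contMDiff.contMDiffOn (s := t.baseSet))
        t.open_baseSet hχ (t.contMDiffOn_localFrame_baseSet ∞ b i)⟩
  -- The coefficients come from `linearMapAt`, which is zero outside the base set; they are used on
  -- U only.
  let c : Fin (Module.finrank ℝ F) → ∀ x, V x →ₗ[ℝ] ℝ :=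
    fun i x => b.coord i ∘ₗ t.linearMapAt ℝ x
  have he : ∀ i, ∀ x, (hx : x ∈ U) → e i x = t.basisAt b (hU x hx).2 i := fun i x hx => by
    change χ x • t.localFrame b i x = _
    rw [t.localFrame_apply_of_mem_baseSet b (hU x hx).2]
    exact (congrArg (· • (t.basisAt b (hU x hx).2 i)) (hU x hx).1).trans (one_smul ℝ _)
  refine ⟨U, e, c, hUo, hUx, ?_, ?_, ?_⟩
  · have : (fun i => e i x₀) = t.basisAt b (hU x₀ hUx).2 := funext fun i => he i x₀ hUx
    rw [this]
    exact (t.basisAt b (hU x₀ hUx).2).linearIndependent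
  · intro x hx v
    have hc : ∀ i, c i x v = (t.basisAt b (hU x hx).2).repr v i := by
      intro i
      simp [c, Trivialization.basisAt, (hU x hx).2]
    simp only [hc, he _ x hx]
    exact (t.basisAt b (hU x hx).2).sum_repr v
  · intro i
    have hs : TotalSpace.proj ⁻¹' U ⊆ t.source := fun q hq => by
      rw [t.mem_source]; exact (hU q.1 hq).2
    have h2 : ContMDiffOn (𝓘(ℝ, E).prod 𝓘(ℝ, F)) 𝓘(ℝ, ℝ) ∞
        (fun q : TotalSpace F V => b.coord i (t q).2) (TotalSpace.proj ⁻¹' U) := by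
      have h3 : ContMDiffOn (𝓘(ℝ, E).prod 𝓘(ℝ, F)) 𝓘(ℝ, F) ∞
          (fun q : TotalSpace F V => (t q).2) (TotalSpace.proj ⁻¹' U) :=
        contMDiff_snd.comp_contMDiffOn ((t.contMDiffOn (IB := 𝓘(ℝ, E)) (n := ∞)).mono hs)
      have h4 : ContMDiff 𝓘(ℝ, F) 𝓘(ℝ, ℝ) ∞ (LinearMap.toContinuousLinearMap (b.coord i)) :=
        (LinearMap.toContinuousLinearMap (b.coord i)).contMDiff
      exact h4.comp_contMDiffOn h3
    refine h2.congr fun q hq => ?_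
    simp [c, (hU q.1 hq).2]

/-- Every vector is the value of a global smooth section. -/
theorem exists_smoothSec_apply_eq (x₀ : M) (v : V x₀) : ∃ u : SmoothSec E M F V, u x₀ = v := by
  obtain ⟨U, e, c, -, hx, -, h, -⟩ := exists_frame (E := E) (F := F) (V := V) x₀
  refine ⟨∑ i, c i x₀ v • e i, ?_⟩
  have h0 : ∀ s : Finset (Fin (Module.finrank ℝ F)),
      (∑ i ∈ s, c i x₀ v • e i : SmoothSec E M F V) x₀ = ∑ i ∈ s, c i x₀ v • e i x₀ := by
    intro s
    have := congrFun (map_sum (ContMDiffSection.coeAddHom 𝓘(ℝ, E) F ∞ V)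
      (fun i => c i x₀ v • e i) s) x₀
    rw [Finset.sum_apply] at this
    exact this
  rw [h0]
  exact h x₀ hx v

theorem exists_smoothVF_apply_eq (x₀ : M) (v : TangentSpace 𝓘(ℝ, E) x₀) :
    ∃ X : SmoothVF E M, X x₀ = v := by
  have := contMDiffVectorBundle_tangent (E := E) (M := M)
  exact exists_smoothSec_apply_eq (V := (TangentSpace 𝓘(ℝ, E) : M → Type _)) x₀ v

/-- A vector field that annihilates all functions vanishes. -/
theorem SmoothVF.eq_zero_of_lie_eq_zero (X : SmoothVF E M)
    (h : ∀ f : SmoothFun E M, ⁅X, f⁆ = 0) : X = 0 := by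
  ext x
  by_contra hx
  obtain ⟨ℓ, hℓ⟩ : ∃ ℓ : E →ₗ[ℝ] ℝ, ℓ (X x) ≠ 0 := by
    by_contra hcon
    push Not at hcon
    exact hx ((Module.forall_dual_apply_eq_zero_iff ℝ (V := E) (X x)).1 hcon)
  let L := LinearMap.toContinuousLinearMap ℓ
  obtain ⟨χ, -, -⟩ := (SmoothBumpFunction.nhds_basis_tsupport (I := 𝓘(ℝ, E)) x).mem_iff.1
    Filter.univ_mem
  have hg : ContMDiffOn 𝓘(ℝ, E) 𝓘(ℝ, ℝ) ∞ (fun y => L (extChartAt 𝓘(ℝ, E) x y))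
      (chartAt E x).source :=
    (L.contMDiff (n := ∞)).comp_contMDiffOn contMDiffOn_extChartAt
  -- The test function is a linear functional in the chart at x, cut off. Its differential at x is
  -- the functional itself, because the chart has derivative the identity at its centre.
  let f : SmoothFun E M := ⟨fun y => χ y • L (extChartAt 𝓘(ℝ, E) x y), χ.contMDiff_smul hg⟩
  have hf := congrArg (fun k : SmoothFun E M => k x) (h f)
  have hf' : mvfderiv 𝓘(ℝ, E) f x (X x) = 0 := hf
  have he : (f : M → ℝ) =ᶠ[nhds x] fun y => L (extChartAt 𝓘(ℝ, E) x y) := by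
    filter_upwards [χ.eventuallyEq_one] with y hy
    change χ y • L (extChartAt 𝓘(ℝ, E) x y) = _
    rw [hy]; simp
  have hd : mvfderiv 𝓘(ℝ, E) f x (X x) = L (X x) := by
    have h1 : mfderiv 𝓘(ℝ, E) 𝓘(ℝ, ℝ) f x = L ∘L mfderiv 𝓘(ℝ, E) 𝓘(ℝ, E)
        (extChartAt 𝓘(ℝ, E) x) x := by
      rw [he.mfderiv_eq]
      have := mfderiv_comp (I := 𝓘(ℝ, E)) (I' := 𝓘(ℝ, E)) (I'' := 𝓘(ℝ, ℝ)) x (g := L)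
        (f := extChartAt 𝓘(ℝ, E) x) (L.mdifferentiableAt)
        (mdifferentiableAt_extChartAt (mem_chart_source E x))
      rw [ContinuousLinearMap.mfderiv_eq] at this
      exact this
    rw [mfderiv_extChartAt_self] at h1
    change mfderiv 𝓘(ℝ, E) 𝓘(ℝ, ℝ) f x (X x) = _
    rw [h1]
    rfl
  exact hℓ (hd.symm.trans hf')

/-- A family of bilinear forms that is smooth on global sections is smooth along maps to the total
spaces. -/
theorem contMDiffAt_bilin {F' : Type*} [NormedAddCommGroup F'] [NormedSpace ℝ F']
    [FiniteDimensional ℝ F']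
    {V' : M → Type*} [TopologicalSpace (TotalSpace F' V')] [∀ x, AddCommGroup (V' x)]
    [∀ x, Module ℝ (V' x)] [∀ x, TopologicalSpace (V' x)] [FiberBundle F' V']
    [VectorBundle ℝ F' V'] [ContMDiffVectorBundle ∞ F' V' 𝓘(ℝ, E)]
    (β : ∀ x, V x →ₗ[ℝ] V' x →ₗ[ℝ] ℝ)
    (hβ : ∀ (u : SmoothSec E M F V) (u' : SmoothSec E M F' V'),
      ContMDiff 𝓘(ℝ, E) 𝓘(ℝ, ℝ) ∞ fun x => β x (u x) (u' x))
    {EN : Type*} [NormedAddCommGroup EN] [NormedSpace ℝ EN] {HN : Type*} [TopologicalSpace HN]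
    {IN : ModelWithCorners ℝ EN HN} {N : Type*} [TopologicalSpace N] [ChartedSpace HN N]
    {p : N → M} {f : ∀ n, V (p n)} {g : ∀ n, V' (p n)} {n₀ : N}
    (hf : ContMDiffAt IN (𝓘(ℝ, E).prod 𝓘(ℝ, F)) ∞ (fun n => (⟨p n, f n⟩ : TotalSpace F V)) n₀)
    (hg : ContMDiffAt IN (𝓘(ℝ, E).prod 𝓘(ℝ, F')) ∞
      (fun n => (⟨p n, g n⟩ : TotalSpace F' V')) n₀) :
    ContMDiffAt IN 𝓘(ℝ, ℝ) ∞ (fun n => β (p n) (f n) (g n)) n₀ := by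
  obtain ⟨U, e, c, hUo, hU, -, hec, hc⟩ := exists_frame (E := E) (F := F) (V := V) (p n₀)
  obtain ⟨U', e', c', hUo', hU', -, hec', hc'⟩ := exists_frame (E := E) (F := F') (V := V') (p n₀)
  have hp : ContMDiffAt IN 𝓘(ℝ, E) ∞ p n₀ := (contMDiffAt_totalSpace.1 hf).1
  have hcf : ∀ i, ContMDiffAt IN 𝓘(ℝ, ℝ) ∞ (fun n => c i (p n) (f n)) n₀ := fun i =>
    ((hc i).contMDiffAt ((hUo.preimage (FiberBundle.continuous_proj F V)).mem_nhds hU)).comp n₀ hf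
  have hcg : ∀ i, ContMDiffAt IN 𝓘(ℝ, ℝ) ∞ (fun n => c' i (p n) (g n)) n₀ := fun i =>
    ((hc' i).contMDiffAt
      ((hUo'.preimage (FiberBundle.continuous_proj F' V')).mem_nhds hU')).comp n₀ hg
  -- Near n₀ the value is expanded in the two frames, leaving products of smooth coefficients with β
  -- evaluated on global sections.
  have hs : ContMDiffAt IN 𝓘(ℝ, ℝ) ∞ (fun n => ∑ i, ∑ j,
      c i (p n) (f n) * (c' j (p n) (g n) * β (p n) (e i (p n)) (e' j (p n)))) n₀ :=
    contMDiffAt_finsetSum fun i _ => contMDiffAt_finsetSum fun j _ =>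
      (hcf i).mul ((hcg j).mul ((hβ (e i) (e' j) (p n₀)).comp n₀ hp))
  refine hs.congr_of_eventuallyEq ?_
  filter_upwards [hp.continuousAt (hUo.mem_nhds hU), hp.continuousAt (hUo'.mem_nhds hU')]
    with n hn hn'
  conv_lhs => rw [← hec (p n) hn (f n), ← hec' (p n) hn' (g n)]
  simp only [map_sum, LinearMap.sum_apply, map_smul, LinearMap.smul_apply, smul_eq_mul]
  simp only [Finset.mul_sum]
  rw [Finset.sum_comm]
  exact Finset.sum_congr rfl fun i _ => Finset.sum_congr rfl fun j _ => by ring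

end

end SmoothSections

/-! ### Splittings of an exact Courant algebroid and their twisting forms. -/

section CourantCalculus

open Bundle

set_option linter.unusedSectionVars false

noncomputable section

variable {E : Type*} [NormedAddCommGroup E] [NormedSpace ℝ E] [FiniteDimensional ℝ E]
  {M : Type*} [TopologicalSpace M] [ChartedSpace E M] [IsManifold 𝓘(ℝ, E) ∞ M]
  [T2Space M] [SigmaCompactSpace M]
  {F : Type*} [NormedAddCommGroup F] [NormedSpace ℝ F] [FiniteDimensional ℝ F]
  {V : M → Type*} [TopologicalSpace (TotalSpace F V)] [∀ x, AddCommGroup (V x)]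
  [∀ x, Module ℝ (V x)] [∀ x, TopologicalSpace (V x)] [FiberBundle F V] [VectorBundle ℝ F V]
  [ContMDiffVectorBundle ∞ F V 𝓘(ℝ, E)]

namespace ExactCourantAlgebroid

variable (C : ExactCourantAlgebroid E F V)

theorem rho_sub (u v : SmoothSec E M F V) : C.rho (u - v) = C.rho u - C.rho v := by
  ext x; exact map_sub (C.anchor x) (u x) (v x)

theorem inner_add_left (u u' v : SmoothSec E M F V) :
    C.inner (u + u') v = C.inner u v + C.inner u' v := by
  ext x
  change C.pairing x (u x + u' x) (v x) = C.pairing x (u x) (v x) + C.pairing x (u' x) (v x)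
  rw [map_add, LinearMap.add_apply]

theorem inner_add_right (u v v' : SmoothSec E M F V) :
    C.inner u (v + v') = C.inner u v + C.inner u v' := by
  ext x; exact map_add (C.pairing x (u x)) (v x) (v' x)

/-- Twice the pairing of two sections. -/
def pair (u v : SmoothSec E M F V) : SmoothFun E M := (2 : ℝ) • C.inner u v

theorem pair_apply (u v : SmoothSec E M F V) (x : M) :
    C.pair u v x = 2 * C.pairing x (u x) (v x) := rfl

theorem pair_comm (u v : SmoothSec E M F V) : C.pair u v = C.pair v u := by
  ext x; rw [pair_apply, pair_apply, C.pairing_symm]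

theorem pair_add_left (u u' v : SmoothSec E M F V) :
    C.pair (u + u') v = C.pair u v + C.pair u' v := by
  rw [pair, inner_add_left, smul_add]; rfl

theorem pair_add_right (u v v' : SmoothSec E M F V) :
    C.pair u (v + v') = C.pair u v + C.pair u v' := by
  rw [pair, inner_add_right, smul_add]; rfl

theorem pair_neg_left (u v : SmoothSec E M F V) : C.pair (-u) v = -C.pair u v := by
  have h := C.pair_add_left (-u) u v
  rw [neg_add_cancel] at h
  have h0 : C.pair 0 v = 0 := by
    ext x
    rw [pair_apply]
    change 2 * C.pairing x 0 (v x) = 0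
    rw [map_zero, LinearMap.zero_apply, mul_zero]
  rw [h0] at h
  exact eq_neg_of_add_eq_zero_left h.symm

theorem pair_sub_left (u u' v : SmoothSec E M F V) :
    C.pair (u - u') v = C.pair u v - C.pair u' v := by
  rw [sub_eq_add_neg, pair_add_left, pair_neg_left, sub_eq_add_neg]

theorem lie_pair (u v w : SmoothSec E M F V) :
    ⁅C.rho u, C.pair v w⁆ = C.pair (C.bracket u v) w + C.pair v (C.bracket u w) := by
  rw [pair, lie_smul, C.lie_inner, smul_add]; rfl

theorem lie_pair_symm (u v w : SmoothSec E M F V) :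
    ⁅C.rho u, C.pair v w⁆ = C.pair u (C.bracket v w) + C.pair u (C.bracket w v) := by
  rw [pair, lie_smul, C.lie_inner_symm, inner_add_right, smul_add]; rfl

theorem eq_of_pairing_eq {x : M} {v v' : V x} (h : ∀ w, C.pairing x v w = C.pairing x v' w) :
    v = v' := by
  refine sub_eq_zero.1 (C.pairing_nondegenerate x _ fun w => ?_)
  rw [map_sub, LinearMap.sub_apply, h w, sub_self]

/-- A vector in the kernel of the anchor pairs with another one through the anchor of the latter. -/
theorem pairing_eq_of_anchor_eq {x : M} {k v w : V x} (hk : C.anchor x k = 0)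
    (h : C.anchor x v = C.anchor x w) : C.pairing x k v = C.pairing x k w := by
  obtain ⟨ξ, hξ⟩ := (C.anchor_eq_zero_iff x k).1 hk
  have h2 : 2 * C.pairing x k v = 2 * C.pairing x k w := by rw [hξ, hξ, h]
  linarith

theorem pair_eq_of_rho_eq {k v w : SmoothSec E M F V} (hk : C.rho k = 0)
    (h : C.rho v = C.rho w) : C.pair k v = C.pair k w := by
  ext x
  rw [pair_apply, pair_apply, C.pairing_eq_of_anchor_eq (DFunLike.congr_fun hk x)
    (DFunLike.congr_fun h x)]

/-- By the derivation rule and the Jacobi identity, the difference D of the two sides annihilates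
every function ⟨w, z⟩. Replacing w by f w gives D(f) ⟨w, z⟩ = 0, and w, z may be chosen with nonzero
pairing at a given point. -/
theorem rho_bracket (u v : SmoothSec E M F V) :
    C.rho (C.bracket u v) = ⁅C.rho u, C.rho v⁆ := by
  rw [← sub_eq_zero]
  set D := C.rho (C.bracket u v) - ⁅C.rho u, C.rho v⁆ with hD
  have h0 : ∀ w z : SmoothSec E M F V, ⁅D, C.inner w z⁆ = 0 := by
    intro w z
    have e1 : ∀ u w z : SmoothSec E M F V, ⁅C.rho u, C.inner w z⁆ =
      C.inner (C.bracket u w) z + C.inner w (C.bracket u z) := C.lie_inner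
    rw [hD, sub_lie, lie_lie]
    simp only [e1, lie_add, C.jacobi u v, inner_add_left, inner_add_right]
    abel
  refine SmoothVF.eq_zero_of_lie_eq_zero D fun f => ?_
  ext x
  by_cases hx : ∃ w z : V x, C.pairing x w z ≠ 0
  · obtain ⟨w', z', hwz⟩ := hx
    obtain ⟨w, rfl⟩ := exists_smoothSec_apply_eq (E := E) (F := F) x w'
    obtain ⟨z, rfl⟩ := exists_smoothSec_apply_eq (E := E) (F := F) x z'
    let fw : SmoothSec E M F V := ⟨fun x => f x • w x, f.contMDiff.smul_section w.contMDiff⟩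
    have e : C.inner fw z = f * C.inner w z := by
      ext y
      change C.pairing y (f y • w y) (z y) = f y * C.pairing y (w y) (z y)
      rw [map_smul, LinearMap.smul_apply, smul_eq_mul]
    have h1 := h0 fw z
    rw [e, LieRinehartRing.leibniz_mul_right, h0, smul_zero, zero_add] at h1
    have h2 : ⁅D, f⁆ x * C.pairing x (w x) (z x) = 0 :=
      congrArg (fun k : SmoothFun E M => k x) h1
    exact (mul_eq_zero.1 h2).resolve_right hwz
  -- Otherwise the pairing vanishes on V_x, so V_x = 0 by nondegeneracy, and surjectivity of the
  -- anchor forces D to vanish at x.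
  · push Not at hx
    have hV : ∀ w : V x, w = 0 := fun w => C.pairing_nondegenerate x w (hx w)
    obtain ⟨w, hw⟩ := C.anchor_surjective x (D x)
    have hDx : D x = 0 := by rw [← hw, hV w, map_zero]
    change mvfderiv 𝓘(ℝ, E) f x (D x) = 0
    rw [hDx, map_zero]

namespace IsotropicSplitting

variable {C} (s s' s'' : C.IsotropicSplitting)

theorem rho_sec (X : SmoothVF E M) : C.rho (s.sec X) = X := by
  ext x; exact s.anchor_toFun x (X x)

theorem pair_sec_sec (X Y : SmoothVF E M) : C.pair (s.sec X) (s.sec Y) = 0 := by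
  rw [pair, inner_sec_sec, smul_zero]

theorem covector_apply (u : SmoothSec E M F V) (v : Fin 1 → SmoothVF E M) :
    s.covector u v = C.pair u (s.sec (v 0)) := by
  change C.pair (u - s.sec (C.rho u)) (s.sec (v 0)) = _
  rw [pair_sub_left, pair_sec_sec, sub_zero]

/-- For u = s(X) + ξ and v = s(Y) + η this is 2⟨u, v⟩ = ξ(Y) + η(X), valid since both s(TM) and T*M
are isotropic. The computations with brackets below rest on it. -/
theorem pair_eq (u v : SmoothSec E M F V) :
    C.pair u v = C.pair u (s.sec (C.rho v)) + C.pair v (s.sec (C.rho u)) := by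
  have h1 : C.pair (u - s.sec (C.rho u)) v = C.pair (u - s.sec (C.rho u)) (s.sec (C.rho v)) :=
    C.pair_eq_of_rho_eq (by rw [rho_sub, rho_sec, sub_self]) (by rw [rho_sec])
  rw [pair_sub_left, pair_sub_left, pair_sec_sec, sub_zero, C.pair_comm (s.sec _) v] at h1
  linear_combination h1

theorem twistFun_cyclic (X Y Z : SmoothVF E M) : s.twistFun X Y Z = s.twistFun Y Z X := by
  rw [s.twistFun_swap X Y Z, s.twistFun_swap_right Z Y X, neg_neg, s.twistFun_swap Z X Y,
    s.twistFun_swap_right Y X Z, neg_neg]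

theorem pair_bracket_sec' (X Y Z : SmoothVF E M) :
    C.pair (C.bracket (s.sec Y) (s.sec Z)) (s.sec X) = s.twistFun X Y Z := C.pair_comm _ _

theorem lie_pair_sec (X : SmoothVF E M) (v w : SmoothSec E M F V) :
    ⁅X, C.pair v w⁆ = C.pair (C.bracket (s.sec X) v) w + C.pair v (C.bracket (s.sec X) w) := by
  rw [← C.lie_pair, rho_sec]

theorem lie_pair_sec_symm (X : SmoothVF E M) (v w : SmoothSec E M F V) :
    ⁅X, C.pair v w⁆ = C.pair (s.sec X) (C.bracket v w) + C.pair (s.sec X) (C.bracket w v) := by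
  rw [← C.lie_pair_symm, rho_sec]

theorem update_one {L : Type*} (a b : L) : Function.update ![a] 0 b = ![b] := by
  funext i; fin_cases i; rfl

theorem extDeriv_one_apply (ξ : Form (SmoothFun E M) (SmoothVF E M) 1) (X Y : SmoothVF E M) :
    ξ.extDeriv ![X, Y] = ⁅X, ξ ![Y]⁆ - ξ ![⁅X, Y⁆] - ⁅Y, ξ ![X]⁆ := by
  rw [Form.extDeriv_apply_succ, Form.lieDeriv_apply, Form.extDeriv_apply_zero, Fin.sum_univ_one]
  have ht : Fin.tail ![X, Y] = ![Y] := by funext i; fin_cases i; rfl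
  rw [ht, update_one]
  rfl

theorem extDeriv_two_apply (B : Form (SmoothFun E M) (SmoothVF E M) 2) (X Y Z : SmoothVF E M) :
    B.extDeriv ![X, Y, Z] = ⁅X, B ![Y, Z]⁆ - B ![⁅X, Y⁆, Z] - B ![Y, ⁅X, Z⁆] -
      (⁅Y, B ![X, Z]⁆ - B ![X, ⁅Y, Z⁆] - ⁅Z, B ![X, Y]⁆) := by
  rw [Form.extDeriv_apply_succ, Form.lieDeriv_apply, Fin.sum_univ_two]
  have ht : Fin.tail ![X, Y, Z] = ![Y, Z] := by funext i; fin_cases i <;> rfl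
  have h0 : Function.update ![Y, Z] 0 ⁅X, Y⁆ = ![⁅X, Y⁆, Z] := by funext i; fin_cases i <;> rfl
  have h1 : Function.update ![Y, Z] 1 ⁅X, Z⁆ = ![Y, ⁅X, Z⁆] := by funext i; fin_cases i <;> rfl
  rw [ht, extDeriv_one_apply]
  change ⁅X, B ![Y, Z]⁆ - (B (Function.update ![Y, Z] 0 ⁅X, Y⁆) +
    B (Function.update ![Y, Z] 1 ⁅X, Z⁆)) - _ = _
  rw [h0, h1, ← sub_sub]
  rfl

theorem extDeriv_three_apply (H : Form (SmoothFun E M) (SmoothVF E M) 3)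
    (X Y Z W : SmoothVF E M) :
    H.extDeriv ![X, Y, Z, W] = ⁅X, H ![Y, Z, W]⁆ - H ![⁅X, Y⁆, Z, W] - H ![Y, ⁅X, Z⁆, W] -
      H ![Y, Z, ⁅X, W⁆] - (⁅Y, H ![X, Z, W]⁆ - H ![X, ⁅Y, Z⁆, W] - H ![X, Z, ⁅Y, W⁆] -
      (⁅Z, H ![X, Y, W]⁆ - H ![X, Y, ⁅Z, W⁆] - ⁅W, H ![X, Y, Z]⁆)) := by
  rw [Form.extDeriv_apply_succ, Form.lieDeriv_apply, Fin.sum_univ_three]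
  have ht : Fin.tail ![X, Y, Z, W] = ![Y, Z, W] := by funext i; fin_cases i <;> rfl
  have h0 : Function.update ![Y, Z, W] 0 ⁅X, Y⁆ = ![⁅X, Y⁆, Z, W] := by
    funext i; fin_cases i <;> rfl
  have h1 : Function.update ![Y, Z, W] 1 ⁅X, Z⁆ = ![Y, ⁅X, Z⁆, W] := by
    funext i; fin_cases i <;> rfl
  have h2 : Function.update ![Y, Z, W] 2 ⁅X, W⁆ = ![Y, Z, ⁅X, W⁆] := by
    funext i; fin_cases i <;> rfl
  rw [ht, extDeriv_two_apply]
  change ⁅X, H ![Y, Z, W]⁆ - (H (Function.update ![Y, Z, W] 0 ⁅X, Y⁆) +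
    H (Function.update ![Y, Z, W] 1 ⁅X, Z⁆) + H (Function.update ![Y, Z, W] 2 ⁅X, W⁆)) - _ = _
  rw [h0, h1, h2, ← sub_sub, ← sub_sub]
  rfl

/-- The twisting form is closed. -/
theorem extDeriv_twistingForm : s.twistingForm.extDeriv = 0 := by
  refine AlternatingMap.ext fun v => ?_
  have hv : v = ![v 0, v 1, v 2, v 3] := by funext i; fin_cases i <;> rfl
  generalize v 0 = X, v 1 = Y, v 2 = Z, v 3 = W at hv
  subst hv
  have h : ∀ A B D : SmoothVF E M, s.twistingForm ![A, B, D] = s.twistFun A B D :=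
    fun _ _ _ => rfl
  have b : ∀ A B, C.rho (C.bracket (s.sec A) (s.sec B)) = ⁅A, B⁆ := fun A B => by
    rw [rho_bracket, rho_sec, rho_sec]
  -- The derivation rule moves s(A) off the inner bracket, and `pair_eq` evaluates the resulting
  -- pairing of two brackets.
  have T : ∀ A B D, C.pair (C.bracket (s.sec A) (C.bracket (s.sec B) (s.sec D))) (s.sec W) =
      ⁅A, s.twistFun W B D⁆ - s.twistFun ⁅A, W⁆ B D - s.twistFun ⁅B, D⁆ A W := by
    intro A B D
    have h1 := s.lie_pair_sec A (C.bracket (s.sec B) (s.sec D)) (s.sec W)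
    rw [s.pair_eq (C.bracket (s.sec B) (s.sec D)) (C.bracket (s.sec A) (s.sec W)), b, b] at h1
    simp only [pair_bracket_sec'] at h1
    linear_combination -h1
  have T1 := T X Y Z
  have T3 := T Y X Z
  -- In (s(X) * s(Y)) * s(Z) the inner bracket stands on the left. The rule for the symmetrized
  -- bracket exchanges it with s(Z), and T4 evaluates what results.
  have T2 := s.lie_pair_sec_symm W (C.bracket (s.sec X) (s.sec Y)) (s.sec Z)
  have T4 := s.lie_pair_sec Z (C.bracket (s.sec X) (s.sec Y)) (s.sec W)
  rw [s.pair_eq (C.bracket (s.sec X) (s.sec Y)) (C.bracket (s.sec Z) (s.sec W)), b, b] at T4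
  have J := congrArg (fun p => C.pair p (s.sec W)) (C.jacobi (s.sec X) (s.sec Y) (s.sec Z))
  simp only [pair_add_left] at J
  rw [C.pair_comm (s.sec W), C.pair_comm (s.sec W)] at T2
  simp only [pair_bracket_sec'] at T2 T4
  rw [AlternatingMap.zero_apply, extDeriv_three_apply]
  simp only [h]
  have c1 : s.twistFun Y Z W = s.twistFun W Y Z := (s.twistFun_cyclic W Y Z).symm
  have c2 : s.twistFun Y Z ⁅X, W⁆ = s.twistFun ⁅X, W⁆ Y Z := (s.twistFun_cyclic _ _ _).symm
  have c3 : s.twistFun X ⁅Y, Z⁆ W = -s.twistFun ⁅Y, Z⁆ X W := by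
    rw [s.twistFun_cyclic X, s.twistFun_swap_right]
  have c4 : s.twistFun X Z W = s.twistFun W X Z := (s.twistFun_cyclic W X Z).symm
  have c5 : s.twistFun X Z ⁅Y, W⁆ = s.twistFun ⁅Y, W⁆ X Z := (s.twistFun_cyclic _ _ _).symm
  have c6 : s.twistFun Y ⁅X, Z⁆ W = -s.twistFun ⁅X, Z⁆ Y W := by
    rw [s.twistFun_cyclic Y, s.twistFun_swap_right]
  have c7 : s.twistFun X Y Z = s.twistFun Z X Y := (s.twistFun_cyclic Z X Y).symm
  have c8 : s.twistFun X Y W = s.twistFun W X Y := (s.twistFun_cyclic W X Y).symm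
  have c9 : s.twistFun X Y ⁅Z, W⁆ = s.twistFun ⁅Z, W⁆ X Y := (s.twistFun_cyclic _ _ _).symm
  rw [c1, c2, c3, c4, c5, c6, c7, c8, c9]
  linear_combination J - T1 + T3 - T2 + T4

/-- The two-form `B` with `s' = s + B`. -/
def shiftForm : Form (SmoothFun E M) (SmoothVF E M) 2 :=
  -- Isotropy of s' makes the form alternating: by `pair_eq` for s, the pairing of s'(X) with itself
  -- is twice that of s'(X) with s(X).
  have hself : ∀ X, C.pair (s'.sec X) (s.sec X) = 0 := fun X => by
    have h := s.pair_eq (s'.sec X) (s'.sec X)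
    rw [rho_sec, pair_sec_sec] at h
    ext x
    have hx : (0 : ℝ) = C.pair (s'.sec X) (s.sec X) x + C.pair (s'.sec X) (s.sec X) x :=
      congrArg (fun f : SmoothFun E M => f x) h
    change C.pair (s'.sec X) (s.sec X) x = 0
    linarith
  { MultilinearMap.mk' (fun v : Fin 2 → SmoothVF E M => C.pair (s'.sec (v 0)) (s.sec (v 1)))
      (by
        intro v i X Y
        fin_cases i
        · simp [sec_add, pair_add_left]
        · simp [sec_add, pair_add_right])
      (by
        have hs : ∀ (s : C.IsotropicSplitting) (u : SmoothSec E M F V) (f : SmoothFun E M) X,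
            C.pair u (s.sec (f • X)) = f * C.pair u (s.sec X) := by
          intro s u f X
          ext x
          change 2 * C.pairing x (u x) (s.toFun x (f x • X x)) =
            f x * (2 * C.pairing x (u x) (s.toFun x (X x)))
          rw [map_smul, map_smul, smul_eq_mul, mul_left_comm]
        intro v i f X
        fin_cases i
        · simp [C.pair_comm (s'.sec _), hs]
        · simp [hs]) with
    map_eq_zero_of_eq' := by
      intro v i j hv hij
      change C.pair (s'.sec (v 0)) (s.sec (v 1)) = 0
      have h01 : v 0 = v 1 := by
        fin_cases i <;> fin_cases j <;> simp_all
      rw [h01, hself] }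

theorem shiftForm_apply (X Y : SmoothVF E M) :
    shiftForm s s' ![X, Y] = C.pair (s'.sec X) (s.sec Y) := rfl

/-- The difference s'(X) - s(X) lies in the kernel of the anchor, so u may be replaced by s(a(u)).
-/
theorem isShift_shiftForm : s.IsShift s' (shiftForm s s') := by
  intro X u
  change C.pair (s'.sec X - s.sec X) u = C.pair (s'.sec X) (s.sec (C.rho u))
  rw [C.pair_eq_of_rho_eq (v := u) (w := s.sec (C.rho u))
    (by rw [rho_sub, rho_sec, rho_sec, sub_self]) (by rw [rho_sec]), pair_sub_left, pair_sec_sec,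
    sub_zero]

variable {s s' s''} {B B' : Form (SmoothFun E M) (SmoothVF E M) 2}

theorem IsShift.pair_sub (h : s.IsShift s' B) (X : SmoothVF E M) (u : SmoothSec E M F V) :
    C.pair (s'.sec X - s.sec X) u = B ![X, C.rho u] := h X u

theorem IsShift.apply_eq (h : s.IsShift s' B) (X Y : SmoothVF E M) :
    C.pair (s'.sec X) (s.sec Y) = B ![X, Y] := by
  have := h.pair_sub X (s.sec Y)
  rwa [pair_sub_left, pair_sec_sec, sub_zero, rho_sec] at this

/-- Together with the preceding lemma: any two splittings differ by exactly one 2-form. This makes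
evaluation of spinors at a single splitting injective and `extend` consistent. -/
theorem IsShift.eq_shiftForm (h : s.IsShift s' B) : B = shiftForm s s' := by
  refine AlternatingMap.ext fun v => ?_
  have hv : v = ![v 0, v 1] := by funext i; fin_cases i <;> rfl
  rw [hv, shiftForm_apply, h.apply_eq]

theorem IsShift.trans (h : s.IsShift s' B) (h' : s'.IsShift s'' B') :
    s.IsShift s'' (B + B') := by
  intro X u
  change C.pair (s''.sec X - s.sec X) u = B ![X, C.rho u] + B' ![X, C.rho u]
  rw [← h.pair_sub, ← h'.pair_sub, ← pair_add_left, add_comm, sub_add_sub_cancel]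

theorem IsShift.refl (s : C.IsotropicSplitting) : s.IsShift s 0 := by
  intro X u
  change C.pair (s.sec X - s.sec X) u = 0
  rw [pair_sub_left, sub_self]

theorem IsShift.covector (h : s.IsShift s' B) (u : SmoothSec E M F V) :
    s'.covector u = s.covector u - B.curryLeft (C.rho u) := by
  refine AlternatingMap.ext fun v => ?_
  change _ = s.covector u v - B (Matrix.vecCons (C.rho u) v)
  have hv : Matrix.vecCons (C.rho u) v = ![C.rho u, v 0] := by
    funext i; fin_cases i <;> rfl
  have hB : B ![C.rho u, v 0] = -B ![v 0, C.rho u] := by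
    have h0 : (0 : Fin 2) ≠ 1 := by decide
    have := B.map_swap ![v 0, C.rho u] h0
    rw [← this]
    congr 1
    funext i; fin_cases i <;> rfl
  rw [covector_apply, covector_apply, hv, hB, ← h.pair_sub, pair_sub_left, C.pair_comm (s'.sec _),
    C.pair_comm (s.sec _)]
  ring

/-- In ⟨s'(X), s'(Y) * s'(Z)⟩ the splitting s' is exchanged for s one slot at a time, with the
bracket rules moving the slots. Each of the six identities contributes one of the six terms of dB.
-/
theorem IsShift.twistingForm (h : s.IsShift s' B) :
    s'.twistingForm = s.twistingForm + B.extDeriv := by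
  refine AlternatingMap.ext fun v => ?_
  have hv : v = ![v 0, v 1, v 2] := by funext i; fin_cases i <;> rfl
  generalize v 0 = X, v 1 = Y, v 2 = Z at hv
  subst hv
  have hB : ∀ A D, B ![A, D] = -B ![D, A] := by
    intro A D
    have h0 : (0 : Fin 2) ≠ 1 := by decide
    have := B.map_swap ![D, A] h0
    rw [← this]
    congr 1
    funext i; fin_cases i <;> rfl
  have e1 := h.pair_sub X (C.bracket (s'.sec Y) (s'.sec Z))
  rw [rho_bracket, rho_sec, rho_sec, pair_sub_left] at e1
  have e2 := s'.lie_pair_sec Y (s'.sec Z) (s.sec X)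
  have e3 := s'.lie_pair_sec_symm Z (s'.sec Y) (s.sec X)
  have e4 := s.pair_eq (s'.sec Z) (C.bracket (s.sec X) (s'.sec Y))
  have e5 := s.lie_pair_sec X (s'.sec Y) (s.sec Z)
  have e6 := s.pair_eq (s'.sec Y) (C.bracket (s.sec X) (s.sec Z))
  rw [rho_bracket] at e4 e6
  simp only [rho_sec] at e4 e6
  rw [C.pair_comm (C.bracket _ _) (s.sec X)] at e2
  rw [pair_bracket_sec'] at e6
  simp only [h.apply_eq] at e2 e3 e4 e5 e6
  rw [AlternatingMap.add_apply, extDeriv_two_apply]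
  change C.pair (s'.sec X) (C.bracket (s'.sec Y) (s'.sec Z)) = s.twistFun X Y Z + _
  have c1 : s.twistFun X Y Z = -s.twistFun Y X Z := by
    rw [s.twistFun_cyclic X, s.twistFun_swap_right]
  have c2 : ⁅Y, B ![X, Z]⁆ = -⁅Y, B ![Z, X]⁆ := by rw [hB X Z, lie_neg]
  have c3 : ⁅Z, B ![X, Y]⁆ = -⁅Z, B ![Y, X]⁆ := by rw [hB X Y, lie_neg]
  rw [c1, c2, c3, hB ⁅X, Y⁆ Z]
  linear_combination e1 - e2 + e3 + e4 - e5 - e6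

end IsotropicSplitting

end ExactCourantAlgebroid

end

end CourantCalculus

/-! ### The equivariant twist at an invariant splitting, and the isomorphism. -/

section EquivariantTwist

open Bundle

set_option linter.unusedSectionVars false

noncomputable section

/-- Antisymmetric coefficients are summed against the symmetric u_i u_j. Isotropy enters both the
Cartan condition and the closedness of H_G through this lemma. -/
theorem Series.sum_mulVar_mulVar_const_eq_zero {r : ℕ} {W : Type*} [AddCommGroup W] [Module ℝ W]
    (a : Fin r → Fin r → W) (h : ∀ i j, a i j = -a j i) :
    ∑ i, ∑ j, Series.mulVar i (Series.mulVar j (Series.const (a i j))) = 0 := by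
  have h1 : ∑ i, ∑ j, Series.mulVar i (Series.mulVar j (Series.const (a i j))) =
      -∑ i, ∑ j, Series.mulVar i (Series.mulVar j (Series.const (a i j))) := by
    conv_lhs => rw [Finset.sum_comm]
    simp only [← Finset.sum_neg_distrib]
    refine Finset.sum_congr rfl fun i _ => Finset.sum_congr rfl fun j _ => ?_
    rw [h j i, Series.const_neg, map_neg, map_neg, Series.mulVar_comm]
  have h2 := eq_neg_iff_add_eq_zero.1 h1
  rw [← two_smul ℝ] at h2
  exact (smul_eq_zero.1 h2).resolve_left two_ne_zero

variable {E : Type*} [NormedAddCommGroup E] [NormedSpace ℝ E] [FiniteDimensional ℝ E]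
  {M : Type*} [TopologicalSpace M] [ChartedSpace E M] [IsManifold 𝓘(ℝ, E) ∞ M]
  [T2Space M] [SigmaCompactSpace M]
  {F : Type*} [NormedAddCommGroup F] [NormedSpace ℝ F] [FiniteDimensional ℝ F]
  {V : M → Type*} [TopologicalSpace (TotalSpace F V)] [∀ x, AddCommGroup (V x)]
  [∀ x, Module ℝ (V x)] [∀ x, TopologicalSpace (V x)] [FiberBundle F V] [VectorBundle ℝ F V]
  [ContMDiffVectorBundle ∞ F V 𝓘(ℝ, E)]

namespace ExactCourantAlgebroid

variable {C : ExactCourantAlgebroid E F V}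

namespace IsotropicSplitting

variable {s s' : C.IsotropicSplitting} {B : Form (SmoothFun E M) (SmoothVF E M) 2}

/-- Here dB in the new twisting form cancels the commutator of d with e^B ∧. In the next two lemmas
the changes of ξ and of dξ - ι_X H do the same, so all three operators act on spinors. -/
theorem IsShift.d_expWedge (h : s.IsShift s' B) (ρ : Forms (SmoothFun E M) (SmoothVF E M)) :
    s'.d (Forms.expWedge B ρ) = Forms.expWedge B (s.d ρ) := by
  simp only [d, LinearMap.sub_apply, h.twistingForm, Forms.ofForm_add, map_add,
    LinearMap.add_apply, Forms.d_expWedge, Forms.wedge_expWedge, map_sub]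
  abel

theorem IsShift.contract_expWedge (h : s.IsShift s' B) (u : SmoothSec E M F V)
    (ρ : Forms (SmoothFun E M) (SmoothVF E M)) :
    s'.contract u (Forms.expWedge B ρ) = Forms.expWedge B (s.contract u ρ) := by
  simp only [contract, h.covector, Forms.ofForm_sub, map_add, LinearMap.sub_apply, map_sub,
    LinearMap.add_apply, Forms.contract_expWedge, Forms.wedge_expWedge]
  abel

theorem IsShift.lieD_expWedge (h : s.IsShift s' B) (u : SmoothSec E M F V)
    (ρ : Forms (SmoothFun E M) (SmoothVF E M)) :
    s'.lieD u (Forms.expWedge B ρ) = Forms.expWedge B (s.lieD u ρ) := by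
  -- The change is -d ι_X B - ι_X dB, which is -L_X B by Cartan's formula.
  have e : Forms.ofForm ((s'.covector u).extDeriv - s'.twistingForm.curryLeft (C.rho u)) =
      Forms.ofForm ((s.covector u).extDeriv - s.twistingForm.curryLeft (C.rho u)) -
        Forms.ofForm (Form.lieDeriv (C.rho u) B) := by
    rw [← Forms.lieD_ofForm, Forms.ofForm_sub, Forms.ofForm_sub, ← Forms.d_ofForm,
      ← Forms.d_ofForm, ← Forms.contract_ofForm, ← Forms.contract_ofForm, h.covector,
      h.twistingForm, Forms.ofForm_sub, Forms.ofForm_add, map_sub, map_add, ← Forms.d_ofForm,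
      Forms.contract_d, Forms.contract_ofForm _ B]
    abel
  simp only [lieD, LinearMap.add_apply, e, map_sub, LinearMap.sub_apply, map_add,
    Forms.lieD_expWedge, Forms.wedge_expWedge]
  abel

variable {u v : SmoothSec E M F V}

/-- An infinitesimal symmetry `u` of the splitting satisfies `dξ = ι_X H`. -/
theorem extDeriv_covector (hu : ∀ Y, C.bracket u (s.sec Y) = s.sec ⁅C.rho u, Y⁆) :
    (s.covector u).extDeriv = s.twistingForm.curryLeft (C.rho u) := by
  refine AlternatingMap.ext fun v => ?_
  have hv : v = ![v 0, v 1] := by funext i; fin_cases i <;> rfl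
  generalize v 0 = Y, v 1 = Z at hv
  subst hv
  rw [extDeriv_one_apply]
  change _ = s.twistFun (C.rho u) Y Z
  have c : ∀ Y, s.covector u ![Y] = C.pair u (s.sec Y) := fun Y => covector_apply s u _
  rw [c, c, c]
  have e1 := s.lie_pair_sec Y u (s.sec Z)
  have e2 := s.lie_pair_sec_symm Z u (s.sec Y)
  -- Invariance enters here: u * s(Y) lies in the isotropic image of s, so it pairs to zero with
  -- s(Z).
  rw [hu, pair_sec_sec] at e2
  have e3 := s.pair_eq u (C.bracket (s.sec Y) (s.sec Z))
  rw [rho_bracket, rho_sec, rho_sec, pair_bracket_sec'] at e3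
  rw [C.pair_comm (C.bracket _ _)] at e1
  linear_combination e1 - e2 + e3

/-- The correction term dξ - ι_X H vanishes, so at an invariant splitting the conditions on spinors
turn into those of the ordinary Cartan complexes. -/
theorem lieD_eq_of_invariant (hu : ∀ Y, C.bracket u (s.sec Y) = s.sec ⁅C.rho u, Y⁆) :
    s.lieD u = Forms.lieD (C.rho u) := by
  rw [lieD, extDeriv_covector hu, sub_self, Forms.ofForm_zero, map_zero, add_zero]

/-- Bracketing with u is a derivation of the pairing and respects s by `hu`, hence it respects the
covector part taken with respect to s. -/
theorem lieDeriv_covector (hu : ∀ Y, C.bracket u (s.sec Y) = s.sec ⁅C.rho u, Y⁆) :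
    Form.lieDeriv (C.rho u) (s.covector v) = s.covector (C.bracket u v) := by
  refine AlternatingMap.ext fun w => ?_
  rw [Form.lieDeriv_apply, Fin.sum_univ_one, covector_apply, covector_apply, covector_apply,
    C.lie_pair, hu, Function.update_self]
  ring

/-- L_X H = ι_X dH + d ι_X H, where dH = 0 and ι_X H = dξ. -/
theorem lieD_twistingForm (hu : ∀ Y, C.bracket u (s.sec Y) = s.sec ⁅C.rho u, Y⁆) :
    Forms.lieD (C.rho u) (Forms.ofForm s.twistingForm) = 0 := by
  have h := Forms.contract_d (C.rho u) (Forms.ofForm s.twistingForm)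
  rw [Forms.d_ofForm, extDeriv_twistingForm, Forms.ofForm_zero, map_zero, Forms.contract_ofForm,
    ← extDeriv_covector hu, ← Forms.d_ofForm, Forms.d_d, sub_zero] at h
  exact h.symm

/-- The symmetric part of the bracket is governed by the derivative of ⟨u, v⟩, which is zero here.
-/
theorem covector_bracket_add (h : C.pair u v = 0) :
    s.covector (C.bracket u v) = -s.covector (C.bracket v u) := by
  refine AlternatingMap.ext fun w => ?_
  rw [AlternatingMap.neg_apply, covector_apply, covector_apply]
  have e := s.lie_pair_sec_symm (w 0) u v
  rw [h, lie_zero, C.pair_comm (s.sec _), C.pair_comm (s.sec _)] at e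
  linear_combination -e

/-- By `pair_eq` the isotropy condition reads ξ_u(X_v) + ξ_v(X_u) = 0. -/
theorem contract_covector (h : C.pair u v = 0) :
    Forms.contract (C.rho u) (Forms.ofForm (s.covector v)) =
      -Forms.contract (C.rho v) (Forms.ofForm (s.covector u)) := by
  rw [Forms.contract_ofForm, Forms.contract_ofForm, eq_neg_iff_add_eq_zero, ← Forms.ofForm_add,
    ← Forms.ofForm_zero]
  congr 1
  refine AlternatingMap.ext fun w => ?_
  change s.covector v (Matrix.vecCons (C.rho u) w) + s.covector u (Matrix.vecCons (C.rho v) w) = 0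
  rw [covector_apply, covector_apply]
  have e := s.pair_eq u v
  rw [h] at e
  change C.pair v (s.sec (C.rho u)) + C.pair u (s.sec (C.rho v)) = 0
  linear_combination -e

/-- The covector part, as a linear map on sections. -/
def covectorₗ (s : C.IsotropicSplitting) :
    SmoothSec E M F V →ₗ[ℝ] Form (SmoothFun E M) (SmoothVF E M) 1 where
  toFun := s.covector
  map_add' u v := by
    refine AlternatingMap.ext fun w => ?_
    rw [AlternatingMap.add_apply, covector_apply, covector_apply, covector_apply, pair_add_left]
  map_smul' c u := by
    refine AlternatingMap.ext fun w => ?_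
    rw [AlternatingMap.smul_apply, covector_apply, covector_apply]
    ext x
    change 2 * C.pairing x (c • u x) _ = c * (2 * C.pairing x (u x) _)
    rw [map_smul, LinearMap.smul_apply, smul_eq_mul, mul_left_comm]

variable {r : ℕ} (s) (w : Fin r → SmoothSec E M F V)

/-- The equivariant extension `H + ∑ j, u_j ξ_j` of the twisting form. -/
def equivTwist : Series r (Forms (SmoothFun E M) (SmoothVF E M)) :=
  Series.const (Forms.ofForm s.twistingForm) +
    ∑ j, Series.mulVar j (Series.const (Forms.ofForm (s.covector (w j))))

theorem isHomogeneous_equivTwist : (s.equivTwist w).IsHomogeneous 3 := by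
  intro m k hmk
  rw [equivTwist, Pi.add_apply, Finset.sum_apply, Pi.add_apply, Finset.sum_apply]
  have h1 : (Series.const (Forms.ofForm s.twistingForm) :
      Series r (Forms (SmoothFun E M) (SmoothVF E M))) m k = 0 := by
    by_cases hm : m = 0
    · subst hm
      have hk : k ≠ 3 := by rintro rfl; simp at hmk
      have h0 : Forms.ofForm s.twistingForm k = 0 := Pi.single_eq_of_ne hk _
      simpa only [Series.const, Pi.single_eq_same] using h0
    · simp [Series.const, hm]
  rw [h1, zero_add]
  refine Finset.sum_eq_zero fun j _ => ?_
  rw [Series.mulVar_apply]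
  split_ifs with hj
  · rfl
  by_cases hm : m - Finsupp.single j 1 = 0
  · have hle : Finsupp.single j 1 ≤ m := by rw [Finsupp.single_le_iff]; omega
    have hm' : m = Finsupp.single j 1 := le_antisymm (tsub_eq_zero_iff_le.1 hm) hle
    have hk : k ≠ 1 := by
      rintro rfl
      rw [hm'] at hmk
      simp at hmk
    rw [hm]
    have h0 : Forms.ofForm (s.covector (w j)) k = 0 := Pi.single_eq_of_ne hk _
    simpa only [Series.const, Pi.single_eq_same] using h0
  · simp [Series.const, hm]

theorem equivTwist_mem_parity : s.equivTwist w ∈ Series.parity (r := r) 1 := by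
  refine add_mem (Series.const_mem_parity ?_)
    (Submodule.sum_mem _ fun j _ => Series.mulVar_mem_parity (Series.const_mem_parity ?_) j)
  · exact Forms.ofForm_mem_parity s.twistingForm
  · simpa using Forms.ofForm_mem_parity (s.covector (w j))

theorem map_equivTwist (T : Forms (SmoothFun E M) (SmoothVF E M) →ₗ[ℝ]
    Forms (SmoothFun E M) (SmoothVF E M)) : Series.map T (s.equivTwist w) =
      Series.const (T (Forms.ofForm s.twistingForm)) +
        ∑ j, Series.mulVar j (Series.const (T (Forms.ofForm (s.covector (w j))))) := by
  simp only [equivTwist, map_add, map_sum, Series.map_mulVar, Series.map_const]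

theorem wedge_equivTwist (ρ : Series r (Forms (SmoothFun E M) (SmoothVF E M))) :
    Series.wedge (s.equivTwist w) ρ = Series.map (Forms.wedge (Forms.ofForm s.twistingForm)) ρ +
      ∑ j, Series.mulVar j (Series.map (Forms.wedge (Forms.ofForm (s.covector (w j)))) ρ) := by
  simp only [equivTwist, map_add, map_sum, LinearMap.add_apply, LinearMap.sum_apply,
    Series.wedge_mulVar_left, Series.wedge_const]

theorem wedge_equivTwist_assoc (ρ α : Series r (Forms (SmoothFun E M) (SmoothVF E M))) :
    Series.wedge (s.equivTwist w) (Series.wedge ρ α) =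
      Series.wedge (Series.wedge (s.equivTwist w) ρ) α := by
  have h : ∀ a : Forms (SmoothFun E M) (SmoothVF E M),
      Series.map (Forms.wedge a) (Series.wedge ρ α) =
        Series.wedge (Series.map (Forms.wedge a) ρ) α := fun a =>
    Series.map_wedge_of_linear (fun b c => (Forms.wedge_assoc a b c).symm) ρ α
  simp only [wedge_equivTwist, h, map_add, map_sum, LinearMap.add_apply, LinearMap.sum_apply,
    Series.wedge_mulVar_left]

/-- This dictates the form of H_G: the parts ξ_j ∧ of the Clifford contractions, weighted by u_j,
are absorbed into the twist. -/
theorem equivDiff_eq_twistedDiff (ρ : Series r (Forms (SmoothFun E M) (SmoothVF E M))) :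
    (Series.map s.d - Series.diag fun j => s.contract (w j) : Series r (Forms (SmoothFun E M)
      (SmoothVF E M)) →ₗ[ℝ] Series r (Forms (SmoothFun E M) (SmoothVF E M))) ρ =
      Series.twistedDiff (fun j => C.rho (w j)) (s.equivTwist w) ρ := by
  have h1 : Series.map s.d ρ = Series.map Forms.d ρ -
    Series.map (Forms.wedge (Forms.ofForm s.twistingForm)) ρ := rfl
  have h2 : ∀ j, Series.map (s.contract (w j)) ρ = Series.map (Forms.contract (C.rho (w j))) ρ +
    Series.map (Forms.wedge (Forms.ofForm (s.covector (w j)))) ρ := fun _ => rfl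
  simp only [Series.twistedDiff, Series.cartanDiff, LinearMap.sub_apply, wedge_equivTwist,
    Series.diag_apply, h1, h2, map_add, Finset.sum_add_distrib]
  abel

/-- With α on the right, the Leibniz sign falls on the term containing d_G α, which vanishes, and
multiplication by H_G from the left is associative with it. -/
theorem twistedDiff_wedge {α : Series r (Forms (SmoothFun E M) (SmoothVF E M))}
    (hα : Series.cartanDiff (fun j => C.rho (w j)) α = 0)
    (ρ : Series r (Forms (SmoothFun E M) (SmoothVF E M))) :
    Series.twistedDiff (fun j => C.rho (w j)) (s.equivTwist w) (Series.wedge ρ α) =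
      Series.wedge (Series.twistedDiff (fun j => C.rho (w j)) (s.equivTwist w) ρ) α := by
  simp only [Series.twistedDiff, LinearMap.sub_apply, Series.cartanDiff_wedge, hα, map_zero,
    add_zero, wedge_equivTwist_assoc, map_sub]

theorem map_lieD_equivTwist
    (hw : ∀ j Y, C.bracket (w j) (s.sec Y) = s.sec ⁅C.rho (w j), Y⁆) (i : Fin r) :
    Series.map (Forms.lieD (C.rho (w i))) (s.equivTwist w) = ∑ j, Series.mulVar j
      (Series.const (Forms.ofForm (s.covector (C.bracket (w i) (w j))))) := by
  rw [map_equivTwist, lieD_twistingForm (hw i), Series.const_zero, zero_add]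
  simp only [Forms.lieD_ofForm, lieDeriv_covector (hw i)]

/-- Only Σ u_i u_j L_{X_i} ξ_j is left, and L_{X_i} ξ_j, the covector part of the bracket of
sections i and j, is antisymmetric by isotropy. -/
theorem equivTwist_mem_cartan
    (hw : ∀ j Y, C.bracket (w j) (s.sec Y) = s.sec ⁅C.rho (w j), Y⁆)
    (hiso : ∀ i j, C.pair (w i) (w j) = 0) :
    s.equivTwist w ∈ Series.cartan (fun j => C.rho (w j)) 1 := by
  refine ⟨s.equivTwist_mem_parity w, LinearMap.mem_ker.2 ?_⟩
  simp only [Series.diag_apply, s.map_lieD_equivTwist w hw, map_sum]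
  refine Series.sum_mulVar_mulVar_const_eq_zero
    (fun i j => Forms.ofForm (s.covector (C.bracket (w i) (w j)))) fun i j => ?_
  rw [covector_bracket_add (hiso i j), ← zero_sub, Forms.ofForm_sub, Forms.ofForm_zero, zero_sub]

/-- By order in u: dH = 0; then dξ_j cancels ι_{X_j} H by invariance of s; then the quadratic term
vanishes by isotropy. -/
theorem cartanDiff_equivTwist
    (hw : ∀ j Y, C.bracket (w j) (s.sec Y) = s.sec ⁅C.rho (w j), Y⁆)
    (hiso : ∀ i j, C.pair (w i) (w j) = 0) :
    Series.cartanDiff (fun j => C.rho (w j)) (s.equivTwist w) = 0 := by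
  have h0 := Series.sum_mulVar_mulVar_const_eq_zero
    (fun i j => Forms.contract (C.rho (w i)) (Forms.ofForm (s.covector (w j))))
    fun i j => contract_covector (hiso i j)
  simp only [Series.cartanDiff, LinearMap.sub_apply, Series.diag_apply, map_equivTwist, map_add,
    map_sum, Finset.sum_add_distrib, h0, Forms.d_ofForm, extDeriv_twistingForm,
    Forms.ofForm_zero, Series.const_zero, extDeriv_covector (hw _), Forms.contract_ofForm _ s.twistingForm]
  abel

/-- Since ∂H_G/∂u_k = ξ_k, the coadjoint term is Σ c^k_{il} u_l ξ_k. By `hc` the Lie derivative of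
the linear part is exactly its negative, and L_{X_i} H = 0. -/
theorem equivTwist_mem_invariantCartan
    (hw : ∀ j Y, C.bracket (w j) (s.sec Y) = s.sec ⁅C.rho (w j), Y⁆)
    {c : Fin r → Fin r → Fin r → ℝ}
    (hc : ∀ i l, C.bracket (w i) (w l) = -∑ k, c i l k • w k) :
    s.equivTwist w ∈ Series.invariantCartan (fun j => C.rho (w j)) c 1 := by
  refine Series.mem_invariantCartan.2 ⟨s.equivTwist_mem_parity w, fun i => ?_⟩
  have h1 : ∀ k, Series.partialDeriv k (s.equivTwist w) =
      Series.const (Forms.ofForm (s.covector (w k))) := by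
    intro k
    simp [equivTwist, Series.partialDeriv_const, Series.partialDeriv_mulVar_const]
  have h2 : ∀ l, Forms.ofForm (s.covector (C.bracket (w i) (w l))) =
      -∑ k, c i l k • Forms.ofForm (s.covector (w k)) := by
    intro l
    have := map_neg s.covectorₗ (∑ k, c i l k • w k)
    rw [← hc, map_sum] at this
    simp only [map_smul] at this
    change s.covector _ = -∑ k, c i l k • s.covector (w k) at this
    rw [this]
    have h3 : ∀ η : Form (SmoothFun E M) (SmoothVF E M) 1, Forms.ofForm η =
      LinearMap.single ℝ (fun n => Form (SmoothFun E M) (SmoothVF E M) n) 1 η := fun _ => rfl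
    simp only [h3, map_neg, map_sum, map_smul]
  simp only [s.map_lieD_equivTwist w hw, h2, Series.coadjoint, LinearMap.sum_apply,
    LinearMap.smul_apply, LinearMap.comp_apply, h1, Series.const_neg, map_neg, Series.const_sum,
    Series.const_smul, map_sum, map_smul, Finset.sum_neg_distrib]
  exact neg_add_cancel _

/-- The spinor with a given value at the splitting `s`. -/
def extend : Series r (Forms (SmoothFun E M) (SmoothVF E M)) →ₗ[ℝ] C.SpinorFamily r :=
  LinearMap.pi fun s' => Series.map (Forms.expWedge (shiftForm s s'))

theorem extend_apply (ρ : Series r (Forms (SmoothFun E M) (SmoothVF E M)))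
    (s' : C.IsotropicSplitting) :
    s.extend ρ s' = Series.map (Forms.expWedge (shiftForm s s')) ρ := rfl

theorem extend_apply_self (ρ : Series r (Forms (SmoothFun E M) (SmoothVF E M))) :
    s.extend ρ s = ρ := by
  rw [extend_apply, ← (IsShift.refl s).eq_shiftForm]
  exact funext fun m => Forms.expWedge_zero (ρ m)

/-- The 2-forms of successive shifts add, and their exponentials compose accordingly. -/
theorem extend_mem_spinors (ρ : Series r (Forms (SmoothFun E M) (SmoothVF E M))) :
    s.extend ρ ∈ C.spinors r := by
  intro s₁ s₂ B h
  rw [extend_apply, extend_apply, ← ((isShift_shiftForm s s₁).trans h).eq_shiftForm, add_comm]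
  exact funext fun m => Forms.expWedge_add _ _ (ρ m)

theorem extend_of_mem_spinors {φ : C.SpinorFamily r} (h : φ ∈ C.spinors r) :
    s.extend (φ s) = φ :=
  funext fun s' => (h s s' _ (isShift_shiftForm s s')).symm

theorem extend_mem_parity {p : ZMod 2} {ρ : Series r (Forms (SmoothFun E M) (SmoothVF E M))}
    (h : ρ ∈ Series.parity p) : s.extend ρ ∈ C.parity r p :=
  fun s' _ => Series.map_expWedge_mem_parity h (shiftForm s s')

/-- An operator on spinors is determined by its action at s as soon as it commutes with the shifts
that start at s. -/
theorem map_extend {T : C.IsotropicSplitting → Forms (SmoothFun E M) (SmoothVF E M) →ₗ[ℝ]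
    Forms (SmoothFun E M) (SmoothVF E M)}
    (hT : ∀ (s' : C.IsotropicSplitting) B, s.IsShift s' B → ∀ ρ,
      T s' (Forms.expWedge B ρ) = Forms.expWedge B (T s ρ))
    (ρ : Series r (Forms (SmoothFun E M) (SmoothVF E M))) (s' : C.IsotropicSplitting) :
    Series.map (T s') (s.extend ρ s') = s.extend (Series.map (T s) ρ) s' :=
  funext fun m => hT s' _ (isShift_shiftForm s s') (ρ m)

theorem diag_extend {T : Fin r → C.IsotropicSplitting → Forms (SmoothFun E M) (SmoothVF E M) →ₗ[ℝ]
    Forms (SmoothFun E M) (SmoothVF E M)}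
    (hT : ∀ j (s' : C.IsotropicSplitting) B, s.IsShift s' B → ∀ ρ,
      T j s' (Forms.expWedge B ρ) = Forms.expWedge B (T j s ρ))
    (ρ : Series r (Forms (SmoothFun E M) (SmoothVF E M))) (s' : C.IsotropicSplitting) :
    Series.diag (fun j => T j s') (s.extend ρ s') =
      s.extend (Series.diag (fun j => T j s) ρ) s' := by
  simp only [Series.diag_apply, s.map_extend (hT _)]
  simp only [extend_apply, map_sum, Series.map_mulVar]

theorem equivDiff_extend (ρ : Series r (Forms (SmoothFun E M) (SmoothVF E M))) :
    C.equivDiff w (s.extend ρ) =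
      s.extend (Series.twistedDiff (fun j => C.rho (w j)) (s.equivTwist w) ρ) := by
  funext s'
  rw [← equivDiff_eq_twistedDiff]
  change Series.map s'.d (s.extend ρ s') -
    Series.diag (fun j => s'.contract (w j)) (s.extend ρ s') = _
  rw [s.map_extend (T := fun s => s.d) (fun s' B h => h.d_expWedge),
    s.diag_extend (T := fun j s => s.contract (w j)) (fun j s' B h => h.contract_expWedge (w j)),
    LinearMap.sub_apply, map_sub]
  rfl

theorem wedge_extend (ρ α : Series r (Forms (SmoothFun E M) (SmoothVF E M))) :
    C.wedge (s.extend ρ) α = s.extend (Series.wedge ρ α) :=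
  funext fun _ => (Series.map_wedge_of_linear (Forms.expWedge_wedge _) ρ α).symm

theorem diag_lieD_eq
    (hw : ∀ j Y, C.bracket (w j) (s.sec Y) = s.sec ⁅C.rho (w j), Y⁆) :
    (Series.diag fun j => s.lieD (w j)) =
    Series.diag fun j => Forms.lieD (C.rho (w j)) := by
  simp only [lieD_eq_of_invariant (hw _)]

/-- Evaluation at s and `extend` are mutually inverse on spinors. Invariance of s matches the Lie
derivative condition at s with the ordinary one; the shifts carry it to all other splittings. -/
theorem isoCohomology_cartan
    (hw : ∀ j Y, C.bracket (w j) (s.sec Y) = s.sec ⁅C.rho (w j), Y⁆) :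
    IsoCohomology
    (C.equivDiff w) (C.cartan w) C.wedge
    (Series.twistedDiff (fun j => C.rho (w j)) (s.equivTwist w))
    (Series.cartan fun j => C.rho (w j)) (fun ρ α => Series.wedge ρ α)
    (Series.cartanDiff fun j => C.rho (w j)) (Series.cartan fun j => C.rho (w j)) := by
  refine IsoCohomology.of_inverse
    (D := C.equivDiff w) (C := C.cartan w) (mul := C.wedge)
    (D' := Series.twistedDiff (fun j => C.rho (w j)) (s.equivTwist w)) (C' := Series.cartan fun j => C.rho (w j))
    (D₀ := Series.cartanDiff fun j => C.rho (w j)) (C₀ := Series.cartan fun j => C.rho (w j))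
    Series.wedge s.extend (LinearMap.proj s) s.extend_apply_self
    (fun p z hz => s.extend_of_mem_spinors hz.1.1) (fun p ρ hρ => ?_) (fun p z hz => ?_)
    (s.equivDiff_extend w) s.wedge_extend (fun p q ρ hρ α hα => Series.wedge_mem_cartan hρ hα)
    (fun ρ α hα => s.twistedDiff_wedge w hα ρ)
  · refine ⟨⟨s.extend_mem_spinors ρ, s.extend_mem_parity hρ.1⟩, LinearMap.mem_ker.2 ?_⟩
    funext s'
    change Series.diag (fun j => s'.lieD (w j)) (s.extend ρ s') = 0
    rw [s.diag_extend (T := fun j s => s.lieD (w j)) (fun j s' B h => h.lieD_expWedge (w j)),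
      s.diag_lieD_eq w hw, LinearMap.mem_ker.1 hρ.2, map_zero, Pi.zero_apply]
  · refine ⟨hz.1.2 s (Set.mem_univ s), LinearMap.mem_ker.2 ?_⟩
    rw [← s.diag_lieD_eq w hw]
    exact congrFun (LinearMap.mem_ker.1 hz.2) s

theorem isoCohomology_invariantCartan
    (hw : ∀ j Y, C.bracket (w j) (s.sec Y) = s.sec ⁅C.rho (w j), Y⁆)
    (c : Fin r → Fin r → Fin r → ℝ) : IsoCohomology
    (C.equivDiff w) (C.invariantCartan w c) C.wedge
    (Series.twistedDiff (fun j => C.rho (w j)) (s.equivTwist w))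
    (Series.invariantCartan (fun j => C.rho (w j)) c) (fun ρ α => Series.wedge ρ α)
    (Series.cartanDiff fun j => C.rho (w j)) (Series.invariantCartan (fun j => C.rho (w j)) c) := by
  refine IsoCohomology.of_inverse
    (D := C.equivDiff w) (C := C.invariantCartan w c) (mul := C.wedge)
    (D' := Series.twistedDiff (fun j => C.rho (w j)) (s.equivTwist w)) (C' := Series.invariantCartan (fun j => C.rho (w j)) c)
    (D₀ := Series.cartanDiff fun j => C.rho (w j)) (C₀ := Series.invariantCartan (fun j => C.rho (w j)) c)
    Series.wedge s.extend (LinearMap.proj s) s.extend_apply_self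
    (fun p z hz => s.extend_of_mem_spinors hz.1.1) (fun p ρ hρ => ?_) (fun p z hz => ?_)
    (s.equivDiff_extend w) s.wedge_extend
    (fun p q ρ hρ α hα => Series.wedge_mem_invariantCartan hρ hα)
    (fun ρ α hα => s.twistedDiff_wedge w hα ρ)
  · rw [Series.mem_invariantCartan] at hρ
    refine ⟨⟨s.extend_mem_spinors ρ, s.extend_mem_parity hρ.1⟩,
      Submodule.mem_iInf _ |>.2 fun i => LinearMap.mem_ker.2 ?_⟩
    funext s'
    change Series.map (s'.lieD (w i)) (s.extend ρ s') + Series.coadjoint c i (s.extend ρ s') = 0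
    rw [s.map_extend (T := fun s => s.lieD (w i)) (fun s' B h => h.lieD_expWedge (w i)),
      lieD_eq_of_invariant (hw i), extend_apply, extend_apply, ← Series.map_coadjoint, ← map_add,
      hρ.2, map_zero]
  · refine Series.mem_invariantCartan.2 ⟨hz.1.2 s (Set.mem_univ s), fun i => ?_⟩
    rw [← lieD_eq_of_invariant (hw i)]
    exact congrFun (LinearMap.mem_ker.1 (Submodule.mem_iInf _ |>.1 hz.2 i)) s

end IsotropicSplitting

end ExactCourantAlgebroid

end

end EquivariantTwist

/-! ### Existence of smooth isotropic splittings. -/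

section LocalFrames

open Bundle

set_option linter.unusedSectionVars false

noncomputable section

variable {E : Type*} [NormedAddCommGroup E] [NormedSpace ℝ E] [FiniteDimensional ℝ E]
  {M : Type*} [TopologicalSpace M] [ChartedSpace E M] [IsManifold 𝓘(ℝ, E) ∞ M]
  [T2Space M] [SigmaCompactSpace M]
  {F : Type*} [NormedAddCommGroup F] [NormedSpace ℝ F] [FiniteDimensional ℝ F]
  {V : M → Type*} [TopologicalSpace (TotalSpace F V)] [∀ x, AddCommGroup (V x)]
  [∀ x, Module ℝ (V x)] [∀ x, TopologicalSpace (V x)] [FiberBundle F V] [VectorBundle ℝ F V]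
  [ContMDiffVectorBundle ∞ F V 𝓘(ℝ, E)]

theorem contMDiffAt_matrix_det {n : ℕ} {A : M → Matrix (Fin n) (Fin n) ℝ} {x₀ : M}
    (h : ∀ i j, ContMDiffAt 𝓘(ℝ, E) 𝓘(ℝ, ℝ) ∞ (fun x => A x i j) x₀) :
    ContMDiffAt 𝓘(ℝ, E) 𝓘(ℝ, ℝ) ∞ (fun x => (A x).det) x₀ := by
  simp only [Matrix.det_apply]
  refine contMDiffAt_finsetSum fun σ _ => ?_
  simp only [Units.smul_def, zsmul_eq_mul]
  exact contMDiffAt_const.mul (contMDiffAt_finsetProd fun i _ => h _ _)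

/-- Cramer's rule: each entry is a determinant in smooth entries, divided by one that does not
vanish at x₀. -/
theorem contMDiffAt_matrix_inv {n : ℕ} {A : M → Matrix (Fin n) (Fin n) ℝ} {x₀ : M}
    (h : ∀ i j, ContMDiffAt 𝓘(ℝ, E) 𝓘(ℝ, ℝ) ∞ (fun x => A x i j) x₀) (h0 : (A x₀).det ≠ 0)
    (i j : Fin n) : ContMDiffAt 𝓘(ℝ, E) 𝓘(ℝ, ℝ) ∞ (fun x => (A x)⁻¹ i j) x₀ := by
  simp only [Matrix.inv_def, Matrix.smul_apply, Ring.inverse_eq_inv', smul_eq_mul,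
    Matrix.adjugate_apply]
  refine ((contMDiffAt_matrix_det h).inv₀ h0).mul (contMDiffAt_matrix_det fun k l => ?_)
  by_cases hk : k = j
  · subst hk
    simp only [Matrix.updateRow_self]
    exact contMDiffAt_const
  · simp only [Matrix.updateRow_ne hk]
    exact h k l

theorem nonempty_fiber_linearEquiv (x : M) : Nonempty (V x ≃ₗ[ℝ] F) :=
  ⟨(trivializationAt F V x).linearEquivAt ℝ x (mem_baseSet_trivializationAt F V x)⟩

namespace ExactCourantAlgebroid

variable (C : ExactCourantAlgebroid E F V)

/-- The pairing identifies each fibre with its dual. -/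
theorem exists_linearEquiv_dual (x : M) :
    ∃ e : V x ≃ₗ[ℝ] Module.Dual ℝ (V x), ∀ v w, e v w = C.pairing x v w := by
  obtain ⟨t⟩ := nonempty_fiber_linearEquiv (F := F) (V := V) x
  have := Module.Finite.equiv t.symm
  have hinj : Function.Injective (C.pairing x) := fun v v' h =>
    C.eq_of_pairing_eq fun w => LinearMap.congr_fun h w
  exact ⟨LinearEquiv.ofInjectiveOfFinrankEq _ hinj Subspace.dual_finrank_eq.symm, fun _ _ => rfl⟩

/-- A family of covectors that is smooth on sections is given by pairing with a smooth section. -/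
theorem exists_section_pairing_eq (l : ∀ x, V x →ₗ[ℝ] ℝ)
    (hl : ∀ u : SmoothSec E M F V, ContMDiff 𝓘(ℝ, E) 𝓘(ℝ, ℝ) ∞ fun x => l x (u x)) :
    ∃ v : SmoothSec E M F V, ∀ x w, C.pairing x (v x) w = l x w := by
  have hp : ∀ x, ∃ v : V x, ∀ w, C.pairing x v w = l x w := fun x => by
    obtain ⟨e, he⟩ := C.exists_linearEquiv_dual x
    exact ⟨e.symm (l x), fun w => by rw [← he, LinearEquiv.apply_symm_apply]⟩
  choose v hv using hp
  refine ⟨⟨v, fun x₀ => ?_⟩, hv⟩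
  obtain ⟨U, e, c, hUo, hU, hli, hec, hc⟩ := exists_frame (E := E) (F := F) (V := V) x₀
  -- The Gram matrix of the pairing in the frame. It is invertible near x₀ by nondegeneracy, and its
  -- inverse turns the smooth values of l on the frame into the coefficients of v.
  let A : M → Matrix (Fin (Module.finrank ℝ F)) (Fin (Module.finrank ℝ F)) ℝ :=
    fun x => Matrix.of fun i j => C.pairing x (e i x) (e j x)
  have hA : ∀ i j, ContMDiffAt 𝓘(ℝ, E) 𝓘(ℝ, ℝ) ∞ (fun x => A x i j) x₀ :=
    fun i j => C.contMDiff_pairing (e i) (e j) x₀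
  have hdet : (A x₀).det ≠ 0 := by
    intro h0
    obtain ⟨y, hy0, hy⟩ := Matrix.exists_vecMul_eq_zero_iff.2 h0
    have h1 : ∑ i, y i • e i x₀ = 0 := by
      refine C.pairing_nondegenerate x₀ _ fun w => ?_
      rw [← hec x₀ hU w, map_sum]
      refine Finset.sum_eq_zero fun j _ => ?_
      have hj := congrFun hy j
      simp only [Matrix.vecMul, dotProduct, A, Matrix.of_apply, Pi.zero_apply] at hj
      rw [map_smul, map_sum, LinearMap.sum_apply]
      simp only [map_smul, LinearMap.smul_apply, smul_eq_mul, hj, mul_zero]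
    exact hy0 (funext fun i => Fintype.linearIndependent_iff.1 hli y h1 i)
  have hs : ContMDiffAt 𝓘(ℝ, E) (𝓘(ℝ, E).prod 𝓘(ℝ, F)) ∞ (fun x => TotalSpace.mk' F x
      (∑ i, (∑ j, l x (e j x) * (A x)⁻¹ j i) • e i x)) x₀ :=
    ContMDiffAt.sum_section fun i _ => ContMDiffAt.smul_section
      (contMDiffAt_finsetSum fun j _ => (hl (e j) x₀).mul (contMDiffAt_matrix_inv hA hdet j i))
      ((e i).contMDiff x₀)
  refine hs.congr_of_eventuallyEq ?_
  filter_upwards [hUo.mem_nhds hU,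
    (contMDiffAt_matrix_det hA).continuousAt.eventually_ne hdet] with x hx hdx
  have h2 : Matrix.vecMul (fun i => c i x (v x)) (A x) = fun j => l x (e j x) := by
    funext j
    rw [← hv x]
    conv_rhs => rw [← hec x hx (v x)]
    simp only [Matrix.vecMul, dotProduct, A, Matrix.of_apply, map_sum, LinearMap.sum_apply,
      map_smul, LinearMap.smul_apply, smul_eq_mul]
  have h3 : Matrix.vecMul (fun j => l x (e j x)) (A x)⁻¹ = fun i => c i x (v x) := by
    rw [← h2, Matrix.vecMul_vecMul, Matrix.mul_nonsing_inv _ (isUnit_iff_ne_zero.2 hdx),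
      Matrix.vecMul_one]
  have h4 : v x = ∑ i, (∑ j, l x (e j x) * (A x)⁻¹ j i) • e i x := by
    conv_lhs => rw [← hec x hx (v x)]
    exact Finset.sum_congr rfl fun i _ => congrArg (· • e i x) (congrFun h3 i).symm
  exact congrArg (TotalSpace.mk' F x) h4

/-- A vector orthogonal to the kernel of the anchor belongs to it. -/
theorem anchor_eq_zero_of_orthogonal {x : M} {v : V x}
    (h : ∀ k, C.anchor x k = 0 → C.pairing x v k = 0) : C.anchor x v = 0 := by
  obtain ⟨t, ht⟩ := LinearMap.exists_rightInverse_of_surjective (C.anchor x)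
    (LinearMap.range_eq_top.2 (C.anchor_surjective x))
  refine (C.anchor_eq_zero_iff x v).2 ⟨(2 : ℝ) • (C.pairing x v ∘ₗ t), fun w => ?_⟩
  have h1 := h (w - t (C.anchor x w)) (by
    rw [map_sub, sub_eq_zero]; exact (LinearMap.congr_fun ht (C.anchor x w)).symm)
  rw [map_sub, sub_eq_zero] at h1
  rw [h1]; rfl

/-- The bilinear forms `β(X, w)` on `TM × V` of the form `⟨s(X), w⟩` with a splitting `s` of the
anchor. -/
def IsSplittingForm (β : ∀ x, TangentSpace 𝓘(ℝ, E) x →ₗ[ℝ] V x →ₗ[ℝ] ℝ) : Prop :=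
  ∀ x X k w, C.anchor x k = 0 → C.anchor x w = X → β x X k = C.pairing x k w

/-- Near every point there is a splitting of the anchor. -/
theorem exists_local_splitting (x₀ : M) : ∃ (U : Set M)
    (s : ∀ x, TangentSpace 𝓘(ℝ, E) x →ₗ[ℝ] V x), IsOpen U ∧ x₀ ∈ U ∧
      (∀ x ∈ U, ∀ X, C.anchor x (s x X) = X) ∧
      ∀ X : SmoothVF E M, ∀ x ∈ U, ContMDiffAt 𝓘(ℝ, E) (𝓘(ℝ, E).prod 𝓘(ℝ, F)) ∞
        (fun x => (⟨x, s x (X x)⟩ : TotalSpace F V)) x := by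
  have := contMDiffVectorBundle_tangent (E := E) (M := M)
  obtain ⟨U, e, c, hUo, hU, hli, hec, hc⟩ :=
    exists_frame (E := E) (F := E) (V := (TangentSpace 𝓘(ℝ, E) : M → Type _)) x₀
  have hlift : ∀ j, ∃ u : SmoothSec E M F V, C.anchor x₀ (u x₀) = e j x₀ := fun j => by
    obtain ⟨v, hv⟩ := C.anchor_surjective x₀ (e j x₀)
    obtain ⟨u, rfl⟩ := exists_smoothSec_apply_eq (E := E) (F := F) x₀ v
    exact ⟨u, hv⟩
  choose u hu using hlift
  have hcs : ∀ k (X : SmoothVF E M), ∀ x ∈ U,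
      ContMDiffAt 𝓘(ℝ, E) 𝓘(ℝ, ℝ) ∞ (fun x => c k x (X x)) x := fun k X x hx =>
    ((hc k).contMDiffAt ((hUo.preimage (FiberBundle.continuous_proj E
      (TangentSpace 𝓘(ℝ, E) : M → Type _))).mem_nhds hx)).comp x (X.contMDiff x)
  -- The u_j lift the frame e_j of TM at x₀ only. The matrix A of their anchors is the identity
  -- there, hence invertible nearby, and its inverse corrects the lifts.
  let A : M → Matrix (Fin (Module.finrank ℝ E)) (Fin (Module.finrank ℝ E)) ℝ :=
    fun x => Matrix.of fun k j => c k x (C.anchor x (u j x))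
  have hA : ∀ x ∈ U, ∀ k j, ContMDiffAt 𝓘(ℝ, E) 𝓘(ℝ, ℝ) ∞ (fun x => A x k j) x :=
    fun x hx k j => hcs k (C.rho (u j)) x hx
  have hA0 : A x₀ = 1 := by
    ext k j
    have h1 : ∑ k, (c k x₀ (e j x₀) - (1 : Matrix _ _ ℝ) k j) • e k x₀ = 0 := by
      simp only [sub_smul, Finset.sum_sub_distrib, hec x₀ hU]
      rw [Finset.sum_eq_single j, Matrix.one_apply_eq, one_smul, sub_self]
      · intro i _ hij
        rw [Matrix.one_apply_ne hij, zero_smul]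
      · simp
    have h2 := Fintype.linearIndependent_iff.1 hli _ h1 k
    change c k x₀ (C.anchor x₀ (u j x₀)) = _
    rw [hu]
    exact sub_eq_zero.1 h2
  have hdet : ∀ᶠ x in nhds x₀, (A x).det ≠ 0 :=
    (contMDiffAt_matrix_det (hA x₀ hU)).continuousAt.eventually_ne (by
      rw [hA0, Matrix.det_one]; exact one_ne_zero)
  obtain ⟨U', hU', hUo', hx'⟩ := eventually_nhds_iff.1 hdet
  refine ⟨U ∩ U', fun x => ∑ j, (∑ k, (A x)⁻¹ j k • c k x).smulRight (u j x), hUo.inter hUo',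
    ⟨hU, hx'⟩, fun x hx X => ?_, fun X x hx => ?_⟩
  · have h1 : Matrix.mulVec (A x) (Matrix.mulVec (A x)⁻¹ fun k => c k x X) = fun k => c k x X := by
      rw [Matrix.mulVec_mulVec, Matrix.mul_nonsing_inv _ (isUnit_iff_ne_zero.2 (hU' x hx.2)),
        Matrix.one_mulVec]
    rw [LinearMap.sum_apply, map_sum]
    rw [← hec x hx.1 (∑ j, C.anchor x _)]
    conv_rhs => rw [← hec x hx.1 X]
    refine Finset.sum_congr rfl fun l _ => congrArg (· • e l x) ?_
    rw [← congrFun h1 l]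
    simp only [Matrix.mulVec, dotProduct, map_sum, LinearMap.smulRight_apply, map_smul, A,
      LinearMap.sum_apply, LinearMap.smul_apply, smul_eq_mul, Matrix.of_apply]
    exact Finset.sum_congr rfl fun j _ => mul_comm _ _
  · have h2 : ContMDiffAt 𝓘(ℝ, E) (𝓘(ℝ, E).prod 𝓘(ℝ, F)) ∞ (fun x => TotalSpace.mk' F x
        (∑ j, (∑ k, (A x)⁻¹ j k * c k x (X x)) • u j x)) x :=
      ContMDiffAt.sum_section fun j _ => ContMDiffAt.smul_section
        (contMDiffAt_finsetSum fun k _ =>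
          (contMDiffAt_matrix_inv (hA x hx.1) (hU' x hx.2) j k).mul (hcs k X x hx.1))
        ((u j).contMDiff x)
    refine h2.congr_of_eventuallyEq (Filter.Eventually.of_forall fun y => ?_)
    refine congrArg (TotalSpace.mk' F y) ?_
    simp only [LinearMap.sum_apply, LinearMap.smulRight_apply, LinearMap.smul_apply, smul_eq_mul]

/-- The anchor has a smooth splitting. -/
theorem exists_isSplittingForm : ∃ β : ∀ x, TangentSpace 𝓘(ℝ, E) x →ₗ[ℝ] V x →ₗ[ℝ] ℝ,
    C.IsSplittingForm β ∧ ∀ (X : SmoothVF E M) (w : SmoothSec E M F V),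
      ContMDiff 𝓘(ℝ, E) 𝓘(ℝ, ℝ) ∞ fun x => β x (X x) (w x) := by
  choose U s hUo hU hs hsm using C.exists_local_splitting
  obtain ⟨f, hf⟩ := SmoothPartitionOfUnity.exists_isSubordinate 𝓘(ℝ, E) isClosed_univ U hUo
    fun x _ => Set.mem_iUnion.2 ⟨x, hU x⟩
  have hfin : ∀ x, (Function.support fun i => f i x).Finite := fun x =>
    f.locallyFinite.point_finite x
  -- At each point the combination is a finite sum, so it is a linear map; smoothness is proved for
  -- the corresponding `finsum`, where the index set does not depend on x.
  have hval : ∀ x X w, (∑ i ∈ (hfin x).toFinset, f i x • (C.pairing x ∘ₗ s i x) :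
      TangentSpace 𝓘(ℝ, E) x →ₗ[ℝ] V x →ₗ[ℝ] ℝ) X w =
        ∑ᶠ i, f i x • C.pairing x (s i x X) w := by
    intro x X w
    rw [finsum_eq_sum_of_support_subset (s := (hfin x).toFinset)]
    · simp only [LinearMap.sum_apply, LinearMap.smul_apply, LinearMap.comp_apply]
    · intro i hi
      simp only [Set.Finite.coe_toFinset, Function.mem_support] at hi ⊢
      exact fun h => hi (by rw [h, zero_smul])
  refine ⟨fun x => ∑ i ∈ (hfin x).toFinset, f i x • (C.pairing x ∘ₗ s i x), ?_, fun X w => ?_⟩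
  · intro x X k w hk hw
    -- Being a splitting form is an affine condition: every local splitting gives the same value on
    -- the kernel of the anchor, and the weights add up to one.
    have h1 : ∀ i, f i x • C.pairing x (s i x X) k = f i x * C.pairing x k w := by
      intro i
      by_cases hi : f i x = 0
      · rw [hi, zero_smul, zero_mul]
      · have hx : x ∈ U i := hf i (subset_tsupport _ hi)
        rw [smul_eq_mul, C.pairing_symm, C.pairing_eq_of_anchor_eq hk (v := s i x X) (w := w)
          (by rw [hs i x hx, hw])]
    rw [hval]
    simp only [h1]
    rw [← finsum_mul, f.sum_eq_one (Set.mem_univ x), one_mul]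
  · simp only [hval]
    refine f.contMDiff_finsum_smul fun i x hx => ?_
    exact contMDiffAt_bilin C.pairing C.contMDiff_pairing (hsm i X x (hf i hx)) (w.contMDiff x)

/-- Raising the index of a smooth family of bilinear forms. -/
theorem exists_toFun_of_bilin (β : ∀ x, TangentSpace 𝓘(ℝ, E) x →ₗ[ℝ] V x →ₗ[ℝ] ℝ)
    (hβ : ∀ (X : SmoothVF E M) (w : SmoothSec E M F V),
      ContMDiff 𝓘(ℝ, E) 𝓘(ℝ, ℝ) ∞ fun x => β x (X x) (w x)) :
    ∃ s : ∀ x, TangentSpace 𝓘(ℝ, E) x →ₗ[ℝ] V x,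
      (∀ x X w, C.pairing x (s x X) w = β x X w) ∧
      ∀ X : SmoothVF E M, ContMDiff 𝓘(ℝ, E) (𝓘(ℝ, E).prod 𝓘(ℝ, F)) ∞
        fun x => (⟨x, s x (X x)⟩ : TotalSpace F V) := by
  choose e he using C.exists_linearEquiv_dual
  have hs : ∀ x X w, C.pairing x ((e x).symm (β x X)) w = β x X w := fun x X w => by
    rw [← he, LinearEquiv.apply_symm_apply]
  refine ⟨fun x => (e x).symm.toLinearMap ∘ₗ β x, hs, fun X => ?_⟩
  obtain ⟨v, hv⟩ := C.exists_section_pairing_eq (fun x => β x (X x)) (hβ X)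
  refine v.contMDiff.congr fun x => congrArg (TotalSpace.mk' F x) ?_
  exact C.eq_of_pairing_eq fun w => (hs x (X x) w).trans (hv x w).symm

/-- A smooth splitting of the anchor can be made isotropic; the result is expressed through the
original splitting `t` by `⟨s(X), w⟩ = ⟨t(X), w⟩ - ⟨t(X), t(a(w))⟩ / 2`. -/
theorem exists_isotropicSplitting_of_isSplittingForm
    {β : ∀ x, TangentSpace 𝓘(ℝ, E) x →ₗ[ℝ] V x →ₗ[ℝ] ℝ} (h : C.IsSplittingForm β)
    (hβ : ∀ (X : SmoothVF E M) (w : SmoothSec E M F V),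
      ContMDiff 𝓘(ℝ, E) 𝓘(ℝ, ℝ) ∞ fun x => β x (X x) (w x)) :
    ∃ (t : ∀ x, TangentSpace 𝓘(ℝ, E) x →ₗ[ℝ] V x) (s : C.IsotropicSplitting),
      (∀ x X w, C.pairing x (t x X) w = β x X w) ∧
      ∀ x X w, C.pairing x (s.toFun x X) w =
        C.pairing x (t x X) w - C.pairing x (t x X) (t x (C.anchor x w)) / 2 := by
  obtain ⟨t, ht, htm⟩ := C.exists_toFun_of_bilin β hβ
  have hat : ∀ x X, C.anchor x (t x X) = X := fun x X => by
    obtain ⟨w, hw⟩ := C.anchor_surjective x X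
    rw [← hw, ← sub_eq_zero, ← map_sub]
    -- The kernel of the anchor contains its own orthogonal. So w and t(a(w)) have the same anchor
    -- once they pair equally with the kernel, which is the splitting form condition.
    refine C.anchor_eq_zero_of_orthogonal fun k hk => ?_
    rw [map_sub, LinearMap.sub_apply, ht, h x _ k w hk rfl, C.pairing_symm, sub_self]
  let γ : ∀ x, TangentSpace 𝓘(ℝ, E) x →ₗ[ℝ] V x →ₗ[ℝ] ℝ := fun x =>
    (C.pairing x ∘ₗ t x) - (2⁻¹ : ℝ) • (C.pairing x).compl₁₂ (t x) (t x ∘ₗ C.anchor x)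
  have hγ : ∀ x X w, γ x X w =
      C.pairing x (t x X) w - C.pairing x (t x X) (t x (C.anchor x w)) / 2 := fun x X w => by
    simp only [γ, LinearMap.sub_apply, LinearMap.smul_apply, LinearMap.comp_apply,
      LinearMap.compl₁₂_apply, smul_eq_mul]
    ring
  obtain ⟨s, hs, hsm⟩ := C.exists_toFun_of_bilin γ fun X w => by
    simp only [hγ]
    exact (C.contMDiff_pairing ⟨_, htm X⟩ w).sub
      ((C.contMDiff_pairing ⟨_, htm X⟩ ⟨_, htm (C.rho w)⟩).div_const 2)
  have hs' : ∀ x X w, C.pairing x (s x X) w =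
      C.pairing x (t x X) w - C.pairing x (t x X) (t x (C.anchor x w)) / 2 := fun x X w =>
    (hs x X w).trans (hγ x X w)
  have has : ∀ x X, C.anchor x (s x X) = X := fun x X => by
    refine Eq.trans ?_ (hat x X)
    rw [← sub_eq_zero, ← map_sub]
    refine C.anchor_eq_zero_of_orthogonal fun k hk => ?_
    rw [map_sub, LinearMap.sub_apply, hs', hk, map_zero, map_zero]
    ring
  refine ⟨t, ⟨s, hsm, has, fun x X Y => ?_⟩, ht, hs'⟩
  -- The pairing of s(X) with s(Y) is that of t(X) with s(Y) minus half of ⟨t(X), t(Y)⟩, and by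
  -- symmetry the former is itself half of ⟨t(X), t(Y)⟩.
  have e1 := hs' x X (s x Y)
  have e2 := hs' x Y (t x X)
  have e3 := C.pairing_symm x (t x X) (s x Y)
  have e4 := C.pairing_symm x (t x X) (t x Y)
  rw [has] at e1
  rw [hat] at e2
  linarith

end ExactCourantAlgebroid

end

end LocalFrames

/-! ### Smoothness of integrals over a compact manifold. -/

section ParametricIntegral

open MeasureTheory

set_option linter.unusedSectionVars false

noncomputable section

variable {E : Type*} [NormedAddCommGroup E] [NormedSpace ℝ E] [FiniteDimensional ℝ E]
  {EG : Type*} [NormedAddCommGroup EG] [NormedSpace ℝ EG]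
  {G : Type*} [TopologicalSpace G] [ChartedSpace EG G] [IsManifold 𝓘(ℝ, EG) ∞ G]

/-- The derivative in the second variable of a smooth function is smooth in both variables. -/
theorem contMDiffAt_fderiv_snd {f : G → E → ℝ} {g₀ : G} {y₀ : E}
    (hf : ContMDiffAt (𝓘(ℝ, EG).prod 𝓘(ℝ, E)) 𝓘(ℝ, ℝ) ∞ (Function.uncurry f) (g₀, y₀)) :
    ContMDiffAt (𝓘(ℝ, EG).prod 𝓘(ℝ, E)) 𝓘(ℝ, E →L[ℝ] ℝ) ∞
      (fun p : G × E => fderiv ℝ (f p.1) p.2) (g₀, y₀) := by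
  have h := ContMDiffAt.mfderiv (I := 𝓘(ℝ, E)) (I' := 𝓘(ℝ, ℝ)) (J := 𝓘(ℝ, EG).prod 𝓘(ℝ, E))
    (n := ∞) (m := ∞) (x₀ := (g₀, y₀)) (fun (p : G × E) (y : E) => f p.1 y) Prod.snd
    (hf.comp (((g₀, y₀), y₀) : (G × E) × E)
      ((contMDiff_fst.comp contMDiff_fst).prodMk contMDiff_snd).contMDiffAt)
    contMDiffAt_snd (by simp)
  rw [← inTangentCoordinates_model_space (I := 𝓘(ℝ, E)) (I' := 𝓘(ℝ, ℝ)) Prod.snd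
    (fun p : G × E => f p.1 p.2) (fun p : G × E => fderiv ℝ (f p.1) p.2) (g₀, y₀)]
  simpa only [mfderiv_eq_fderiv] using h

variable [CompactSpace G] [MeasurableSpace G] [BorelSpace G] (μ : Measure G) [IsFiniteMeasure μ]

theorem integrable_of_continuous {W : Type*} [NormedAddCommGroup W] [SecondCountableTopology W]
    {k : G → W} (hk : Continuous k) : Integrable k μ := by
  obtain ⟨c, hc⟩ := isCompact_univ.exists_bound_of_continuousOn hk.continuousOn
  exact Integrable.of_bound hk.aestronglyMeasurable c
    (Filter.Eventually.of_forall fun g => hc g (Set.mem_univ g))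

/-- Differentiation under the integral: by compactness of `G` times a closed ball, the derivative is
bounded by a constant, which is integrable for a finite measure. -/
theorem hasFDerivAt_integral_of_contMDiffAt {f : G → E → ℝ} {U : Set E} (hU : IsOpen U)
    (hf : ∀ g, ∀ y ∈ U,
      ContMDiffAt (𝓘(ℝ, EG).prod 𝓘(ℝ, E)) 𝓘(ℝ, ℝ) ∞ (Function.uncurry f) (g, y))
    {y₀ : E} (hy₀ : y₀ ∈ U) :
    HasFDerivAt (fun y => ∫ g, f g y ∂μ) (∫ g, fderiv ℝ (f g) y₀ ∂μ) y₀ ∧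
      Integrable (fun g => fderiv ℝ (f g) y₀) μ := by
  have : SecondCountableTopology (E →L[ℝ] ℝ) := by
    have : ProperSpace (E →L[ℝ] ℝ) := FiniteDimensional.proper_real _
    infer_instance
  obtain ⟨ε, hε, hεU⟩ := Metric.nhds_basis_closedBall.mem_iff.1 (hU.mem_nhds hy₀)
  have hc : ∀ y ∈ U, Continuous fun g => f g y := fun y hy =>
    continuous_iff_continuousAt.2 fun g => (hf g y hy).continuousAt.comp (f := fun g => (g, y))
      (by fun_prop)
  have hc' : ∀ g, ∀ y ∈ U, ContinuousAt (fun p : G × E => fderiv ℝ (f p.1) p.2) (g, y) :=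
    fun g y hy => (contMDiffAt_fderiv_snd (hf g y hy)).continuousAt
  have hcd : ∀ y ∈ U, Continuous fun g => fderiv ℝ (f g) y := fun y hy =>
    continuous_iff_continuousAt.2 fun g => (hc' g y hy).comp (f := fun g => (g, y)) (by fun_prop)
  obtain ⟨c, hbound⟩ := (isCompact_univ.prod (isCompact_closedBall y₀ ε)).exists_bound_of_continuousOn
    (f := fun p : G × E => fderiv ℝ (f p.1) p.2)
    fun p hp => (hc' p.1 p.2 (hεU hp.2)).continuousWithinAt
  refine ⟨hasFDerivAt_integral_of_dominated_of_fderiv_le (bound := fun _ => c)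
    (F := fun y g => f g y) (F' := fun y g => fderiv ℝ (f g) y)
    (Metric.closedBall_mem_nhds y₀ hε) ?_ (integrable_of_continuous μ (hc y₀ hy₀))
    (hcd y₀ hy₀).aestronglyMeasurable ?_ (integrable_const c) ?_,
    integrable_of_continuous μ (hcd y₀ hy₀)⟩
  · filter_upwards [hU.mem_nhds hy₀] with y hy
    exact (hc y hy).aestronglyMeasurable
  · exact Filter.Eventually.of_forall fun g y hy => hbound (g, y) ⟨Set.mem_univ g, hy⟩
  · refine Filter.Eventually.of_forall fun g y hy => ?_
    have h1 : ContMDiffAt 𝓘(ℝ, E) 𝓘(ℝ, ℝ) ∞ (f g) y :=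
      (hf g y (hεU hy)).comp (f := fun y => (g, y)) y
        (contMDiff_const.prodMk contMDiff_id).contMDiffAt
    exact (h1.contDiffAt.differentiableAt (by simp)).hasFDerivAt

/-- Each directional derivative is again the integral of a smooth family, so the induction on n runs
over all families simultaneously. -/
theorem contDiffOn_integral (n : ℕ) : ∀ {f : G → E → ℝ} {U : Set E}, IsOpen U →
    (∀ g, ∀ y ∈ U,
      ContMDiffAt (𝓘(ℝ, EG).prod 𝓘(ℝ, E)) 𝓘(ℝ, ℝ) ∞ (Function.uncurry f) (g, y)) →
    ContDiffOn ℝ n (fun y => ∫ g, f g y ∂μ) U := by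
  induction n with
  | zero =>
    intro f U hU hf
    refine contDiffOn_zero.2 fun y hy => ?_
    exact (hasFDerivAt_integral_of_contMDiffAt μ hU hf hy).1.continuousAt.continuousWithinAt
  | succ n ih =>
    intro f U hU hf
    push_cast
    refine (contDiffOn_succ_iff_fderiv_of_isOpen hU).2 ⟨fun y hy =>
      (hasFDerivAt_integral_of_contMDiffAt μ hU hf hy).1.differentiableAt.differentiableWithinAt,
      fun h => by simp at h, contDiffOn_clm_apply.2 fun v => ?_⟩
    refine (ih (f := fun g y => fderiv ℝ (f g) y v) hU fun g y hy => ?_).congr fun y hy => ?_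
    · exact (contMDiffAt_fderiv_snd (hf g y hy)).clm_apply contMDiffAt_const
    · obtain ⟨h1, h2⟩ := hasFDerivAt_integral_of_contMDiffAt μ hU hf hy
      rw [h1.fderiv, ContinuousLinearMap.integral_apply h2]

/-- The integral over a compact manifold of a smooth family of functions is smooth. -/
theorem contMDiff_integral {M : Type*} [TopologicalSpace M] [ChartedSpace E M]
    [IsManifold 𝓘(ℝ, E) ∞ M] {f : G → M → ℝ}
    (hf : ContMDiff (𝓘(ℝ, EG).prod 𝓘(ℝ, E)) 𝓘(ℝ, ℝ) ∞ (Function.uncurry f)) :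
    ContMDiff 𝓘(ℝ, E) 𝓘(ℝ, ℝ) ∞ fun x => ∫ g, f g x ∂μ := by
  intro x₀
  have hU := isOpen_extChartAt_target (I := 𝓘(ℝ, E)) x₀
  have h1 : ContDiffOn ℝ ∞ (fun y => ∫ g, f g ((extChartAt 𝓘(ℝ, E) x₀).symm y) ∂μ)
      (extChartAt 𝓘(ℝ, E) x₀).target := by
    refine contDiffOn_infty.2 fun n => contDiffOn_integral (EG := EG) μ n
      (f := fun g y => f g ((extChartAt 𝓘(ℝ, E) x₀).symm y)) hU fun g y hy => ?_
    have h2 : ContMDiffAt 𝓘(ℝ, E) 𝓘(ℝ, E) ∞ (extChartAt 𝓘(ℝ, E) x₀).symm y :=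
      (contMDiffOn_extChartAt_symm x₀).contMDiffAt (hU.mem_nhds hy)
    exact hf.contMDiffAt.comp (g := Function.uncurry f)
      (f := fun p : G × E => (p.1, (extChartAt 𝓘(ℝ, E) x₀).symm p.2)) (g, y)
      (contMDiffAt_fst.prodMk (h2.comp (f := Prod.snd) (g, y) contMDiffAt_snd))
  have h3 : ContMDiffAt 𝓘(ℝ, E) 𝓘(ℝ, ℝ) ∞
      (fun x => ∫ g, f g ((extChartAt 𝓘(ℝ, E) x₀).symm (extChartAt 𝓘(ℝ, E) x₀ x)) ∂μ) x₀ :=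
    ((h1.contDiffAt (hU.mem_nhds (mem_extChartAt_target x₀))).contMDiffAt).comp
      (f := extChartAt 𝓘(ℝ, E) x₀) x₀ contMDiffAt_extChartAt
  refine h3.congr_of_eventuallyEq ?_
  filter_upwards [extChartAt_source_mem_nhds (I := 𝓘(ℝ, E)) x₀] with x hx
  rw [(extChartAt 𝓘(ℝ, E) x₀).left_inv hx]

end

end ParametricIntegral

/-! ### Averaging over the group, and infinitesimal invariance. -/

section Averaging

open Bundle MeasureTheory

set_option linter.unusedSectionVars false

noncomputable section

variable {E : Type*} [NormedAddCommGroup E] [NormedSpace ℝ E] [FiniteDimensional ℝ E]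
  {M : Type*} [TopologicalSpace M] [ChartedSpace E M] [IsManifold 𝓘(ℝ, E) ∞ M]
  [T2Space M] [SigmaCompactSpace M]
  {F : Type*} [NormedAddCommGroup F] [NormedSpace ℝ F] [FiniteDimensional ℝ F]
  {V : M → Type*} [TopologicalSpace (TotalSpace F V)] [∀ x, AddCommGroup (V x)]
  [∀ x, Module ℝ (V x)] [∀ x, TopologicalSpace (V x)] [FiberBundle F V] [VectorBundle ℝ F V]
  [ContMDiffVectorBundle ∞ F V 𝓘(ℝ, E)]
  {EG : Type*} [NormedAddCommGroup EG] [NormedSpace ℝ EG]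
  {G : Type*} [TopologicalSpace G] [ChartedSpace EG G] [Group G] [LieGroup 𝓘(ℝ, EG) ∞ G]
  [MulAction G M] [ContMDiffSMul 𝓘(ℝ, EG) 𝓘(ℝ, E) ∞ G M]

variable (E) in
/-- The tangent map of the action of a group element. -/
def tangentAction (g : G) (x : M) :
    TangentSpace 𝓘(ℝ, E) x →L[ℝ] TangentSpace 𝓘(ℝ, E) (g • x) :=
  mfderiv 𝓘(ℝ, E) 𝓘(ℝ, E) (fun y : M => g • y) x

theorem mdifferentiable_smul (EG : Type*) [NormedAddCommGroup EG] [NormedSpace ℝ EG]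
    [ChartedSpace EG G] [ContMDiffSMul 𝓘(ℝ, EG) 𝓘(ℝ, E) ∞ G M] (g : G) :
    MDifferentiable 𝓘(ℝ, E) 𝓘(ℝ, E) (fun y : M => g • y) := by
  have h : ContMDiff (𝓘(ℝ, EG).prod 𝓘(ℝ, E)) 𝓘(ℝ, E) ∞ fun p : G × M => p.1 • p.2 :=
    contMDiff_smul
  have h' : ContMDiff 𝓘(ℝ, E) (𝓘(ℝ, EG).prod 𝓘(ℝ, E)) ∞ fun y : M => (g, y) :=
    contMDiff_const.prodMk contMDiff_id
  exact (h.comp h').mdifferentiable (by simp)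

/-- The chain rule, stated in the total space because the fibres over (g * h) • x and g • h • x are
not definitionally the same. -/
theorem tangentAction_mul {g h : G}
    (hg : MDifferentiable 𝓘(ℝ, E) 𝓘(ℝ, E) (fun y : M => g • y))
    (hh : MDifferentiable 𝓘(ℝ, E) 𝓘(ℝ, E) (fun y : M => h • y)) (x : M) (X : TangentSpace 𝓘(ℝ, E) x) :
    (⟨(g * h) • x, tangentAction E (g * h) x X⟩ : TangentBundle 𝓘(ℝ, E) M) =
      ⟨g • h • x, tangentAction E g (h • x) (tangentAction E h x X)⟩ := by
  have h1 := tangentMap_comp hg hh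
  have h2 : ((fun y : M => g • y) ∘ fun y : M => h • y) = fun y : M => (g * h) • y :=
    funext fun y => (mul_smul g h y).symm
  rw [h2] at h1
  exact congrFun h1 ⟨x, X⟩

/-- Joint smoothness in g and x: the expression is the tangent map of the action `G × M → M`,
evaluated on the zero vector at g and on X. -/
theorem contMDiff_tangentAction (X : SmoothVF E M) :
    ContMDiff (𝓘(ℝ, EG).prod 𝓘(ℝ, E)) 𝓘(ℝ, E).tangent ∞ fun p : G × M =>
      (⟨p.1 • p.2, tangentAction E p.1 p.2 (X p.2)⟩ : TangentBundle 𝓘(ℝ, E) M) := by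
  have h1 : ContMDiff (𝓘(ℝ, EG).prod 𝓘(ℝ, E)) 𝓘(ℝ, E) ∞ fun p : G × M => p.1 • p.2 :=
    contMDiff_smul
  have h2 := h1.contMDiff_tangentMap (m := ∞) (by simp)
  have hz : ContMDiff 𝓘(ℝ, EG) 𝓘(ℝ, EG).tangent ∞
      (zeroSection EG (TangentSpace 𝓘(ℝ, EG) : G → Type _)) := contMDiff_zeroSection ℝ _
  have h3 : ContMDiff (𝓘(ℝ, EG).prod 𝓘(ℝ, E)) (𝓘(ℝ, EG).prod 𝓘(ℝ, E)).tangent ∞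
      fun p : G × M => (equivTangentBundleProd 𝓘(ℝ, EG) G 𝓘(ℝ, E) M).symm
        (zeroSection EG (TangentSpace 𝓘(ℝ, EG) : G → Type _) p.1, ⟨p.2, X p.2⟩) :=
    contMDiff_equivTangentBundleProd_symm.comp
      ((hz.comp contMDiff_fst).prodMk (X.contMDiff.comp contMDiff_snd))
  refine (h2.comp h3).congr fun p => ?_
  have h4 : tangentAction E p.1 p.2 = (mfderiv (𝓘(ℝ, EG).prod 𝓘(ℝ, E)) 𝓘(ℝ, E)
      (fun p : G × M => p.1 • p.2) p) ∘L
        mfderiv 𝓘(ℝ, E) (𝓘(ℝ, EG).prod 𝓘(ℝ, E)) (fun y : M => (p.1, y)) p.2 :=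
    mfderiv_comp p.2 (g := fun p : G × M => p.1 • p.2) (f := fun y : M => (p.1, y))
      (h1.mdifferentiable (by simp) _)
      ((contMDiff_const.prodMk contMDiff_id : ContMDiff _ _ ∞ _).mdifferentiable (by simp) _)
  rw [mfderiv_prod_right] at h4
  refine congrArg (fun v => (⟨p.1 • p.2, v⟩ : TangentBundle 𝓘(ℝ, E) M)) ?_
  rw [h4]
  rfl

namespace ExactCourantAlgebroid.GroupAction

variable {C : ExactCourantAlgebroid E F V} (φ : C.GroupAction EG G)

/-- Preserving a nondegenerate pairing makes the fibre map injective, and all fibres have the same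
finite dimension. -/
theorem toFun_surjective (g : G) (x : M) : Function.Surjective (φ.toFun g x) := by
  obtain ⟨t⟩ := nonempty_fiber_linearEquiv (F := F) (V := V) x
  obtain ⟨t'⟩ := nonempty_fiber_linearEquiv (F := F) (V := V) (g • x)
  have := Module.Finite.equiv t.symm
  have := Module.Finite.equiv t'.symm
  refine (LinearMap.injective_iff_surjective_of_finrank_eq_finrank
    (t.finrank_eq.trans t'.finrank_eq.symm)).1
    ((injective_iff_map_eq_zero _).2 fun v hv => C.pairing_nondegenerate x v fun w => ?_)
  rw [← φ.pairing_toFun g, hv, map_zero, LinearMap.zero_apply]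

theorem tangentAction_surjective (φ : C.GroupAction EG G) (g : G) (x : M) :
    Function.Surjective (tangentAction E g x) := by
  intro Y
  obtain ⟨w, rfl⟩ := C.anchor_surjective (g • x) Y
  obtain ⟨v, rfl⟩ := φ.toFun_surjective g x w
  exact ⟨C.anchor x v, (φ.anchor_toFun g x v).symm⟩

theorem bilin_congr (β : ∀ x, TangentSpace 𝓘(ℝ, E) x →ₗ[ℝ] V x →ₗ[ℝ] ℝ) {x y : M}
    {X : TangentSpace 𝓘(ℝ, E) x} {Y : TangentSpace 𝓘(ℝ, E) y} {v : V x} {w : V y}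
    (h : (⟨x, X⟩ : TangentBundle 𝓘(ℝ, E) M) = ⟨y, Y⟩) (h' : (⟨x, v⟩ : TotalSpace F V) = ⟨y, w⟩) :
    β x X v = β y Y w := by
  obtain rfl : x = y := congrArg TotalSpace.proj h'
  rw [TotalSpace.mk_inj.1 h', TotalSpace.mk_inj.1 h]

theorem contMDiff_bilin_action (β : ∀ x, TangentSpace 𝓘(ℝ, E) x →ₗ[ℝ] V x →ₗ[ℝ] ℝ)
    (hβ : ∀ (X : SmoothVF E M) (w : SmoothSec E M F V),
      ContMDiff 𝓘(ℝ, E) 𝓘(ℝ, ℝ) ∞ fun x => β x (X x) (w x))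
    (X : SmoothVF E M) (w : SmoothSec E M F V) :
    ContMDiff (𝓘(ℝ, EG).prod 𝓘(ℝ, E)) 𝓘(ℝ, ℝ) ∞ (Function.uncurry fun (g : G) (x : M) =>
      β (g • x) (tangentAction E g x (X x)) (φ.toFun g x (w x))) := by
  have := contMDiffVectorBundle_tangent (E := E) (M := M)
  intro p
  have h1 : ContMDiff (𝓘(ℝ, EG).prod 𝓘(ℝ, E)) (𝓘(ℝ, E).prod 𝓘(ℝ, F)) ∞ fun p : G × M =>
      (⟨p.1 • p.2, φ.toFun p.1 p.2 (w p.2)⟩ : TotalSpace F V) :=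
    φ.contMDiff_toFun.comp (contMDiff_fst.prodMk (w.contMDiff.comp contMDiff_snd))
  exact contMDiffAt_bilin (V := (TangentSpace 𝓘(ℝ, E) : M → Type _)) β hβ
    (contMDiff_tangentAction X p) (h1 p)

theorem continuous_bilin_action (β : ∀ x, TangentSpace 𝓘(ℝ, E) x →ₗ[ℝ] V x →ₗ[ℝ] ℝ)
    (hβ : ∀ (X : SmoothVF E M) (w : SmoothSec E M F V),
      ContMDiff 𝓘(ℝ, E) 𝓘(ℝ, ℝ) ∞ fun x => β x (X x) (w x))
    (x : M) (X : TangentSpace 𝓘(ℝ, E) x) (w : V x) : Continuous fun g : G =>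
      β (g • x) (tangentAction E g x X) (φ.toFun g x w) := by
  obtain ⟨X, rfl⟩ := exists_smoothVF_apply_eq x X
  obtain ⟨w, rfl⟩ := exists_smoothSec_apply_eq (E := E) (F := F) x w
  exact (φ.contMDiff_bilin_action β hβ X w).continuous.comp
    (continuous_id.prodMk continuous_const : Continuous fun g : G => (g, x))

/-- A family of bilinear forms is invariant under the action. -/
def IsInvariantForm (β : ∀ x, TangentSpace 𝓘(ℝ, E) x →ₗ[ℝ] V x →ₗ[ℝ] ℝ) : Prop :=
  ∀ g x X w, β (g • x) (tangentAction E g x X) (φ.toFun g x w) = β x X w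

/-- Averaging over a compact group. -/
theorem exists_invariant_isSplittingForm [CompactSpace G] :
    ∃ β : ∀ x, TangentSpace 𝓘(ℝ, E) x →ₗ[ℝ] V x →ₗ[ℝ] ℝ,
      C.IsSplittingForm β ∧ φ.IsInvariantForm β ∧
      ∀ (X : SmoothVF E M) (w : SmoothSec E M F V),
        ContMDiff 𝓘(ℝ, E) 𝓘(ℝ, ℝ) ∞ fun x => β x (X x) (w x) := by
  obtain ⟨β, hs, hβ⟩ := C.exists_isSplittingForm
  have : IsTopologicalGroup G := topologicalGroup_of_lieGroup 𝓘(ℝ, EG) ∞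
  let mG : MeasurableSpace G := borel G
  have bG : BorelSpace G := ⟨rfl⟩
  -- Acting by h replaces g by g h in the integrand, so right invariance is required; inversion
  -- turns left Haar measure into a right invariant one. The normalization to mass one keeps the
  -- average a splitting form.
  let μ : Measure G := (Measure.haarMeasure (⊤ : TopologicalSpace.PositiveCompacts G)).inv
  have hμ : IsProbabilityMeasure μ := ⟨by
    rw [Measure.inv_apply, Set.inv_univ]
    exact Measure.haarMeasure_self (K₀ := (⊤ : TopologicalSpace.PositiveCompacts G))⟩
  have hint : ∀ x X w, Integrable
      (fun g : G => β (g • x) (tangentAction E g x X) (φ.toFun g x w)) μ := fun x X w =>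
    integrable_of_continuous μ (φ.continuous_bilin_action β hβ x X w)
  let α : ∀ x, TangentSpace 𝓘(ℝ, E) x →ₗ[ℝ] V x →ₗ[ℝ] ℝ := fun x =>
    LinearMap.mk₂ ℝ (fun X w => ∫ g : G, β (g • x) (tangentAction E g x X) (φ.toFun g x w) ∂μ)
      (fun X Y w => by
        rw [← integral_add (hint x X w) (hint x Y w)]
        simp only [map_add, LinearMap.add_apply])
      (fun c X w => by
        rw [← integral_smul]
        simp only [map_smul, LinearMap.smul_apply])
      (fun X v w => by
        rw [← integral_add (hint x X v) (hint x X w)]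
        simp only [map_add])
      (fun c X w => by
        rw [← integral_smul]
        simp only [map_smul])
  have hα : ∀ x X w, α x X w =
    ∫ g : G, β (g • x) (tangentAction E g x X) (φ.toFun g x w) ∂μ := fun _ _ _ => rfl
  refine ⟨α, fun x X k w hk hw => ?_, fun h x X w => ?_, fun X w => ?_⟩
  -- On the kernel of the anchor the integrand is constant in g, because the action preserves the
  -- anchor and the pairing.
  · have h1 : ∀ g : G, β (g • x) (tangentAction E g x X) (φ.toFun g x k) = C.pairing x k w := by
      intro g
      rw [hs (g • x) _ (φ.toFun g x k) (φ.toFun g x w) (by rw [φ.anchor_toFun, hk, map_zero])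
        (by rw [φ.anchor_toFun, hw]; rfl), φ.pairing_toFun]
    rw [hα]
    simp only [h1, integral_const, probReal_univ, one_smul]
  · rw [hα, hα]
    refine Eq.trans ?_ (integral_mul_right_eq_self
      (fun g : G => β (g • x) (tangentAction E g x X) (φ.toFun g x w)) h)
    exact integral_congr_ae (Filter.Eventually.of_forall fun g => (bilin_congr β
      (tangentAction_mul (mdifferentiable_smul EG g) (mdifferentiable_smul EG h) x X) (φ.mul_apply g h x w)).symm)
  · simp only [hα]
    exact contMDiff_integral μ (φ.contMDiff_bilin_action β hβ X w)

/-- There is an invariant isotropic splitting. -/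
theorem exists_invariant_isotropicSplitting [CompactSpace G] : ∃ s : C.IsotropicSplitting,
    ∀ g x X, s.toFun (g • x) (tangentAction E g x X) = φ.toFun g x (s.toFun x X) := by
  obtain ⟨β, hs, hinv, hβ⟩ := φ.exists_invariant_isSplittingForm
  obtain ⟨t, s, ht, hst⟩ := C.exists_isotropicSplitting_of_isSplittingForm hs hβ
  have h1 : ∀ g x X, t (g • x) (tangentAction E g x X) = φ.toFun g x (t x X) := fun g x X => by
    refine C.eq_of_pairing_eq fun w => ?_
    obtain ⟨w, rfl⟩ := φ.toFun_surjective g x w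
    rw [ht, hinv, φ.pairing_toFun, ht]
  -- The isotropic correction is built from t, the pairing and the anchor alone, so invariance
  -- passes from t to s without a second averaging.
  refine ⟨s, fun g x X => C.eq_of_pairing_eq fun w => ?_⟩
  obtain ⟨w, rfl⟩ := φ.toFun_surjective g x w
  have h2 : C.anchor (g • x) (φ.toFun g x w) = tangentAction E g x (C.anchor x w) :=
    φ.anchor_toFun g x w
  rw [hst, h2, h1, h1, φ.pairing_toFun, φ.pairing_toFun, φ.pairing_toFun, hst]

variable {φ} {δ : GroupLieAlgebra 𝓘(ℝ, EG) G →ₗ[ℝ] SmoothSec E M F V}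

/-- An invariant splitting is infinitesimally invariant. -/
theorem IsIsotropicExtended.bracket_sec (hδ : φ.IsIsotropicExtended G δ)
    {s : C.IsotropicSplitting}
    (hs : ∀ g x X, s.toFun (g • x) (tangentAction E g x X) = φ.toFun g x (s.toFun x X))
    (τ : GroupLieAlgebra 𝓘(ℝ, EG) G) (Y : SmoothVF E M) :
    C.bracket (δ τ) (s.sec Y) = s.sec ⁅C.rho (δ τ), Y⁆ := by
  ext x
  refine C.eq_of_pairing_eq fun e => ?_
  obtain ⟨ι, hι⟩ := C.exists_linearEquiv_dual x
  -- The vector e' is the transpose of the projection s ∘ a applied to e. By invariance of s,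
  -- pairing s(Y) with g e or with g e' gives the same function of g. Comparing derivatives at 1
  -- shows that δ(τ) * s(Y) is fixed by s ∘ a, and `rho_bracket` computes its anchor.
  obtain ⟨e', he'⟩ : ∃ e', ∀ w, C.pairing x e' w = C.pairing x (s.toFun x (C.anchor x w)) e :=
    ⟨ι.symm ((C.pairing x).flip e ∘ₗ s.toFun x ∘ₗ C.anchor x), fun w => by
      rw [← hι, LinearEquiv.apply_symm_apply]; rfl⟩
  have h1 : (fun g : G => C.pairing (g • x) (s.sec Y (g • x)) (φ.toFun g x e)) =
      fun g : G => C.pairing (g • x) (s.sec Y (g • x)) (φ.toFun g x e') := by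
    funext g
    obtain ⟨W, hW⟩ := φ.tangentAction_surjective g x (Y (g • x))
    change C.pairing (g • x) (s.toFun (g • x) (Y (g • x))) _ =
      C.pairing (g • x) (s.toFun (g • x) (Y (g • x))) _
    rw [← hW, hs, φ.pairing_toFun, φ.pairing_toFun, C.pairing_symm x _ e', he', s.anchor_toFun]
  have h2 := hδ.bracket_eq τ (s.sec Y) x e
  rw [h1, hδ.bracket_eq τ (s.sec Y) x e', C.pairing_symm, he'] at h2
  have h3 : C.anchor x (C.bracket (δ τ) (s.sec Y) x) = ⁅C.rho (δ τ), Y⁆ x := by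
    have := C.rho_bracket (δ τ) (s.sec Y)
    rw [s.rho_sec] at this
    exact DFunLike.congr_fun this x
  rw [h3] at h2
  exact h2.symm

end ExactCourantAlgebroid.GroupAction

end

end Averaging

/-! ### Conclusion, with H_G taken at an invariant splitting. -/

theorem mainTheorem5
    {E : Type*} [NormedAddCommGroup E] [NormedSpace ℝ E] [FiniteDimensional ℝ E]
    {M : Type*} [TopologicalSpace M] [T2Space M] [SigmaCompactSpace M] [ChartedSpace E M]
    [IsManifold 𝓘(ℝ, E) ∞ M]
    {F : Type*} [NormedAddCommGroup F] [NormedSpace ℝ F] [FiniteDimensional ℝ F]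
    {V : M → Type*} [TopologicalSpace (Bundle.TotalSpace F V)] [∀ x, AddCommGroup (V x)]
    [∀ x, Module ℝ (V x)] [∀ x, TopologicalSpace (V x)] [FiberBundle F V] [VectorBundle ℝ F V]
    [ContMDiffVectorBundle ∞ F V 𝓘(ℝ, E)]
    (C : ExactCourantAlgebroid E F V)
    {EG : Type*} [NormedAddCommGroup EG] [NormedSpace ℝ EG] [FiniteDimensional ℝ EG]
    {G : Type*} [TopologicalSpace G] [T2Space G] [CompactSpace G] [ChartedSpace EG G] [Group G]
    [LieGroup 𝓘(ℝ, EG) ∞ G]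
    [MulAction G M] [ContMDiffSMul 𝓘(ℝ, EG) 𝓘(ℝ, E) ∞ G M]
    (φ : C.GroupAction EG G)
    (δ : GroupLieAlgebra 𝓘(ℝ, EG) G →ₗ[ℝ] SmoothSec E M F V)
    (hδ : φ.IsIsotropicExtended G δ)
    {r : ℕ} (b : Module.Basis (Fin r) ℝ (GroupLieAlgebra 𝓘(ℝ, EG) G)) :
    ∃ H : Series r (Forms (SmoothFun E M) (SmoothVF E M)),
      H.IsHomogeneous 3 ∧
      H ∈ Series.cartan (fun j => C.rho (δ (b j))) 1 ∧
      Series.cartanDiff (fun j => C.rho (δ (b j))) H = 0 ∧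
      IsoCohomology
        (C.equivDiff fun j => δ (b j)) (C.cartan fun j => δ (b j)) C.wedge
        (Series.twistedDiff (fun j => C.rho (δ (b j))) H)
        (Series.cartan fun j => C.rho (δ (b j))) (fun ρ α => Series.wedge ρ α)
        (Series.cartanDiff fun j => C.rho (δ (b j)))
        (Series.cartan fun j => C.rho (δ (b j))) ∧
      ((∀ τ σ : GroupLieAlgebra 𝓘(ℝ, EG) G, δ ⁅τ, σ⁆ = -C.bracket (δ τ) (δ σ)) →
        H ∈ Series.invariantCartan (fun j => C.rho (δ (b j))) (structureConstants b) 1 ∧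
        IsoCohomology
          (C.equivDiff fun j => δ (b j))
          (C.invariantCartan (fun j => δ (b j)) (structureConstants b)) C.wedge
          (Series.twistedDiff (fun j => C.rho (δ (b j))) H)
          (Series.invariantCartan (fun j => C.rho (δ (b j))) (structureConstants b))
          (fun ρ α => Series.wedge ρ α)
          (Series.cartanDiff fun j => C.rho (δ (b j)))
          (Series.invariantCartan (fun j => C.rho (δ (b j))) (structureConstants b))) := by
  obtain ⟨s, hs⟩ := φ.exists_invariant_isotropicSplitting
  have hw : ∀ j Y, C.bracket (δ (b j)) (s.sec Y) = s.sec ⁅C.rho (δ (b j)), Y⁆ :=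
    fun j Y => hδ.bracket_sec hs (b j) Y
  have hiso : ∀ i j, C.pair (δ (b i)) (δ (b j)) = 0 := fun i j => by
    ext x
    rw [C.pair_apply, hδ.isotropic, mul_zero]
    rfl
  refine ⟨s.equivTwist fun j => δ (b j), s.isHomogeneous_equivTwist _,
    s.equivTwist_mem_cartan _ hw hiso, s.cartanDiff_equivTwist _ hw hiso,
    s.isoCohomology_cartan _ hw, fun h => ⟨s.equivTwist_mem_invariantCartan _ hw fun i l => ?_,
      s.isoCohomology_invariantCartan _ hw _⟩⟩
  have h1 := h (b i) (b l)
  rw [← b.sum_repr ⁅b i, b l⁆, map_sum] at h1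
  simp only [map_smul] at h1
  exact (neg_eq_iff_eq_neg.2 h1).symm
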